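/- We work with primitive recursive set theory with infinity, $\mathsf{PRS}\omega$: its language has $\in$, $=$ and a function symbol for every construction of a primitive recursive set function (Jensen–Karp, with parameter $\omega$), and its axioms are extensionality, foundation (for sets), infinity and the defining axioms of the function symbols. **Definitions.** A predilator $D$ is a functor from the category $\mathsf{Nat}$ of the finite orders $n=\{0,\ldots,n-1\}$ and strictly increasing maps to linear orders and embeddings, which is monotone ($f\le g$ pointwise entails $D(f)\le D(g)$ pointwise), together with a natural transformation $\operatorname{supp}:D\Rightarrow[\cdot]^{<\omega}$ such that $\operatorname{supp}_n(\sigma)\subseteq\operatorname{rng}(f)$ implies $\sigma\in\operatorname{rng}(D(f))$, for $f:m\to n$ and $\sigma\in D(n)$. Its trace $\operatorname{Tr}(D)$ consists of the pairs $(\sigma,n)$ with $\sigma\in D(n)$ and $\operatorname{supp}_n(\sigma)=n$. For a linear order $X$, let $D(X)$ be the set of pairs $(\sigma,a)$ with $a\subseteq X$ finite and $(\sigma,|a|)\in\operatorname{Tr}(D)$, where $(\sigma,a)<(\tau,b)$ holds if $D(|\iota_a|)(\sigma)<D(|\iota_b|)(\tau)$ in $D(|a\cup b|)$ for the maps $|\iota_a|:|a|\to|a\cup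 b|$ and $|\iota_b|:|b|\to|a\cup b|$ induced by the inclusions; the support of $(\sigma,a)$ is $a$. We also write $(\sigma;a_0,\ldots,a_{k-1})$ for $(\sigma,a)$ when $a=\{a_0<\ldots<a_{k-1}\}$. A dilator is a predilator $D$ such that $D(X)$ is well-founded for every well order $X$. We say that $D$ is connected if $D\neq 0$ and for no $(\sigma,m),(\tau,n)\in\operatorname{Tr}(D)$ we have $D(f)(\sigma)<D(g)(\tau)$ for all embeddings $f:m\to m+n$ and $g:n\to m+n$. By $1$ we denote the constant dilator with one-element values (up to isomorphism). If $D\neq 1$ is connected and $(\sigma,n)\in\operatorname{Tr}(D)$, then $i(\sigma)$ is the unique $i<n$ such that $f(i)<g(i)$ implies $D(f)(\sigma)<D(g)(\sigma)$, for all embeddings $f,g:n\to 2n$. For an ordinal $\gamma$, the predilator $D^\gamma$ is given by $D^\gamma(X)=D(\gamma+X)$ and $D^\gamma(f)=D(\gamma+f)$, where the support of $(\sigma,a)$ in $D^\gamma(X)$ is $\{x\in X\mid\gamma+x\in a\}$. For connected $D\neq 1$, the subfunctors $D^\gamma_-$ and $D^\gamma_+$ of $D^\gamma$ consist of the elements $(\sigma;a_0,\ldots,a_{k-1})$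 with $a_{i(\sigma)}<\gamma$ and with $a_{i(\sigma)}\geq\gamma$, respectively. Put $$D_+^{\langle\rangle}=D,\qquad D_+^{\langle\gamma(0),\ldots,\gamma(n)\rangle}=\big(D_+^{\langle\gamma(0),\ldots,\gamma(n-1)\rangle}\big)^{\gamma(n)}_+,\qquad D_-^{\langle\gamma(0),\ldots,\gamma(n)\rangle}=\big(D_+^{\langle\gamma(0),\ldots,\gamma(n-1)\rangle}\big)^{\gamma(n)}_-.$$ An ordinal $\Omega$ is a $\psi$-fixed point of a predilator $D$ if there is an order embedding $\pi:\Omega\to D(\Omega)$ such that (1) $\alpha\in\operatorname{supp}_\Omega(\pi(\beta))$ implies $\alpha<\beta$, for all $\alpha,\beta<\Omega$, and (2) for every $\tau\in D(\Omega)$, if $\pi(\alpha)<\tau$ for all $\alpha\in\operatorname{supp}_\Omega(\tau)$, then $\tau\in\operatorname{rng}(\pi)$. If $D$ has a unique $\psi$-fixed point, it is denoted by $\psi D$. **Theorem.** The following is provable in $\mathsf{PRS}\omega$ (equivalently, it holds in every model of $\mathsf{PRS}\omega$). Let $D\neq 1$ be a connected dilator and let $\gamma$ be an ordinal. Assume that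 there is a sequence $(\gamma(n))_{n<\omega}$ of ordinals with $\gamma(0)=\gamma$ such that, for each $n<\omega$, the ordinal $\gamma(n+1)$ is a $\psi$-fixed point of $D_-^{\langle\gamma(0),\ldots,\gamma(n)\rangle}$. Then the ordinal $\sum_{n<\omega}\gamma(n+1)$ exists and is the unique $\psi$-fixed point of $D^\gamma$, i.e. $$\psi D^\gamma=\sum_{n<\omega}\gamma(n+1)\quad\text{with}\quad\gamma(0)=\gamma\text{ and }\gamma(n+1)=\psi D_-^{\langle\gamma(0),\ldots,\gamma(n)\rangle}.$$ -/

import Mathlib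

universe u

/-! ## Primitive recursive set theory with infinity

`PRSym n` is the type of `n`-ary function symbols of the language of `PRSω`: one symbol for each
construction of a primitive recursive set function (with `ω` as a parameter) from the initial
functions by composition and recursion over set membership. -/

inductive PRSym : ℕ → Type
  /-- the constant function with value `∅` -/
  | zero (n : ℕ) : PRSym n
  /-- the constant function with value `ω` -/
  | omega (n : ℕ) : PRSym n
  /-- `(x₀, …, xₙ₋₁) ↦ xᵢ` -/
  | proj {n : ℕ} (i : Fin n) : PRSym n
  /-- `(x₀, x₁) ↦ x₀ ∪ {x₁}` -/
  | adjoin : PRSym 2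
  /-- `(x₀, x₁, x₂, x₃) ↦ x₀` if `x₂ ∈ x₃`, and `x₁` otherwise -/
  | cases : PRSym 4
  /-- `x ↦ F (G₀ x, …, Gₘ₋₁ x)` -/
  | comp {m n : ℕ} (F : PRSym m) (G : Fin m → PRSym n) : PRSym n
  /-- `R (x, y) = H (⋃ {R (v, y) | v ∈ x}, x, y)` -/
  | recur {n : ℕ} (H : PRSym (n + 2)) : PRSym (n + 1)

/-- Models of `PRSω`: first-order structures for the language with `∈` and all the symbols above
that satisfy extensionality, foundation (for sets), infinity, and the defining axiom of each
function symbol. By the completeness theorem, a first-order statement is provable in `PRSω` if and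
only if it holds in all these structures. -/
class PRSModel (M : Type u) where
  /-- `mem x y` is `x ∈ y` in the model -/
  mem : M → M → Prop
  /-- the interpretation of the function symbols -/
  app : {n : ℕ} → PRSym n → (Fin n → M) → M
  extensionality : ∀ x y : M, (∀ z, mem z x ↔ mem z y) → x = y
  foundation : ∀ x : M, (∃ y, mem y x) → ∃ y, mem y x ∧ ∀ z, mem z y → ¬ mem z x
  app_zero : ∀ {n : ℕ} (v : Fin n → M) (z : M), ¬ mem z (app (PRSym.zero n) v)
  /-- infinity: `z ∈ ω` iff `z = ∅` or `z = y ∪ {y}` for some `y ∈ ω`; by foundation this determines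
  `ω` as the least inductive set -/
  app_omega : ∀ {n : ℕ} (v : Fin n → M) (z : M), mem z (app (PRSym.omega n) v) ↔
    z = app (PRSym.zero n) v ∨
      ∃ y, mem y (app (PRSym.omega n) v) ∧ z = app PRSym.adjoin ![y, y]
  app_proj : ∀ {n : ℕ} (i : Fin n) (v : Fin n → M), app (PRSym.proj i) v = v i
  app_adjoin : ∀ x y z : M, mem z (app PRSym.adjoin ![x, y]) ↔ mem z x ∨ z = y
  app_cases_pos : ∀ x₀ x₁ x₂ x₃ : M, mem x₂ x₃ → app PRSym.cases ![x₀, x₁, x₂, x₃] = x₀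
  app_cases_neg : ∀ x₀ x₁ x₂ x₃ : M, ¬ mem x₂ x₃ → app PRSym.cases ![x₀, x₁, x₂, x₃] = x₁
  app_comp : ∀ {m n : ℕ} (F : PRSym m) (G : Fin m → PRSym n) (v : Fin n → M),
    app (PRSym.comp F G) v = app F (fun i => app (G i) v)
  app_recur : ∀ {n : ℕ} (H : PRSym (n + 2)) (x : M) (y : Fin n → M),
    ∃ w : M, (∀ z, mem z w ↔ ∃ v, mem v x ∧ mem z (app (PRSym.recur H) (Fin.cons v y))) ∧
      app (PRSym.recur H) (Fin.cons x y) = app H (Fin.cons w (Fin.cons x y))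

namespace PRS

infix:50 " ∊ " => PRSModel.mem

/-! All notions from here on are the set-theoretic ones, read inside a model `M` of `PRSω`: every
quantifier ranges over the elements of `M`, and functions, sequences, subsets and orders that are
quantified over are elements of `M`. The auxiliary types `LO M` and `PD M` below bundle classes of
`M` that are given by formulas, so that no set existence is presupposed. -/

section Sets

variable {M : Type u} [PRSModel M]

/-- `∅` -/
def emp : M := PRSModel.app (PRSym.zero 0) ![]

/-- `ω` -/
def om : M := PRSModel.app (PRSym.omega 0) ![]

/-- `x ∪ {y}` -/
def adj (x y : M) : M := PRSModel.app PRSym.adjoin ![x, y]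

/-- `x ∪ {x}` -/
def suc (x : M) : M := adj x x

/-- the Kuratowski pair `{{x}, {x, y}}` -/
def pr (x y : M) : M := adj (adj emp (adj emp x)) (adj (adj emp x) y)

/-- `x` is a transitive set -/
def IsTrans (x : M) : Prop := ∀ y z : M, y ∊ x → z ∊ y → z ∊ x

/-- `α` is an ordinal: a transitive set of transitive sets -/
def IsOrd (α : M) : Prop := IsTrans α ∧ ∀ β : M, β ∊ α → IsTrans β

/-- `s` is a function with domain `α` -/
def IsSeq (s α : M) : Prop :=
  (∀ p, p ∊ s → ∃ k y, k ∊ α ∧ p = pr k y) ∧ ∀ k, k ∊ α → ∃! y, pr k y ∊ s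

end Sets

/-! ## Linear orders and embeddings -/

/-- A class of `M` with a binary relation on it. -/
structure LO (M : Type u) where
  car : M → Prop
  lt : M → M → Prop

namespace LO

variable {M : Type u} [PRSModel M]

/-- the order on the elements of an ordinal, given by membership -/
def ofOrd (α : M) : LO M where
  car x := x ∊ α
  lt x y := x ∊ y

/-- the order with field `X` whose order relation is the set `R` of pairs -/
def ofSet (X R : M) : LO M where
  car x := x ∊ X
  lt x y := pr x y ∊ R

/-- the copy of `x` in the left summand of a sum of orders -/
def inl (x : M) : M := pr emp x

/-- the copy of `y` in the right summand of a sum of orders (the element `X + y` of `X + Y`) -/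
def inr (y : M) : M := pr (suc emp) y

/-- the sum `A + B` of two orders -/
def add (A B : LO M) : LO M where
  car z := (∃ x, A.car x ∧ z = inl x) ∨ ∃ y, B.car y ∧ z = inr y
  lt z w :=
    (∃ x x', A.car x ∧ A.car x' ∧ A.lt x x' ∧ z = inl x ∧ w = inl x') ∨
    (∃ x y, A.car x ∧ B.car y ∧ z = inl x ∧ w = inr y) ∨
    (∃ y y', B.car y ∧ B.car y' ∧ B.lt y y' ∧ z = inr y ∧ w = inr y')

def IsLinear (A : LO M) : Prop :=
  (∀ x, A.car x → ¬ A.lt x x) ∧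
  (∀ x y z, A.car x → A.car y → A.car z → A.lt x y → A.lt y z → A.lt x z) ∧
  (∀ x y, A.car x → A.car y → A.lt x y ∨ x = y ∨ A.lt y x)

/-- every non-empty set of elements has a minimal element -/
def IsWellFounded (A : LO M) : Prop :=
  ∀ s : M, (∃ z, z ∊ s) → (∀ z, z ∊ s → A.car z) → ∃ z, z ∊ s ∧ ∀ w, w ∊ s → ¬ A.lt w z

/-- the set `h` is (the graph of) an order embedding of `A` into `B` -/
def Emb (A B : LO M) (h : M) : Prop :=
  (∀ p, p ∊ h → ∃ x y, A.car x ∧ B.car y ∧ p = pr x y) ∧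
  (∀ x, A.car x → ∃! y, pr x y ∊ h) ∧
  (∀ x x' y y', pr x y ∊ h → pr x' y' ∊ h → A.lt x x' → B.lt y y')

/-- the set `h` is (the graph of) an order isomorphism between `A` and `B` -/
def Iso (A B : LO M) (h : M) : Prop :=
  A.Emb B h ∧ ∀ y, B.car y → ∃ x, pr x y ∊ h

/-- `a` is a finite subset of `X` with `|a| = k`, and `e` is the increasing enumeration
`en_a : k → X` with range `a` -/
def Enum (X : LO M) (a k e : M) : Prop :=
  k ∊ om ∧ (ofOrd k).Emb X e ∧ ∀ x, x ∊ a ↔ ∃ i, pr i x ∊ e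

end LO

section Nat

variable {M : Type u} [PRSModel M]

/-- `f : m → n` is a morphism of `Nat`, the category of the orders `n = {0, …, n - 1}` with `n ∈ ω`
and strictly increasing maps -/
def Hom (m n f : M) : Prop := m ∊ om ∧ n ∊ om ∧ (LO.ofOrd m).Emb (LO.ofOrd n) f

/-- `N = m + n` for elements of `ω` -/
def NatSum (m n N : M) : Prop :=
  N ∊ om ∧ ∃ h, ((LO.ofOrd m).add (LO.ofOrd n)).Iso (LO.ofOrd N) h

end Nat

/-! ## Predilators -/

/-- The data of a predilator, as relations: `car n σ` is `σ ∈ D(n)`, `lt n σ τ` is `σ < τ` in `D(n)`,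
`map m n f σ τ` is `D(f)(σ) = τ` for `f : m → n`, and `supp n σ a` is `supp_n(σ) = a`. -/
structure PD (M : Type u) where
  car : M → M → Prop
  lt : M → M → M → Prop
  map : M → M → M → M → M → Prop
  supp : M → M → M → Prop

namespace PD

variable {M : Type u} [PRSModel M]

/-- the set that codes the four relations of a predilator -/
def code (C L F S : M) : M := pr C (pr L (pr F S))

/-- the predilator data coded by a set `d` -/
def ofSet (d : M) : PD M where
  car n σ := ∃ C L F S, d = code C L F S ∧ pr n σ ∊ C
  lt n σ τ := ∃ C L F S, d = code C L F S ∧ pr n (pr σ τ) ∊ L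
  map m n f σ τ := ∃ C L F S, d = code C L F S ∧ pr m (pr n (pr f (pr σ τ))) ∊ F
  supp n σ a := ∃ C L F S, d = code C L F S ∧ pr n (pr σ a) ∊ S

/-- the set `d` is the code of the predilator data `D` -/
def IsCode (D : PD M) (d : M) : Prop :=
  ∃ C L F S, d = code C L F S ∧
    (∀ z, z ∊ C ↔ ∃ n σ, D.car n σ ∧ z = pr n σ) ∧
    (∀ z, z ∊ L ↔ ∃ n σ τ, D.lt n σ τ ∧ z = pr n (pr σ τ)) ∧
    (∀ z, z ∊ F ↔ ∃ m n f σ τ, D.map m n f σ τ ∧ z = pr m (pr n (pr f (pr σ τ)))) ∧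
    (∀ z, z ∊ S ↔ ∃ n σ a, D.supp n σ a ∧ z = pr n (pr σ a))

/-- `D` is a predilator: a monotone functor from `Nat` to linear orders and embeddings, with a
natural transformation `supp : D ⇒ [·]^{<ω}` that satisfies the support condition. -/
structure IsPredilator (D : PD M) : Prop where
  car_dom : ∀ n σ, D.car n σ → n ∊ om
  lt_dom : ∀ n σ τ, D.lt n σ τ → D.car n σ ∧ D.car n τ
  map_dom : ∀ m n f σ τ, D.map m n f σ τ → Hom m n f ∧ D.car m σ ∧ D.car n τ
  supp_dom : ∀ n σ a, D.supp n σ a → D.car n σ ∧ ∀ i, i ∊ a → i ∊ n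
  /-- each `D(n)` is a linear order -/
  linear : ∀ n, n ∊ om → (LO.mk (D.car n) (D.lt n)).IsLinear
  /-- each `D(f)` is a function ... -/
  map_total : ∀ m n f σ, Hom m n f → D.car m σ → ∃! τ, D.map m n f σ τ
  /-- ... and an order embedding -/
  map_lt : ∀ m n f σ σ' τ τ', D.map m n f σ τ → D.map m n f σ' τ' → D.lt m σ σ' → D.lt n τ τ'
  map_id : ∀ n f σ, Hom n n f → (∀ i, i ∊ n → pr i i ∊ f) → D.car n σ → D.map n n f σ σ
  map_comp : ∀ l m n f g h σ τ ρ, Hom l n h →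
    (∀ i j k, pr i j ∊ f → pr j k ∊ g → pr i k ∊ h) →
    D.map l m f σ τ → D.map m n g τ ρ → D.map l n h σ ρ
  /-- `f ≤ g` entails `D(f) ≤ D(g)` -/
  monotone : ∀ m n f g σ τ τ', (∀ i j j', pr i j ∊ f → pr i j' ∊ g → j = j' ∨ j ∊ j') →
    D.map m n f σ τ → D.map m n g σ τ' → τ = τ' ∨ D.lt n τ τ'
  supp_total : ∀ n σ, D.car n σ → ∃! a, D.supp n σ a
  /-- `supp_n (D(f)(σ)) = f[supp_m(σ)]` -/
  supp_nat : ∀ m n f σ τ a b, D.map m n f σ τ → D.supp m σ a → D.supp n τ b →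
    ∀ j, j ∊ b ↔ ∃ i, i ∊ a ∧ pr i j ∊ f
  /-- the support condition: elements whose support is contained in the range of `f` lie in the
  range of `D(f)` -/
  supp_range : ∀ m n f τ b, Hom m n f → D.supp n τ b → (∀ j, j ∊ b → ∃ i, pr i j ∊ f) →
    ∃ σ, D.map m n f σ τ

/-- `(σ, n) ∈ Tr(D)` -/
def Tr (D : PD M) (σ n : M) : Prop := D.car n σ ∧ D.supp n σ n

/-- `D(f)(σ) < D(g)(τ)` in `D(N)`, for `f : m → N` and `g : n → N` -/
def MapLt (D : PD M) (m n N f g σ τ : M) : Prop :=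
  ∃ σ' τ', D.map m N f σ σ' ∧ D.map n N g τ τ' ∧ D.lt N σ' τ'

/-- The extension of `D` to arbitrary orders: the elements of `D(X)` are the pairs `(σ, a)` of a
finite `a ⊆ X` and a trace element `(σ, |a|)`, and `(σ, a) < (τ, b)` is decided in `D(|a ∪ b|)`, via
the morphisms `f = |a ↪ a ∪ b|` and `g = |b ↪ a ∪ b|`. The support of `(σ, a)` is `a`. -/
def ext (D : PD M) (X : LO M) : LO M where
  car z := ∃ σ a k e, z = pr σ a ∧ X.Enum a k e ∧ D.Tr σ k
  lt z w := ∃ σ a τ b c, z = pr σ a ∧ w = pr τ b ∧ (∀ x, x ∊ c ↔ x ∊ a ∨ x ∊ b) ∧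
    ∃ ka ea kb eb kc ec f g, X.Enum a ka ea ∧ X.Enum b kb eb ∧ X.Enum c kc ec ∧
      Hom ka kc f ∧ Hom kb kc g ∧
      (∀ i j x, pr i j ∊ f → pr i x ∊ ea → pr j x ∊ ec) ∧
      (∀ i j x, pr i j ∊ g → pr i x ∊ eb → pr j x ∊ ec) ∧
      D.MapLt ka kb kc f g σ τ

/-- `D` is a dilator: a predilator such that `D(X)` is well-founded for every well order `X`. -/
def IsDilator (D : PD M) : Prop :=
  D.IsPredilator ∧ ∀ X R : M, (LO.ofSet X R).IsLinear → (LO.ofSet X R).IsWellFounded →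
    (D.ext (LO.ofSet X R)).IsWellFounded

/-- `(σ, m) ≪ (τ, n)`: all embeddings `f : m → m + n` and `g : n → m + n` validate
`D(f)(σ) < D(g)(τ)` -/
def Below (D : PD M) (σ m τ n : M) : Prop :=
  ∀ N f g, NatSum m n N → Hom m N f → Hom n N g → D.MapLt m n N f g σ τ

/-- `D` is connected: `D ≠ 0`, and no two trace elements are comparable with respect to `≪` -/
def IsConnected (D : PD M) : Prop :=
  (∃ n σ, D.car n σ) ∧
    ∀ σ m τ n, D.Tr σ m → D.Tr τ n → ¬ D.Below σ m τ n ∧ ¬ D.Below τ n σ m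

/-- `D` is (isomorphic to) the constant dilator `1` -/
def IsOne (D : PD M) : Prop := ∀ n, n ∊ om → ∃! σ, D.car n σ

/-- `i = i(σ)`, for a trace element `(σ, n)`: all embeddings `f, g : n → 2n` with `f(i) < g(i)`
validate `D(f)(σ) < D(g)(σ)` -/
def Lead (D : PD M) (σ n i : M) : Prop :=
  i ∊ n ∧ ∀ N f g, NatSum n n N → Hom n N f → Hom n N g →
    (∀ x y, pr i x ∊ f → pr i y ∊ g → x ∊ y) → D.MapLt n n N f g σ σ

/-! ### Separation of variables -/

/-- the order `γ + n` -/
def base (γ n : M) : LO M := (LO.ofOrd γ).add (LO.ofOrd n)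

/-- The predilator `D^γ` with `D^γ(n) = D(γ + n)` and `D^γ(f) = D(γ + f)`, in which the support of
`(σ, a)` consists of all `x` such that the element `γ + x` of the right summand lies in `a`. -/
def shift (D : PD M) (γ : M) : PD M where
  car n z := n ∊ om ∧ (D.ext (base γ n)).car z
  lt n z w := n ∊ om ∧ (D.ext (base γ n)).car z ∧ (D.ext (base γ n)).car w ∧
    (D.ext (base γ n)).lt z w
  map m n f z w := Hom m n f ∧ (D.ext (base γ m)).car z ∧
    ∃ σ a b, z = pr σ a ∧ w = pr σ b ∧
      ∀ y, y ∊ b ↔ (y ∊ a ∧ ∃ x, x ∊ γ ∧ y = LO.inl x) ∨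
        ∃ i j, LO.inr i ∊ a ∧ pr i j ∊ f ∧ y = LO.inr j
  supp n z c := n ∊ om ∧ (D.ext (base γ n)).car z ∧
    ∃ σ a, z = pr σ a ∧ ∀ i, i ∊ c ↔ i ∊ n ∧ LO.inr i ∊ a

/-- the restriction of `D` to the elements `z` of `D(n)` with `Q n z` -/
def restrict (D : PD M) (Q : M → M → Prop) : PD M where
  car n z := D.car n z ∧ Q n z
  lt n z w := D.lt n z w ∧ Q n z ∧ Q n w
  map m n f z w := D.map m n f z w ∧ Q m z ∧ Q n w
  supp n z c := D.supp n z c ∧ Q n z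

/-- `z = (σ; a₀, …, aₖ₋₁) ∈ D(γ + n)`, and `y` is the element `a_{i(σ)}` of `γ + n` -/
def LeadArg (D : PD M) (γ n z y : M) : Prop :=
  ∃ σ a k e i, z = pr σ a ∧ (base γ n).Enum a k e ∧ D.Lead σ k i ∧ pr i y ∊ e

/-- `D^γ_-`: the elements `(σ; a₀, …, aₖ₋₁)` of `D^γ` with `a_{i(σ)} < γ` -/
def minus (D : PD M) (γ : M) : PD M :=
  (D.shift γ).restrict fun n z => ∃ x, x ∊ γ ∧ D.LeadArg γ n z (LO.inl x)

/-- `D^γ_+`: the elements `(σ; a₀, …, aₖ₋₁)` of `D^γ` with `a_{i(σ)} ≥ γ` -/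
def plus (D : PD M) (γ : M) : PD M :=
  (D.shift γ).restrict fun n z => ∃ x, x ∊ n ∧ D.LeadArg γ n z (LO.inr x)

/-- For a predilator coded by `d` and a sequence `g` of ordinals, `e` is the code of the iterate
`D_+^{⟨g(0), …, g(n-1)⟩}`: there is a sequence `s` of length `n + 1` with `s(0) = d` and
`s(n) = e`, such that `s(k+1)` codes `(s(k))_+^{g(k)}` for `k < n`. -/
def IterPlus (d g n e : M) : Prop :=
  ∃ s, IsSeq s (suc n) ∧ pr emp d ∊ s ∧ pr n e ∊ s ∧
    ∀ k x y c, k ∊ n → pr k x ∊ s → pr (suc k) y ∊ s → pr k c ∊ g →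
      ((ofSet x).plus c).IsCode y

/-- `Ω` is a `ψ`-fixed point of `D` -/
def IsPsiFixedPoint (D : PD M) (Ω : M) : Prop :=
  IsOrd Ω ∧ ∃ π, (LO.ofOrd Ω).Emb (D.ext (LO.ofOrd Ω)) π ∧
    (∀ α β σ a, pr β (pr σ a) ∊ π → α ∊ a → α ∊ β) ∧
    (∀ σ a, (D.ext (LO.ofOrd Ω)).car (pr σ a) →
      (∀ α z, α ∊ a → pr α z ∊ π → (D.ext (LO.ofOrd Ω)).lt z (pr σ a)) →
      ∃ β, pr β (pr σ a) ∊ π)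

end PD

section Sum

variable {M : Type u} [PRSModel M]

/-- the lexicographic order on the pairs `(n, ξ)` with `n < ω` and `ξ < g(n+1)` -/
def lexSum (g : M) : LO M where
  car z := ∃ n ξ c, n ∊ om ∧ pr (suc n) c ∊ g ∧ ξ ∊ c ∧ z = pr n ξ
  lt z w := ∃ n ξ m ζ, z = pr n ξ ∧ w = pr m ζ ∧ (n ∊ m ∨ (n = m ∧ ξ ∊ ζ))

/-- `S` is the ordinal `Σ_{n<ω} g(n+1)` -/
def IsOrdSum (g S : M) : Prop := IsOrd S ∧ ∃ h, (lexSum g).Iso (LO.ofOrd S) h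

end Sum

end PRS

/-! Why the theorem holds. Connectedness and D ≠ 1 yield leading arguments that dominate all
comparisons: (σ;a) < (τ;b) holds in D(X) as soon as the leading argument of the first lies below
that of the second. This is the property `Led`. To prove it, `exists_sLead` finds i(σ) as a
threshold in a list of interleaved embeddings, and `led_of_connected` uses two embeddings that
witness the failure of ≪, placed between the leading arguments. The property passes from D to D_+^γ
(`Led.plus`) and hence to all iterates.

Arrange the ordinals γ(n) as consecutive blocks of one order, the order `lex g` on the pairs (n, ξ)
with ξ < γ(n). By dominance, D(lex g) is ordered first by the block of the leading argument. When
the iterated separation of variables is unravelled (`Split`, `J`), the elements of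
D_-^{⟨γ(0),…,γ(n)⟩}(γ(n+1)) become those elements of D(γ(0)+…+γ(n+1)) that have their leading
argument in block n. So the embedding that makes γ(n+1) a ψ-fixed point lists elements with leading
argument in block n, indexed by block n+1 (`Blk`).

These lists, one after the other, embed the sum S of the γ(n+1) into D(γ+S). The support condition
holds because the arguments of an element listed at (n+1, ξ) lie in the blocks up to n, or in block
n+1 below ξ. For the range condition, let τ exceed the values at all its arguments from S and have
its leading argument in block n. An argument in block m+1 with m > n would have a value with leading
argument in block m, and that value would exceed τ. So τ only has arguments in the blocks up to n+1,
and the range condition for γ(n+1) applies (`isPsiFixedPoint_psum`). Uniqueness (`psi_unique`) holds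
since the embeddings for two fixed points α < β agree on α, so that the value of the larger one at α
would be attained twice.

In PRSω, set formation and induction must be confined to primitive recursive functions and
relations; the predicate `PR` keeps track of these. In particular, embeddings for all n cannot be
chosen simultaneously. Instead, `blockFun` computes the list for block n by recursion: the next
entry is the least admissible element above all previous ones. By `Blk.eq_blockFun`, any list
obtained from a fixed point coincides with the computed one. The descent from the n-th iterate to D
is an induction on k ≤ n (`blk_blockFun`), which is legitimate because the bounded versions of the
notions (`BLed`, `Cand`, `Blk`) are primitive recursive. -/

noncomputable section

open scoped Classical

/-! ### Primitive recursive functions of a model, with parameters -/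

namespace PRS

/-- types whose elements are coded by finite tuples of elements of `M` -/
class Enc (M : Type u) (A : Type*) where
  n : ℕ
  enc : A → Fin n → M

instance encSelf (M : Type u) : Enc M M where
  n := 1
  enc x _ := x

instance encProd (M : Type u) (A B : Type*) [Enc M A] [Enc M B] : Enc M (A × B) where
  n := Enc.n M A + Enc.n M B
  enc x := Fin.append (Enc.enc x.1) (Enc.enc x.2)

instance encProp (M : Type u) [PRSModel M] : Enc M Prop where
  n := 1
  enc P _ := if P then suc emp else emp

instance encUnit (M : Type u) : Enc M Unit where
  n := 0
  enc _ := Fin.elim0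

section PRM

variable {M : Type u} [PRSModel M] {A B C : Type*} [Enc M A] [Enc M B] [Enc M C]

/-- the primitive recursive functions `A → M`, with parameters from `M` -/
inductive PRM : (A → M) → Prop
  | coord (j : Fin (Enc.n M A)) : PRM (fun a => Enc.enc a j)
  | const (c : M) : PRM (fun _ => c)
  | app {m : ℕ} (F : PRSym m) (g : Fin m → A → M) (h : ∀ i, PRM (g i)) :
      PRM (fun a => PRSModel.app F (fun i => g i a))

theorem PRM.comp {f : B → M} {h : A → B} (hf : PRM f)
    (hh : ∀ j, PRM (fun a => Enc.enc (M := M) (h a) j)) : PRM (fun a => f (h a)) := by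
  induction hf with
  | coord j => exact hh j
  | const c => exact PRM.const c
  | app F g _ ih => exact PRM.app F _ ih

/-- The symbol for recursion expects the union of the previous values and the recursion variable in
its first two places. All other data, including constants from the model, must therefore be moved
into trailing parameters. An application concatenates the parameter lists of its arguments, whence
the sum of the `k i`. -/
theorem PRM.normalForm {f : (A × M) × M → M} (hf : PRM f) :
    ∃ (k : ℕ) (F : PRSym (k + 2)) (y : Fin k → A → M), (∀ i, PRM (y i)) ∧
      ∀ a w x, f ((a, w), x) =
        PRSModel.app F (Fin.cons w (Fin.cons x (fun i => y i a) : Fin (k + 1) → M)) := by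
  induction hf with
  | coord j =>
    refine Fin.addCases (fun j => ?_) (fun j => ?_) j
    · refine Fin.addCases (fun j => ?_) (fun j => ?_) j
      · refine ⟨1, PRSym.proj 2, fun _ a => Enc.enc a j, fun _ => PRM.coord j, fun a w x => ?_⟩
        rw [PRSModel.app_proj]
        show Fin.append (Fin.append _ _) _ _ = _
        rw [Fin.append_left, Fin.append_left]
        rfl
      · refine ⟨0, PRSym.proj 0, fun i => i.elim0, fun i => i.elim0, fun a w x => ?_⟩
        rw [PRSModel.app_proj]
        show Fin.append (Fin.append _ _) _ _ = _
        rw [Fin.append_left, Fin.append_right]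
        rfl
    · refine ⟨0, PRSym.proj 1, fun i => i.elim0, fun i => i.elim0, fun a w x => ?_⟩
      rw [PRSModel.app_proj]
      show Fin.append _ _ _ = _
      rw [Fin.append_right]
      rfl
  | const c =>
    refine ⟨1, PRSym.proj 2, fun _ _ => c, fun _ => PRM.const c, fun a w x => ?_⟩
    rw [PRSModel.app_proj]
    rfl
  | @app m F g _ ih =>
    choose k G y hy hG using ih
    refine ⟨∑ i, k i, PRSym.comp F (fun i => PRSym.comp (G i)
      (Fin.cons (PRSym.proj 0) (Fin.cons (PRSym.proj 1)
        (fun l => PRSym.proj (finSigmaFinEquiv ⟨i, l⟩).succ.succ) : Fin (k i + 1) → _))),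
      fun l => y (finSigmaFinEquiv.symm l).1 (finSigmaFinEquiv.symm l).2, fun l => hy _ _,
      fun a w x => ?_⟩
    rw [PRSModel.app_comp]
    show PRSModel.app F _ = _
    congr 1
    funext i
    rw [hG, PRSModel.app_comp]
    congr 1
    funext l
    refine Fin.cases ?_ (fun l => ?_) l
    · simp [PRSModel.app_proj]
    · refine Fin.cases ?_ (fun l => ?_) l
      · simp only [Fin.cons_succ, Fin.cons_zero, PRSModel.app_proj]
        rfl
      · simp only [Fin.cons_succ, PRSModel.app_proj]
        have : ∀ p : (Σ i, Fin (k i)), p = ⟨i, l⟩ → y i l a = y p.1 p.2 a := by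
          rintro _ rfl; rfl
        exact this _ (by simp)

end PRM

/-- primitive recursive functions and relations with parameters from `M` -/
@[fun_prop]
def PR (M : Type u) [PRSModel M] {A B : Type*} [Enc M A] [Enc M B] (f : A → B) : Prop :=
  ∀ j, PRM (fun a => Enc.enc (M := M) (f a) j)

/-! ### Closure properties: Boolean operations, recursion, bounded quantifiers, pairs -/

section Basic

variable {M : Type u} [PRSModel M] {A B C : Type*} [Enc M A] [Enc M B] [Enc M C]

theorem PR_M {f : A → M} : PR M f ↔ PRM f := ⟨fun h => h 0, fun h _ => h⟩

@[fun_prop]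
theorem PR.id : PR M (fun a : A => a) := fun j => PRM.coord j

@[fun_prop]
theorem PR.constM (c : M) : PR M (fun _ : A => c) := fun _ => PRM.const c

@[fun_prop]
theorem PR.comp {f : B → C} {h : A → B} (hf : PR M f) (hh : PR M h) :
    PR M (fun a => f (h a)) := fun j => PRM.comp (hf j) hh

@[fun_prop]
theorem PR.prodMk {f : A → B} {h : A → C} (hf : PR M f) (hh : PR M h) :
    PR M (fun a => (f a, h a)) := fun j => by
  show PRM fun a => Fin.append _ _ j
  refine Fin.addCases (fun j => ?_) (fun j => ?_) j
  · simpa only [Fin.append_left] using hf j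
  · simpa only [Fin.append_right] using hh j

@[fun_prop]
theorem PR.fst' : PR M (fun p : A × B => p.1) := fun j => by
  have := PRM.coord (M := M) (A := A × B) (Fin.castAdd _ j)
  convert this using 2
  exact (Fin.append_left _ _ _).symm

@[fun_prop]
theorem PR.snd' : PR M (fun p : A × B => p.2) := fun j => by
  have := PRM.coord (M := M) (A := A × B) (Fin.natAdd _ j)
  convert this using 2
  exact (Fin.append_right _ _ _).symm

@[fun_prop]
theorem PR.fst {f : A → B × C} (hf : PR M f) : PR M (fun a => (f a).1) :=
  PR.comp (M := M) (f := fun p : B × C => p.1) PR.fst' hf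

@[fun_prop]
theorem PR.snd {f : A → B × C} (hf : PR M f) : PR M (fun a => (f a).2) :=
  PR.comp (M := M) (f := fun p : B × C => p.2) PR.snd' hf

theorem PRM.app_vec {m : ℕ} (F : PRSym m) (g : Fin m → A → M) (v : A → Fin m → M)
    (h : ∀ i, PRM (g i)) (hv : ∀ a i, v a i = g i a) : PRM (fun a => PRSModel.app F (v a)) := by
  have := PRM.app F g h
  convert this using 3
  exact funext (hv _)

theorem ext {x y : M} (h : ∀ z, z ∊ x ↔ z ∊ y) : x = y := PRSModel.extensionality x y h

theorem notMem_emp {x : M} : ¬ x ∊ (emp : M) := PRSModel.app_zero _ _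

theorem mem_adj {x y z : M} : z ∊ adj x y ↔ z ∊ x ∨ z = y := PRSModel.app_adjoin _ _ _

@[fun_prop]
theorem PR.adj {f g : A → M} (hf : PR M f) (hg : PR M g) : PR M (fun a => adj (f a) (g a)) := by
  rw [PR_M] at *
  refine PRM.app_vec PRSym.adjoin ![f, g] _ ?_ ?_
  · intro i; fin_cases i <;> assumption
  · intro a i; fin_cases i <;> rfl

@[fun_prop]
theorem PR.suc {f : A → M} (hf : PR M f) : PR M (fun a => suc (f a)) := PR.adj hf hf

theorem mem_suc {x z : M} : z ∊ suc x ↔ z ∊ x ∨ z = x := mem_adj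

theorem notMem_self (x : M) : ¬ x ∊ x := by
  intro h
  obtain ⟨y, hy, hmin⟩ := PRSModel.foundation (adj emp x) ⟨x, mem_adj.2 (Or.inr rfl)⟩
  obtain hy | rfl := mem_adj.1 hy
  · exact notMem_emp hy
  · exact hmin y h (mem_adj.2 (Or.inr rfl))

theorem cases_eq (x₀ x₁ x₂ x₃ : M) :
    PRSModel.app PRSym.cases ![x₀, x₁, x₂, x₃] = if x₂ ∊ x₃ then x₀ else x₁ := by
  split_ifs with h
  · exact PRSModel.app_cases_pos _ _ _ _ h
  · exact PRSModel.app_cases_neg _ _ _ _ h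

theorem PR.ite_mem {f g h k : A → M} (hf : PR M f) (hg : PR M g) (hh : PR M h) (hk : PR M k) :
    PR M (fun a => if h a ∊ k a then f a else g a) := by
  rw [PR_M] at *
  simp_rw [← cases_eq]
  refine PRM.app_vec PRSym.cases ![f, g, h, k] _ ?_ ?_
  · intro i; fin_cases i <;> assumption
  · intro a i; fin_cases i <;> rfl

@[fun_prop]
theorem PR.mem {f g : A → M} (hf : PR M f) (hg : PR M g) : PR M (fun a => f a ∊ g a) :=
  fun _ => PR_M.1 (PR.ite_mem (PR.constM (PRS.suc emp)) (PR.constM emp) hf hg)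

theorem PR.coded {P : A → Prop} (hP : PR M P) :
    PR M (fun a => if P a then PRS.suc emp else (emp : M)) := fun _ => hP 0

theorem coded_iff {P : Prop} : (emp : M) ∊ (if P then suc emp else emp) ↔ P := by
  split_ifs with h
  · simp [h, mem_suc]
  · simp [h, notMem_emp]

@[fun_prop]
theorem PR.ite {P : A → Prop} {f g : A → M} (hP : PR M P) (hf : PR M f) (hg : PR M g) :
    PR M (fun a => if P a then f a else g a) := by
  have := PR.ite_mem hf hg (PR.constM (emp : M)) hP.coded
  simpa only [coded_iff] using this

theorem PR.congr {P Q : A → Prop} (hQ : PR M Q) (h : ∀ a, P a ↔ Q a) : PR M P := by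
  have : P = Q := funext fun a => propext (h a)
  rwa [this]

@[fun_prop]
theorem PR.eq {f g : A → M} (hf : PR M f) (hg : PR M g) : PR M (fun a => f a = g a) :=
  PR.congr (PR.mem hf (PR.adj (PR.constM emp) hg)) fun a => by simp [mem_adj, notMem_emp]

@[fun_prop]
theorem PR.not {P : A → Prop} (hP : PR M P) : PR M (fun a => ¬ P a) :=
  PR.congr (PR.eq hP.coded (PR.constM emp)) fun a => by
    split_ifs with h
    · simp only [h, not_true_eq_false, false_iff]
      intro h
      have h' : (emp : M) ∊ PRS.suc emp := mem_suc.2 (Or.inr rfl)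
      exact notMem_emp (h ▸ h')
    · simp [h]

@[fun_prop]
theorem PR.and {P Q : A → Prop} (hP : PR M P) (hQ : PR M Q) : PR M (fun a => P a ∧ Q a) :=
  PR.congr (PR.mem (PR.constM emp) (PR.ite hP hQ.coded (PR.constM emp))) fun a => by
    by_cases h : P a <;> simp [h, coded_iff, notMem_emp]

@[fun_prop]
theorem PR.or {P Q : A → Prop} (hP : PR M P) (hQ : PR M Q) : PR M (fun a => P a ∨ Q a) :=
  PR.congr (PR.not (PR.and hP.not hQ.not)) fun a => by tauto

@[fun_prop]
theorem PR.iff {P Q : A → Prop} (hP : PR M P) (hQ : PR M Q) : PR M (fun a => P a ↔ Q a) :=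
  PR.congr (PR.or (PR.and hP hQ) (PR.and hP.not hQ.not)) fun a => by tauto

@[fun_prop]
theorem PR.imp {P Q : A → Prop} (hP : PR M P) (hQ : PR M Q) : PR M (fun a => P a → Q a) :=
  PR.congr (PR.or hP.not hQ) fun a => by tauto

/-! ### Recursion -/

theorem PR.recursion_union {f : (A × M) × M → M} (hf : PR M f) :
    ∃ R : A × M → M, PR M R ∧ ∀ a x, ∃ w, (∀ z, z ∊ w ↔ ∃ v, v ∊ x ∧ z ∊ R (a, v)) ∧
      R (a, x) = f ((a, w), x) := by
  obtain ⟨k, F, y, hy, hF⟩ := PRM.normalForm (PR_M.1 hf)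
  refine ⟨fun p => PRSModel.app (PRSym.recur F)
    (Fin.cons p.2 (fun i => y i p.1) : Fin (k + 1) → M), PR_M.2 ?_, fun a x => ?_⟩
  · refine PRM.app_vec _ (Fin.cons (fun p => p.2) (fun i p => y i p.1)) _ ?_ ?_
    · intro i
      refine Fin.cases ?_ (fun i => ?_) i
      · exact (PR_M (M := M) (A := A × M) (f := fun p => p.2)).1 PR.snd'
      · exact PRM.comp (h := fun p : A × M => p.1) (hy i) (PR.fst' (M := M))
    · intro p i
      refine Fin.cases ?_ (fun i => ?_) i <;> rfl
  · obtain ⟨w, hw, h⟩ := PRSModel.app_recur F x (fun i => y i a)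
    exact ⟨w, hw, by rw [hF]; exact h⟩

/-- `⋃ {f z | z ∈ x}` -/
def iU (x : M) (f : M → M) : M :=
  if h : ∃ y, ∀ z, z ∊ y ↔ ∃ v, v ∊ x ∧ z ∊ f v then h.choose else emp

/-- Unions of families are extracted from recursion on membership. With `x` as a parameter, the
recursion returns `f v` at each `v ∊ x` and the union of the previous values elsewhere. Since `x ∊
x` fails, the value at `x` itself is the desired union. -/
theorem exists_iU {f : A × M → M} (hf : PR M f) :
    ∃ R : A × M → M, PR M R ∧ ∀ a x z, z ∊ R (a, x) ↔ ∃ v, v ∊ x ∧ z ∊ f (a, v) := by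
  obtain ⟨R, hR, h⟩ := PR.recursion_union (M := M) (A := A × M)
    (f := fun p => if p.2 ∊ p.1.1.2 then f (p.1.1.1, p.2) else p.1.2) (by
      refine PR.ite (by fun_prop) ?_ (by fun_prop)
      exact PR.comp hf (by fun_prop))
  refine ⟨fun p => R ((p.1, p.2), p.2), PR.comp hR (by fun_prop), fun a x z => ?_⟩
  obtain ⟨w, hw, hx⟩ := h (a, x) x
  simp only [notMem_self, if_false] at hx
  simp only [hx, hw]
  refine exists_congr fun v => and_congr_right fun hv => ?_
  obtain ⟨w', -, hx'⟩ := h (a, x) v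
  simp only [hv, if_true] at hx'
  rw [hx']

theorem mem_iU {x z : M} {f : M → M} (hf : PR M f) : z ∊ iU x f ↔ ∃ v, v ∊ x ∧ z ∊ f v := by
  obtain ⟨R, -, h⟩ := exists_iU (M := M) (A := Unit) (f := fun p => f p.2) (PR.comp hf PR.snd')
  have h' : ∃ y, ∀ z, z ∊ y ↔ ∃ v, v ∊ x ∧ z ∊ f v := ⟨_, h () x⟩
  unfold iU
  rw [dif_pos h']
  exact h'.choose_spec z

theorem PR.const_left {B C D : Type*} [Enc M B] [Enc M C] [Enc M D] {f : B × C → D} (hf : PR M f)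
    (b : B) : PR M (fun c => f (b, c)) := by
  refine PR.comp (f := f) (h := fun c => (b, c)) hf (fun j => ?_)
  show PRM fun a => Fin.append _ _ j
  refine Fin.addCases (fun j => ?_) (fun j => ?_) j
  · simpa only [Fin.append_left] using PRM.const _
  · simpa only [Fin.append_right] using PRM.coord j

@[fun_prop]
theorem PR.iU {t : A → M} {f : A → M → M} (ht : PR M t) (hf : PR M (fun p : A × M => f p.1 p.2)) :
    PR M (fun a => iU (t a) (f a)) := by
  obtain ⟨R, hR, h⟩ := exists_iU hf
  have : (fun a => PRS.iU (t a) (f a)) = fun a => R (a, t a) := by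
    funext a
    refine ext fun z => ?_
    rw [mem_iU (PR.const_left hf a), h]
  rw [this]
  exact PR.comp hR (by fun_prop)

def sing (x : M) : M := adj emp x
def pair (x y : M) : M := adj (sing x) y
def sU (x : M) : M := iU x (fun z => z)
def union (x y : M) : M := sU (pair x y)
def sep (x : M) (P : M → Prop) : M := iU x (fun z => if P z then sing z else emp)
def img (x : M) (f : M → M) : M := iU x (fun z => sing (f z))
-- Bounded quantifiers are named operations, so that `fun_prop` can recognise them. Proving a
-- formula to be `PR` then amounts to writing it with these bounds.
def BEx (x : M) (P : M → Prop) : Prop := ∃ z, z ∊ x ∧ P z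
def BAll (x : M) (P : M → Prop) : Prop := ∀ z, z ∊ x → P z
def times (x y : M) : M := iU x (fun a => img y (fun b => pr a b))

@[fun_prop] theorem PR.sing {f : A → M} (hf : PR M f) : PR M (fun a => sing (f a)) := by
  unfold PRS.sing; fun_prop

@[fun_prop] theorem PR.pair {f g : A → M} (hf : PR M f) (hg : PR M g) :
    PR M (fun a => pair (f a) (g a)) := by unfold PRS.pair; fun_prop

@[fun_prop] theorem PR.sU {f : A → M} (hf : PR M f) : PR M (fun a => sU (f a)) := by
  unfold PRS.sU; fun_prop

@[fun_prop] theorem PR.union {f g : A → M} (hf : PR M f) (hg : PR M g) :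
    PR M (fun a => union (f a) (g a)) := by unfold PRS.union; fun_prop

@[fun_prop] theorem PR.sep {t : A → M} {P : A → M → Prop} (ht : PR M t)
    (hP : PR M (fun p : A × M => P p.1 p.2)) : PR M (fun a => sep (t a) (P a)) := by
  unfold PRS.sep; fun_prop

@[fun_prop] theorem PR.img {t : A → M} {f : A → M → M} (ht : PR M t)
    (hf : PR M (fun p : A × M => f p.1 p.2)) : PR M (fun a => img (t a) (f a)) := by
  unfold PRS.img; fun_prop

@[simp] theorem mem_sing {x z : M} : z ∊ sing x ↔ z = x := by simp [sing, mem_adj, notMem_emp]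

@[simp] theorem mem_pair {x y z : M} : z ∊ pair x y ↔ z = x ∨ z = y := by simp [pair, mem_adj]

@[simp] theorem mem_sU {x z : M} : z ∊ sU x ↔ ∃ v, v ∊ x ∧ z ∊ v := mem_iU (by fun_prop)

@[simp] theorem mem_union {x y z : M} : z ∊ union x y ↔ z ∊ x ∨ z ∊ y := by simp [union]

theorem mem_sep {x z : M} {P : M → Prop} (hP : PR M P) : z ∊ sep x P ↔ z ∊ x ∧ P z := by
  unfold sep
  rw [mem_iU (by fun_prop)]
  constructor
  · rintro ⟨v, hv, h⟩
    split_ifs at h with hPv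
    · rw [mem_sing] at h; subst h; exact ⟨hv, hPv⟩
    · exact (notMem_emp h).elim
  · rintro ⟨h, hPz⟩
    exact ⟨z, h, by simp [hPz]⟩

theorem mem_img {x z : M} {f : M → M} (hf : PR M f) : z ∊ img x f ↔ ∃ v, v ∊ x ∧ z = f v := by
  unfold img
  rw [mem_iU (by fun_prop)]
  simp

@[fun_prop] theorem PR.BEx {t : A → M} {P : A → M → Prop} (ht : PR M t)
    (hP : PR M (fun p : A × M => P p.1 p.2)) : PR M (fun a => BEx (t a) (P a)) := by
  refine PR.congr (Q := fun a => ¬ PRS.sep (t a) (P a) = emp) (by fun_prop) fun a => ?_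
  constructor
  · rintro ⟨z, hz, h⟩ he
    exact notMem_emp (he ▸ (mem_sep (PR.const_left hP a)).2 ⟨hz, h⟩ : z ∊ emp)
  · intro h
    by_contra hn
    refine h (ext fun z => ?_)
    rw [mem_sep (PR.const_left hP a)]
    exact ⟨fun h' => (hn ⟨z, h'⟩).elim, fun h' => (notMem_emp h').elim⟩

@[fun_prop] theorem PR.BAll {t : A → M} {P : A → M → Prop} (ht : PR M t)
    (hP : PR M (fun p : A × M => P p.1 p.2)) : PR M (fun a => BAll (t a) (P a)) :=
  PR.congr (Q := fun a => ¬ PRS.BEx (t a) (fun z => ¬ P a z)) (by fun_prop) fun a => by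
    simp [PRS.BEx, PRS.BAll]

@[fun_prop] theorem PR.pr {f g : A → M} (hf : PR M f) (hg : PR M g) :
    PR M (fun a => pr (f a) (g a)) := by unfold PRS.pr; fun_prop

@[fun_prop] theorem PR.times {f g : A → M} (hf : PR M f) (hg : PR M g) :
    PR M (fun a => times (f a) (g a)) := by unfold PRS.times; fun_prop

theorem pr_eq (x y : M) : pr x y = pair (sing x) (pair x y) := rfl

theorem pr_inj {x y x' y' : M} : pr x y = pr x' y' ↔ x = x' ∧ y = y' := by
  constructor
  · intro h
    have key : ∀ z, (z = sing x ∨ z = pair x y) ↔ (z = sing x' ∨ z = pair x' y') := fun z => by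
      rw [← mem_pair, ← mem_pair, ← pr_eq, ← pr_eq, h]
    have hs : ∀ {a b : M}, sing a = sing b → a = b := fun {a b} h =>
      mem_sing.1 (h ▸ mem_sing.2 rfl : a ∊ sing b)
    have hsp : ∀ {a b c : M}, sing a = pair b c → b = a ∧ c = a := fun {a b c} h =>
      ⟨mem_sing.1 (h.symm ▸ mem_pair.2 (Or.inl rfl) : b ∊ sing a),
        mem_sing.1 (h.symm ▸ mem_pair.2 (Or.inr rfl) : c ∊ sing a)⟩
    have hx : x = x' := by
      rcases (key _).1 (Or.inl rfl) with h | h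
      · exact hs h
      · exact (hsp h).1.symm
    subst hx
    refine ⟨rfl, ?_⟩
    have hy : y = x ∨ y = y' := by
      rcases (key _).1 (Or.inr rfl) with h | h
      · exact Or.inl (hsp h.symm).2
      · exact mem_pair.1 (h ▸ mem_pair.2 (Or.inr rfl) : y ∊ pair x y')
    have hy' : y' = x ∨ y' = y := by
      rcases (key _).2 (Or.inr rfl) with h | h
      · exact Or.inl (hsp h.symm).2
      · exact mem_pair.1 (h ▸ mem_pair.2 (Or.inr rfl) : y' ∊ pair x y)
    rcases hy with hy | hy
    · rcases hy' with hy' | hy'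
      · rw [hy, hy']
      · exact hy'.symm
    · exact hy
  · rintro ⟨rfl, rfl⟩; rfl

@[simp] theorem mem_times {x y z : M} :
    z ∊ times x y ↔ ∃ a b, a ∊ x ∧ b ∊ y ∧ z = pr a b := by
  unfold times
  rw [mem_iU (by fun_prop)]
  refine exists_congr fun a => ?_
  rw [mem_img (by fun_prop)]
  simp

theorem pr_mem_times {x y a b : M} : pr a b ∊ times x y ↔ a ∊ x ∧ b ∊ y := by
  simp [pr_inj]

/-- the first component of a pair -/
def fst (p : M) : M := sU (sep (sU p) (fun x => BEx (sU p) (fun y => p = pr x y)))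
/-- the second component of a pair -/
def snd (p : M) : M := sU (sep (sU p) (fun y => BEx (sU p) (fun x => p = pr x y)))
/-- the value of the function `f` at `x` -/
def ap (f x : M) : M := sU (sep (sU (sU f)) (fun y => pr x y ∊ f))

@[fun_prop] theorem PR.first {f : A → M} (hf : PR M f) : PR M (fun a => PRS.fst (f a)) := by
  unfold PRS.fst; fun_prop
@[fun_prop] theorem PR.second {f : A → M} (hf : PR M f) : PR M (fun a => PRS.snd (f a)) := by
  unfold PRS.snd; fun_prop
@[fun_prop] theorem PR.ap {f g : A → M} (hf : PR M f) (hg : PR M g) :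
    PR M (fun a => PRS.ap (f a) (g a)) := by unfold PRS.ap; fun_prop

theorem sU_sep_unique {x y : M} {P : M → Prop} (hP : PR M P) (hy : y ∊ x) (h : ∀ z, P z ↔ z = y) :
    sU (sep x P) = y := by
  refine ext fun z => ?_
  simp only [mem_sU, mem_sep hP, h]
  exact ⟨by rintro ⟨v, ⟨-, rfl⟩, h'⟩; exact h', fun hz => ⟨y, ⟨hy, rfl⟩, hz⟩⟩

theorem mem_sU_sU {x y f : M} (h : pr x y ∊ f) : x ∊ sU (sU f) ∧ y ∊ sU (sU f) := by
  have : pair x y ∊ sU f := mem_sU.2 ⟨_, h, by rw [pr_eq, mem_pair]; exact Or.inr rfl⟩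
  exact ⟨mem_sU.2 ⟨_, this, by simp⟩, mem_sU.2 ⟨_, this, by simp⟩⟩

theorem mem_sU_pr {x y z : M} : z ∊ sU (pr x y) ↔ z = x ∨ z = y := by
  rw [pr_eq]; simp only [mem_sU, mem_pair]
  constructor
  · rintro ⟨v, rfl | rfl, h⟩
    · exact Or.inl (mem_sing.1 h)
    · exact mem_pair.1 h
  · exact fun h => ⟨_, Or.inr rfl, mem_pair.2 h⟩

@[simp] theorem fst_pr (x y : M) : fst (pr x y) = x := by
  refine sU_sep_unique (by fun_prop) (mem_sU_pr.2 (Or.inl rfl)) fun z => ?_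
  simp only [BEx, pr_inj, mem_sU_pr]
  exact ⟨fun ⟨_, _, h, _⟩ => h.symm, fun h => ⟨y, Or.inr rfl, h.symm, rfl⟩⟩

@[simp] theorem snd_pr (x y : M) : snd (pr x y) = y := by
  refine sU_sep_unique (by fun_prop) (mem_sU_pr.2 (Or.inr rfl)) fun z => ?_
  simp only [BEx, pr_inj, mem_sU_pr]
  exact ⟨fun ⟨_, _, _, h⟩ => h.symm, fun h => ⟨x, Or.inl rfl, rfl, h.symm⟩⟩

theorem ap_eq {f x y : M} (h : pr x y ∊ f) (hu : ∀ z, pr x z ∊ f → z = y) : ap f x = y :=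
  sU_sep_unique (by fun_prop) (mem_sU_sU h).2 fun z => ⟨hu z, fun e => e ▸ h⟩

/-- the graph of `f` on `x` -/
def gr (x : M) (f : M → M) : M := img x (fun z => pr z (f z))

@[fun_prop] theorem PR.gr {t : A → M} {f : A → M → M} (ht : PR M t)
    (hf : PR M (fun p : A × M => f p.1 p.2)) : PR M (fun a => gr (t a) (f a)) := by
  unfold PRS.gr; fun_prop

theorem mem_gr {x z : M} {f : M → M} (hf : PR M f) : z ∊ gr x f ↔ ∃ v, v ∊ x ∧ z = pr v (f v) :=
  mem_img (by fun_prop)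

theorem pr_mem_gr {x a b : M} {f : M → M} (hf : PR M f) : pr a b ∊ gr x f ↔ a ∊ x ∧ b = f a := by
  rw [mem_gr hf]
  simp only [pr_inj]
  exact ⟨by rintro ⟨v, h, rfl, rfl⟩; exact ⟨h, rfl⟩, fun h => ⟨a, h.1, rfl, h.2⟩⟩

theorem ap_gr {x a : M} {f : M → M} (hf : PR M f) (ha : a ∊ x) : ap (gr x f) a = f a :=
  ap_eq ((pr_mem_gr hf).2 ⟨ha, rfl⟩) fun _ h => ((pr_mem_gr hf).1 h).2

/-- recursion along membership, where the step function gets the graph of the previous values -/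
theorem PR.recursion {G : A → M → M → M} (hG : PR M (fun p : (A × M) × M => G p.1.1 p.1.2 p.2)) :
    ∃ F : A → M → M, PR M (fun p : A × M => F p.1 p.2) ∧ ∀ a x, F a x = G a (PRS.gr x (F a)) x := by
  -- The auxiliary function has the value `{(x, F x)}` at `x`. Hence the union of its values on the
  -- members of `x` is the graph of `F` on `x`, and `F x` is recovered by a union and a projection.
  obtain ⟨R, hR, h⟩ := PR.recursion_union (M := M) (A := A)
    (f := fun p => PRS.sing (PRS.pr p.2 (G p.1.1 p.1.2 p.2)))
    (PR.sing (PR.pr (by fun_prop) hG))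
  have hF : PR M (fun p : A × M => PRS.snd (PRS.sU (R p))) := by fun_prop
  refine ⟨fun a x => PRS.snd (PRS.sU (R (a, x))), hF, fun a x => ?_⟩
  have key : ∀ a x, ∃ w, (∀ z, z ∊ w ↔ ∃ v, v ∊ x ∧ z ∊ R (a, v)) ∧
      R (a, x) = PRS.sing (PRS.pr x (G a w x)) := h
  have hs : ∀ x : M, PRS.sU (PRS.sing x) = x := fun x => ext fun z => by simp
  obtain ⟨w, hw, hx⟩ := key a x
  have : w = PRS.gr x (fun x => PRS.snd (PRS.sU (R (a, x)))) := by
    refine ext fun z => ?_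
    rw [hw, mem_gr (PR.const_left hF a)]
    refine exists_congr fun v => and_congr_right fun _ => ?_
    obtain ⟨w', -, hv⟩ := key a v
    rw [hv, hs, snd_pr, mem_sing]
  show PRS.snd (PRS.sU (R (a, x))) = _
  rw [← this, hx, hs, snd_pr]

end Basic

end PRS

namespace PRS

/-! ### Ordinals, natural numbers and finite sets -/

section Ordinals

variable {M : Type u} [PRSModel M] {A B C : Type*} [Enc M A] [Enc M B] [Enc M C]

theorem IsOrd.trans {α β ξ : M} (hα : IsOrd α) (hβ : β ∊ α) (hξ : ξ ∊ β) : ξ ∊ α :=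
  hα.1 β ξ hβ hξ

theorem IsOrd.mem {α β : M} (hα : IsOrd α) (hβ : β ∊ α) : IsOrd β :=
  ⟨hα.2 β hβ, fun _ h => hα.2 _ (hα.1 _ _ hβ h)⟩

/-- Foundation is available for sets only. It applies here because a primitive recursive `P` cuts
out a set. The same restriction is inherited by all induction principles below. -/
theorem exists_minimal {x y : M} {P : M → Prop} (hP : PR M P) (hy : y ∊ x) (h : P y) :
    ∃ z, z ∊ x ∧ P z ∧ ∀ w, w ∊ z → w ∊ x → ¬ P w := by
  obtain ⟨z, hz, hmin⟩ := PRSModel.foundation (sep x P) ⟨y, (mem_sep hP).2 ⟨hy, h⟩⟩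
  obtain ⟨hz, hPz⟩ := (mem_sep hP).1 hz
  exact ⟨z, hz, hPz, fun w hw hwx hPw => hmin w hw ((mem_sep hP).2 ⟨hwx, hPw⟩)⟩

theorem IsOrd.induct {α : M} (hα : IsOrd α) {P : M → Prop} (hP : PR M P)
    (h : ∀ β, β ∊ α → (∀ ξ, ξ ∊ β → P ξ) → P β) : ∀ β, β ∊ α → P β := by
  intro β hβ
  by_contra hn
  obtain ⟨z, hz, hPz, hmin⟩ := exists_minimal (P := fun x => ¬ P x) (by fun_prop) hβ hn
  exact hPz (h z hz fun ξ hξ => not_not.1 (hmin ξ hξ (hα.trans hz hξ)))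

/-- A minimal element `y` of `β \ α` must be equal to `α`. Otherwise a minimal element `x` of `α \
y` would be incomparable with `y`, while membership is linear on `β` by a nested induction. -/
theorem IsOrd.mem_of_ssubset {α β : M} (hα : IsTrans α) (hβ : IsOrd β)
    (h : ∀ z, z ∊ α → z ∊ β) (hne : α ≠ β) : α ∊ β := by
  have : ∃ z, z ∊ β ∧ ¬ z ∊ α := by
    by_contra hn
    push Not at hn
    exact hne (ext fun z => ⟨h z, hn z⟩)
  obtain ⟨z, hz, hzα⟩ := this
  obtain ⟨y, hy, hyα, hmin⟩ := exists_minimal (P := fun z => ¬ z ∊ α) (by fun_prop) hz hzα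
  suffices y = α by rwa [← this]
  by_contra hya
  have hsub : ∀ w, w ∊ y → w ∊ α := fun w hw => not_not.1 (hmin w hw (hβ.trans hy hw))
  have : ∃ z, z ∊ α ∧ ¬ z ∊ y := by
    by_contra hn
    push Not at hn
    exact hya (ext fun z => ⟨hsub z, hn z⟩)
  obtain ⟨z, hz, hzy⟩ := this
  obtain ⟨x, hx, hxy, hmin'⟩ := exists_minimal (P := fun z => ¬ z ∊ y) (by fun_prop) hz hzy
  have hx' : ∀ w, w ∊ x → w ∊ y := fun w hw => not_not.1 (hmin' w hw (hα _ _ hx hw))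
  have hne' : x ≠ y := fun e => hyα (e ▸ hx)
  -- `x` is a proper subset of `y`, so a minimal element of `y \ x` gives a contradiction
  have key : ∀ a b : M, a ∊ β → b ∊ β → a ∊ b ∨ a = b ∨ b ∊ a := by
    refine hβ.induct (P := fun a => BAll β fun b => a ∊ b ∨ a = b ∨ b ∊ a) (by fun_prop)
      (fun a ha iha => ?_) |> fun h a b ha hb => h a ha b hb
    refine hβ.induct (by fun_prop) fun b hb ihb => ?_
    by_cases h1 : ∃ c, c ∊ a ∧ (b = c ∨ b ∊ c)
    · obtain ⟨c, hc, rfl | h⟩ := h1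
      · exact Or.inr (Or.inr hc)
      · exact Or.inr (Or.inr (hβ.2 a ha _ _ hc h))
    by_cases h2 : ∃ c, c ∊ b ∧ (a = c ∨ a ∊ c)
    · obtain ⟨c, hc, rfl | h⟩ := h2
      · exact Or.inl hc
      · exact Or.inl (hβ.2 b hb _ _ hc h)
    push Not at h1 h2
    refine Or.inr (Or.inl (ext fun z => ⟨fun hz => ?_, fun hz => ?_⟩))
    · rcases iha z hz b hb with h | h | h
      · exact h
      · exact ((h1 z hz).1 h.symm).elim
      · exact ((h1 z hz).2 h).elim
    · rcases ihb z hz with h | h | h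
      · exact ((h2 z hz).2 h).elim
      · exact ((h2 z hz).1 h).elim
      · exact h
  rcases key x y (h x hx) hy with h1 | h1 | h1
  · exact hxy h1
  · exact hne' h1
  · exact hyα (hα _ _ hx h1)

theorem IsOrd.sep_ord {α : M} {P : M → Prop} (hα : IsOrd α) (hP : PR M P)
    (h : ∀ β ξ, β ∊ α → ξ ∊ β → P β → P ξ) : IsOrd (sep α P) := by
  refine ⟨fun y z hy hz => ?_, fun y hy => hα.2 y ((mem_sep hP).1 hy).1⟩
  rw [mem_sep hP] at hy ⊢
  exact ⟨hα.trans hy.1 hz, h _ _ hy.1 hz hy.2⟩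

/-- The intersection is transitive. If it were a proper part of both ordinals, it would be an
element of both and hence of itself. -/
theorem IsOrd.trichotomy {α β : M} (hα : IsOrd α) (hβ : IsOrd β) : α ∊ β ∨ α = β ∨ β ∊ α := by
  have hi : IsTrans (sep α fun z => z ∊ β) := fun y z hy hz => by
    rw [mem_sep (by fun_prop)] at *
    exact ⟨hα.trans hy.1 hz, hβ.trans hy.2 hz⟩
  have hm : ∀ z, z ∊ (sep α fun z => z ∊ β) ↔ z ∊ α ∧ z ∊ β := fun z => mem_sep (by fun_prop)
  by_cases h1 : (sep α fun z => z ∊ β) = α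
  · by_cases h2 : (sep α fun z => z ∊ β) = β
    · exact Or.inr (Or.inl (h1.symm.trans h2))
    · have := hβ.mem_of_ssubset hi (fun z hz => ((hm z).1 hz).2) h2
      rw [h1] at this
      exact Or.inl this
  · have h3 := hα.mem_of_ssubset hi (fun z hz => ((hm z).1 hz).1) h1
    by_cases h2 : (sep α fun z => z ∊ β) = β
    · rw [h2] at h3
      exact Or.inr (Or.inr h3)
    · have h4 := hβ.mem_of_ssubset hi (fun z hz => ((hm z).1 hz).2) h2
      exact (notMem_self _ ((hm _).2 ⟨h3, h4⟩)).elim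

theorem IsOrd.not_mem_iff {α β : M} (hα : IsOrd α) (hβ : IsOrd β) :
    ¬ α ∊ β ↔ β = α ∨ β ∊ α := by
  constructor
  · intro h
    rcases hα.trichotomy hβ with h' | h' | h'
    · exact (h h').elim
    · exact Or.inl h'.symm
    · exact Or.inr h'
  · rintro (rfl | h) h'
    · exact notMem_self _ h'
    · exact notMem_self _ (hα.trans h h')

theorem IsOrd.asymm {α β : M} (hα : IsOrd α) (h : β ∊ α) : ¬ α ∊ β :=
  fun h' => notMem_self _ (hα.trans h h')

theorem ofOrd_linear {α : M} (hα : IsOrd α) : (LO.ofOrd α).IsLinear :=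
  ⟨fun x _ => notMem_self x, fun _ _ _ _ _ hz h h' => (hα.mem hz).trans h' h,
    fun _ _ hx hy => (hα.mem hx).trichotomy (hα.mem hy)⟩

theorem IsOrd.suc {α : M} (hα : IsOrd α) : IsOrd (suc α) := by
  refine ⟨fun y z hy hz => ?_, fun y hy => ?_⟩
  · rw [mem_suc] at *
    rcases hy with hy | rfl
    · exact Or.inl (hα.trans hy hz)
    · exact Or.inl hz
  · rcases mem_suc.1 hy with hy | rfl
    · exact hα.2 y hy
    · exact hα.1

theorem mem_suc_self (x : M) : x ∊ suc x := mem_suc.2 (Or.inr rfl)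

theorem suc_mem_suc {α β : M} (hβ : IsOrd β) (h : α ∊ β) : suc α ∊ suc β := by
  rw [mem_suc]
  rcases (hβ.mem h).suc.trichotomy hβ with h' | h' | h'
  · exact Or.inl h'
  · exact Or.inr h'
  · rcases mem_suc.1 h' with h' | rfl
    · exact (hβ.asymm h h').elim
    · exact (notMem_self _ h).elim

theorem suc_inj {α β : M} (h : suc α = suc β) : α = β := by
  have h1 : α ∊ suc β := h ▸ mem_suc_self α
  have h2 : β ∊ suc α := h ▸ mem_suc_self β
  rw [mem_suc] at h1 h2
  rcases h1 with h1 | h1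
  · rcases h2 with h2 | h2
    · exfalso
      obtain ⟨y, hy, hmin⟩ := PRSModel.foundation (pair α β) ⟨α, by simp⟩
      rcases mem_pair.1 hy with rfl | rfl
      · exact hmin β h2 (by simp)
      · exact hmin α h1 (by simp)
    · exact h2.symm
  · exact h1

theorem sU_suc {α : M} (hα : IsTrans α) : sU (suc α) = α := by
  refine ext fun z => ?_
  simp only [mem_sU, mem_suc]
  constructor
  · rintro ⟨v, hv | rfl, hz⟩
    · exact hα _ _ hv hz
    · exact hz
  · exact fun h => ⟨α, Or.inr rfl, h⟩

/-! ### Natural numbers -/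

theorem mem_om {z : M} : z ∊ (om : M) ↔ z = emp ∨ ∃ y, y ∊ (om : M) ∧ z = suc y :=
  PRSModel.app_omega _ _

theorem emp_mem_om : (emp : M) ∊ om := mem_om.2 (Or.inl rfl)

theorem suc_mem_om {n : M} (h : n ∊ om) : suc n ∊ om := mem_om.2 (Or.inr ⟨n, h, rfl⟩)

theorem nat_induct {P : M → Prop} (hP : PR M P) (h0 : P emp)
    (h1 : ∀ n, n ∊ (om : M) → P n → P (suc n)) : ∀ n, n ∊ (om : M) → P n := by
  intro n hn
  by_contra hc
  obtain ⟨z, hz, hPz, hmin⟩ := exists_minimal (P := fun x => ¬ P x) (by fun_prop) hn hc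
  rcases mem_om.1 hz with rfl | ⟨y, hy, rfl⟩
  · exact hPz h0
  · exact hPz (h1 y hy (not_not.1 (hmin y (mem_suc_self y) hy)))

theorem trans_om : IsTrans (om : M) := by
  refine fun n m hn hm => nat_induct (P := fun n => BAll n fun m => m ∊ om) (by fun_prop)
    (fun z hz => (notMem_emp hz).elim) (fun n hn ih z hz => ?_) n hn m hm
  rcases mem_suc.1 hz with hz | rfl
  · exact ih z hz
  · exact hn

theorem trans_nat {n : M} (hn : n ∊ om) : IsTrans n := by
  have := nat_induct (P := fun n : M => BAll n fun m => BAll m fun k => k ∊ n) (by fun_prop)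
    (fun z hz => (notMem_emp hz).elim) (fun n hn ih z hz k hk => by
      rcases mem_suc.1 hz with hz | rfl
      · exact mem_suc.2 (Or.inl (ih z hz k hk))
      · exact mem_suc.2 (Or.inl hk)) n hn
  exact fun y z hy hz => this y hy z hz

theorem ord_om : IsOrd (om : M) := ⟨trans_om, fun _ h => trans_nat h⟩

theorem ord_nat {n : M} (hn : n ∊ om) : IsOrd n := ord_om.mem hn

theorem emp_mem_suc {n : M} (hn : n ∊ om) : (emp : M) ∊ suc n := by
  refine nat_induct (P := fun n : M => emp ∊ suc n) (by fun_prop) (mem_suc_self _)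
    (fun n _ ih => mem_suc.2 (Or.inl ih)) n hn

theorem ord_emp : IsOrd (emp : M) := ord_nat emp_mem_om

theorem eq_emp {x : M} (h : ∀ z, ¬ z ∊ x) : x = emp :=
  ext fun z => ⟨fun h' => (h z h').elim, fun h' => (notMem_emp h').elim⟩

/-- a number below which another one lies is a successor -/
theorem exists_pred {p k : M} (hk : k ∊ om) (hp : p ∊ k) :
    ∃ j, j ∊ om ∧ k = suc j ∧ (p = j ∨ p ∊ j) := by
  rcases mem_om.1 hk with rfl | ⟨j, hj, rfl⟩
  · exact (notMem_emp hp).elim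
  · exact ⟨j, hj, rfl, (mem_suc.1 hp).symm⟩

/-! ### Ordinal addition -/

theorem exists_oadd : ∃ F : M → M → M, PR M (fun p : M × M => F p.1 p.2) ∧
    ∀ a x, F a x = union a (img x (F a)) := by
  obtain ⟨F, hF, h⟩ := PR.recursion (M := M) (A := M) (G := fun a w _ => union a (img w snd))
    (by fun_prop)
  refine ⟨F, hF, fun a x => ?_⟩
  have hFa : PR M (F a) := PR.const_left hF a
  rw [h]
  refine ext fun z => ?_
  simp only [mem_union, mem_img (PR.second (M := M) PR.id), mem_img hFa, mem_gr hFa]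
  refine or_congr Iff.rfl ⟨?_, ?_⟩
  · rintro ⟨_, ⟨v, hv, rfl⟩, rfl⟩; exact ⟨v, hv, by simp⟩
  · rintro ⟨v, hv, rfl⟩; exact ⟨_, ⟨v, hv, rfl⟩, by simp⟩

/-- ordinal addition -/
def oadd : M → M → M := exists_oadd.choose

@[fun_prop] theorem PR.oadd {f g : A → M} (hf : PR M f) (hg : PR M g) :
    PR M (fun a => oadd (f a) (g a)) :=
  PR.comp (f := fun p : M × M => PRS.oadd p.1 p.2) exists_oadd.choose_spec.1 (hf.prodMk hg)

theorem mem_oadd {α β z : M} : z ∊ oadd α β ↔ z ∊ α ∨ ∃ ξ, ξ ∊ β ∧ z = oadd α ξ := by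
  have := exists_oadd.choose_spec.2 α β
  have h : z ∊ oadd α β ↔ z ∊ union α (img β (oadd α)) := by
    unfold oadd
    rw [this]
  rw [h, mem_union, mem_img (by fun_prop)]

theorem oadd_emp (α : M) : oadd α emp = α :=
  ext fun z => by rw [mem_oadd]; simp [notMem_emp]

theorem oadd_suc (α β : M) : oadd α (suc β) = suc (oadd α β) :=
  ext fun z => by
    rw [mem_oadd, mem_suc, mem_oadd]
    simp only [mem_suc]
    constructor
    · rintro (h | ⟨ξ, h | rfl, rfl⟩)
      · exact Or.inl (Or.inl h)
      · exact Or.inl (Or.inr ⟨ξ, h, rfl⟩)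
      · exact Or.inr rfl
    · rintro ((h | ⟨ξ, h, rfl⟩) | rfl)
      · exact Or.inl h
      · exact Or.inr ⟨ξ, Or.inl h, rfl⟩
      · exact Or.inr ⟨β, Or.inr rfl, rfl⟩

theorem oadd_mem {α ξ η : M} (h : ξ ∊ η) : oadd α ξ ∊ oadd α η := mem_oadd.2 (Or.inr ⟨ξ, h, rfl⟩)

theorem mem_oadd_left {α β ξ : M} (h : ξ ∊ α) : ξ ∊ oadd α β := mem_oadd.2 (Or.inl h)

theorem oadd_notMem (α β : M) : ¬ oadd α β ∊ α := fun h => notMem_self _ (mem_oadd_left (β := β) h)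

theorem trans_oadd {α β : M} (hα : IsTrans α) (hβ : IsTrans β) : IsTrans (oadd α β) := by
  intro y z hy hz
  rcases mem_oadd.1 hy with hy | ⟨ξ, hξ, rfl⟩
  · exact mem_oadd_left (hα _ _ hy hz)
  · rcases mem_oadd.1 hz with hz | ⟨η, hη, rfl⟩
    · exact mem_oadd_left hz
    · exact oadd_mem (hβ _ _ hξ hη)

theorem ord_oadd {α β : M} (hα : IsOrd α) (hβ : IsOrd β) : IsOrd (oadd α β) := by
  refine ⟨trans_oadd hα.1 hβ.1, fun y hy => ?_⟩
  rcases mem_oadd.1 hy with hy | ⟨ξ, hξ, rfl⟩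
  · exact hα.2 y hy
  · exact trans_oadd hα.1 (hβ.2 ξ hξ)

theorem oadd_inj {α ξ η : M} (hξ : IsOrd ξ) (hη : IsOrd η) (h : oadd α ξ = oadd α η) : ξ = η := by
  rcases hξ.trichotomy hη with h' | h' | h'
  · have := oadd_mem (α := α) h'
    rw [h] at this
    exact (notMem_self _ this).elim
  · exact h'
  · have := oadd_mem (α := α) h'
    rw [h] at this
    exact (notMem_self _ this).elim

theorem oadd_mem_iff {α ξ η : M} (hξ : IsOrd ξ) (hη : IsOrd η) :
    oadd α ξ ∊ oadd α η ↔ ξ ∊ η := by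
  refine ⟨fun h => ?_, oadd_mem⟩
  rcases mem_oadd.1 h with h | ⟨ζ, hζ, h⟩
  · exact (oadd_notMem _ _ h).elim
  · rwa [oadd_inj hξ (hη.mem hζ) h]

theorem oadd_nat {m n : M} (hm : m ∊ om) (hn : n ∊ om) : oadd m n ∊ om :=
  nat_induct (P := fun n => oadd m n ∊ om) (by fun_prop) (by rwa [oadd_emp])
    (fun n _ ih => by rw [oadd_suc]; exact suc_mem_om ih) n hn

/-! ### Tripling -/

theorem exists_triple : ∃ F : M → M, PR M F ∧ ∀ x, F x = iU x fun v => suc (suc (suc (F v))) := by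
  obtain ⟨F, hF, h⟩ := PR.recursion (M := M) (A := Unit)
    (G := fun _ w _ => iU w fun p => suc (suc (suc (snd p)))) (by fun_prop)
  have hF' : PR M (F ()) := PR.const_left hF ()
  refine ⟨F (), hF', fun x => ?_⟩
  rw [h]
  refine ext fun z => ?_
  rw [mem_iU (by fun_prop), mem_iU (by fun_prop)]
  simp only [mem_gr hF']
  constructor
  · rintro ⟨_, ⟨v, hv, rfl⟩, hz⟩; exact ⟨v, hv, by simpa using hz⟩
  · rintro ⟨v, hv, hz⟩; exact ⟨_, ⟨v, hv, rfl⟩, by simpa using hz⟩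

/-- `n ↦ 3 n` -/
def triple : M → M := exists_triple.choose

@[fun_prop] theorem PR.triple {f : A → M} (hf : PR M f) : PR M (fun a => triple (f a)) :=
  PR.comp (f := PRS.triple) exists_triple.choose_spec.1 hf

theorem mem_triple {x z : M} : z ∊ triple x ↔ ∃ v, v ∊ x ∧ z ∊ suc (suc (suc (triple v))) := by
  have h := exists_triple.choose_spec.2 x
  have h' : triple x = iU x fun v => suc (suc (suc (triple v))) := h
  rw [h', mem_iU (by fun_prop)]

/-- Tripling replaces each point by three slots, all of which lie below the slots of any larger
point. This makes room for embeddings that are interleaved with given ones. -/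
theorem triple_lt {x y : M} (h : x ∊ y) : triple x ∊ triple y ∧ suc (triple x) ∊ triple y ∧
    suc (suc (triple x)) ∊ triple y :=
  ⟨mem_triple.2 ⟨x, h, by simp [mem_suc]⟩, mem_triple.2 ⟨x, h, by simp [mem_suc]⟩,
    mem_triple.2 ⟨x, h, by simp [mem_suc]⟩⟩

theorem triple_suc {n : M} : triple (suc n) = suc (suc (suc (triple n))) := by
  refine ext fun z => ?_
  rw [mem_triple]
  constructor
  · rintro ⟨v, hv, hz⟩
    rcases mem_suc.1 hv with hv | rfl
    · have : z ∊ triple n := mem_triple.2 ⟨v, hv, hz⟩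
      simp [mem_suc, this]
    · exact hz
  · exact fun h => ⟨n, mem_suc_self n, h⟩

theorem triple_nat {n : M} (hn : n ∊ om) : triple n ∊ om := by
  refine nat_induct (P := fun n : M => triple n ∊ om) (by fun_prop) ?_ (fun n hn ih => ?_) n hn
  · rw [eq_emp (x := triple emp)]
    · exact emp_mem_om
    · intro z hz
      obtain ⟨v, hv, -⟩ := mem_triple.1 hz
      exact notMem_emp hv
  · rw [triple_suc]
    exact suc_mem_om (suc_mem_om (suc_mem_om ih))

/-! ### Finite sets -/

/-- For a natural number `n`, the set `F X n` collects what arises from `∅` by at most `n`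
adjunctions of elements of `X`. The union over `ω` consists of the finite subsets. -/
theorem exists_finN : ∃ F : M → M → M, PR M (fun p : M × M => F p.1 p.2) ∧
    ∀ X n a, a ∊ F X n ↔ a = emp ∨ ∃ m, m ∊ n ∧ ∃ b, b ∊ F X m ∧ ∃ x, x ∊ X ∧ a = adj b x := by
  obtain ⟨F, hF, h⟩ := PR.recursion (M := M) (A := M) (G := fun X w _ => union (sing emp)
    (iU w fun p => iU (snd p) fun b => img X fun x => adj b x)) (by fun_prop)
  refine ⟨F, hF, fun X n a => ?_⟩
  have hFX : PR M (F X) := PR.const_left hF X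
  rw [h, mem_union, mem_sing, mem_iU (by fun_prop)]
  refine or_congr Iff.rfl ?_
  simp only [mem_gr hFX]
  constructor
  · rintro ⟨_, ⟨m, hm, rfl⟩, h⟩
    rw [mem_iU (by fun_prop), snd_pr] at h
    obtain ⟨b, hb, h⟩ := h
    exact ⟨m, hm, b, hb, (mem_img (by fun_prop)).1 h⟩
  · rintro ⟨m, hm, b, hb, h⟩
    refine ⟨_, ⟨m, hm, rfl⟩, ?_⟩
    rw [mem_iU (by fun_prop), snd_pr]
    exact ⟨b, hb, by rw [mem_img (by fun_prop)]; exact h⟩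

/-- the set of the finite subsets of `X` -/
def Fin (X : M) : M := iU om (exists_finN.choose X)

@[fun_prop] theorem PR.Fin {f : A → M} (hf : PR M f) : PR M (fun a => Fin (f a)) := by
  have : PR M (fun p : A × M => exists_finN.choose (f p.1) p.2) :=
    PR.comp (f := fun p : M × M => exists_finN.choose p.1 p.2) (h := fun p : A × M => (f p.1, p.2))
      exists_finN.choose_spec.1 (by fun_prop)
  unfold PRS.Fin
  fun_prop

theorem mem_Fin {X a : M} : a ∊ Fin X ↔ ∃ n, n ∊ (om : M) ∧ a ∊ exists_finN.choose X n :=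
  mem_iU (PR.const_left (f := fun p : M × M => exists_finN.choose p.1 p.2)
    exists_finN.choose_spec.1 X)

theorem Fin_emp (X : M) : emp ∊ Fin X :=
  mem_Fin.2 ⟨emp, emp_mem_om, (exists_finN.choose_spec.2 X _ _).2 (Or.inl rfl)⟩

theorem Fin_adj {X a x : M} (ha : a ∊ Fin X) (hx : x ∊ X) : adj a x ∊ Fin X := by
  obtain ⟨n, hn, h⟩ := mem_Fin.1 ha
  exact mem_Fin.2 ⟨suc n, suc_mem_om hn,
    (exists_finN.choose_spec.2 X _ _).2 (Or.inr ⟨n, mem_suc_self n, a, h, x, hx, rfl⟩)⟩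

theorem Fin_induct {X : M} {P : M → Prop} (hP : PR M P) (h0 : P emp)
    (h1 : ∀ a x, a ∊ Fin X → x ∊ X → P a → P (adj a x)) : ∀ a, a ∊ Fin X → P a := by
  intro a ha
  obtain ⟨n, hn, h⟩ := mem_Fin.1 ha
  have hFX : PR M (exists_finN.choose X) := PR.const_left
    (f := fun p : M × M => exists_finN.choose p.1 p.2) exists_finN.choose_spec.1 X
  refine ord_om.induct (P := fun n => BAll (exists_finN.choose X n) P) (by fun_prop)
    (fun n hn ih a ha => ?_) n hn a h
  rcases (exists_finN.choose_spec.2 X _ _).1 ha with rfl | ⟨m, hm, b, hb, x, hx, rfl⟩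
  · exact h0
  · exact h1 b x (mem_Fin.2 ⟨m, trans_om _ _ hn hm, hb⟩) hx (ih m hm b hb)

theorem Fin_sub {X a : M} (ha : a ∊ Fin X) : ∀ x, x ∊ a → x ∊ X := by
  refine Fin_induct (P := fun a => BAll a fun x => x ∊ X) (by fun_prop)
    (fun x hx => (notMem_emp hx).elim) (fun a x _ hx ih y hy => ?_) a ha
  rcases mem_adj.1 hy with hy | rfl
  · exact ih y hy
  · exact hx

theorem Fin_of_sub {X a b : M} (ha : a ∊ Fin X) (h : ∀ x, x ∊ b → x ∊ a) : b ∊ Fin X := by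
  have := Fin_induct (X := X) (P := fun a => sep a (fun x => x ∊ b) ∊ Fin X) (by fun_prop) ?_
    (fun a x _ hx ih => ?_) a ha
  · convert this using 1
    refine ext fun z => ?_
    rw [mem_sep (by fun_prop)]
    exact ⟨fun hz => ⟨h z hz, hz⟩, fun hz => hz.2⟩
  · convert Fin_emp X using 1
    refine eq_emp fun z hz => ?_
    rw [mem_sep (by fun_prop)] at hz
    exact notMem_emp hz.1
  · by_cases hxb : x ∊ b
    · convert Fin_adj ih hx using 1
      refine ext fun z => ?_
      simp only [mem_sep (P := fun x => x ∊ b) (by fun_prop), mem_adj]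
      constructor
      · tauto
      · rintro (h | rfl)
        · tauto
        · exact ⟨Or.inr rfl, hxb⟩
    · convert ih using 1
      refine ext fun z => ?_
      simp only [mem_sep (P := fun x => x ∊ b) (by fun_prop), mem_adj]
      constructor
      · rintro ⟨h | rfl, h'⟩
        · exact ⟨h, h'⟩
        · exact (hxb h').elim
      · tauto

theorem Fin_union {X a b : M} (ha : a ∊ Fin X) (hb : b ∊ Fin X) : union a b ∊ Fin X := by
  refine Fin_induct (P := fun a => union a b ∊ Fin X) (by fun_prop) ?_
    (fun a x _ hx ih => ?_) a ha
  · convert hb using 1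
    exact ext fun z => by simp [notMem_emp]
  · convert Fin_adj ih hx using 1
    exact ext fun z => by simp only [mem_union, mem_adj]; tauto

theorem Fin_img {X Y a : M} {f : M → M} (hf : PR M f) (ha : a ∊ Fin X)
    (h : ∀ x, x ∊ a → f x ∊ Y) : img a f ∊ Fin Y := by
  refine Fin_induct (P := fun a => BAll a (fun x => f x ∊ Y) → img a f ∊ Fin Y) (by fun_prop)
    (fun _ => ?_) (fun a x _ _ ih h => ?_) a ha h
  · convert Fin_emp Y using 1
    refine eq_emp fun z hz => ?_
    rw [mem_img hf] at hz
    obtain ⟨v, hv, -⟩ := hz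
    exact notMem_emp hv
  · convert Fin_adj (ih fun y hy => h y (mem_adj.2 (Or.inl hy))) (h x (mem_adj.2 (Or.inr rfl)))
      using 1
    refine ext fun z => ?_
    simp only [mem_img hf, mem_adj]
    constructor
    · rintro ⟨v, hv | rfl, rfl⟩
      · exact Or.inl ⟨v, hv, rfl⟩
      · exact Or.inr rfl
    · rintro (⟨v, hv, rfl⟩ | rfl)
      · exact ⟨v, Or.inl hv, rfl⟩
      · exact ⟨x, Or.inr rfl, rfl⟩

theorem Fin_mono {X Y a : M} (ha : a ∊ Fin X) (h : ∀ x, x ∊ a → x ∊ Y) : a ∊ Fin Y := by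
  convert Fin_img (f := fun x => x) (by fun_prop) ha h using 1
  exact ext fun z => by rw [mem_img (by fun_prop)]; simp

theorem nat_mem_Fin {n X : M} (hn : n ∊ om) (h : ∀ x, x ∊ n → x ∊ X) : n ∊ Fin X := by
  refine Fin_mono (X := om) ?_ h
  exact nat_induct (P := fun n : M => n ∊ Fin om) (by fun_prop) (Fin_emp _)
    (fun n hn ih => Fin_adj ih hn) n hn

end Ordinals

/-! ### Embeddings and enumerations -/

section Enumerations

variable {M : Type u} [PRSModel M] {A B C : Type*} [Enc M A] [Enc M B] [Enc M C]

/-- The graph conditions are replaced by conditions on the values `ap h x` for `x` in a fixed set.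
In this form they can be shown to be primitive recursive, and graphs of explicit functions are
easily checked to satisfy them. -/
theorem LO.emb_iff {X Y : LO M} {S h : M} (hS : ∀ x, X.car x ↔ x ∊ S) :
    X.Emb Y h ↔ h = gr S (ap h) ∧ (∀ x, x ∊ S → Y.car (ap h x)) ∧
      ∀ x x', x ∊ S → x' ∊ S → X.lt x x' → Y.lt (ap h x) (ap h x') := by
  have hap : PR M (ap h) := by fun_prop
  constructor
  · rintro ⟨h1, h2, h3⟩
    have hmem : ∀ x, x ∊ S → pr x (ap h x) ∊ h := fun x hx => by
      obtain ⟨y, hy, hu⟩ := h2 x ((hS x).2 hx)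
      rwa [ap_eq hy hu]
    refine ⟨ext fun z => ⟨fun hz => ?_, fun hz => ?_⟩, fun x hx => ?_, fun x x' hx hx' hlt => ?_⟩
    · obtain ⟨x, y, hx, -, rfl⟩ := h1 z hz
      rw [pr_mem_gr hap]
      obtain ⟨y', hy', hu⟩ := h2 x hx
      exact ⟨(hS x).1 hx, by rw [ap_eq hy' hu, hu y hz]⟩
    · obtain ⟨x, hx, rfl⟩ := (mem_gr hap).1 hz
      exact hmem x hx
    · obtain ⟨x', y, _, hy, he⟩ := h1 _ (hmem x hx)
      rw [(pr_inj.1 he).2]; exact hy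
    · exact h3 _ _ _ _ (hmem x hx) (hmem x' hx') hlt
  · rintro ⟨h1, h2, h3⟩
    have hmem : ∀ x y, pr x y ∊ h ↔ x ∊ S ∧ y = ap h x := fun x y => by
      rw [← pr_mem_gr hap, ← h1]
    refine ⟨fun p hp => ?_, fun x hx => ?_, fun x x' y y' hx hx' hlt => ?_⟩
    · rw [h1, mem_gr hap] at hp
      obtain ⟨v, hv, rfl⟩ := hp
      exact ⟨v, _, (hS v).2 hv, h2 v hv, rfl⟩
    · exact ⟨ap h x, (hmem _ _).2 ⟨(hS x).1 hx, rfl⟩, fun y hy => ((hmem _ _).1 hy).2⟩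
    · obtain ⟨hxS, rfl⟩ := (hmem _ _).1 hx
      obtain ⟨hxS', rfl⟩ := (hmem _ _).1 hx'
      exact h3 _ _ hxS hxS' hlt

theorem LO.Emb.pr_mem {X Y : LO M} {h x y : M} (H : X.Emb Y h) : pr x y ∊ h ↔ X.car x ∧ y = ap h x := by
  constructor
  · intro hp
    obtain ⟨x', y', hx, -, he⟩ := H.1 _ hp
    obtain ⟨rfl, rfl⟩ := pr_inj.1 he
    obtain ⟨z, hz, hu⟩ := H.2.1 x hx
    exact ⟨hx, by rw [ap_eq hz hu, hu y hp]⟩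
  · rintro ⟨hx, rfl⟩
    obtain ⟨z, hz, hu⟩ := H.2.1 x hx
    rwa [ap_eq hz hu]

theorem LO.Emb.car {X Y : LO M} {h x : M} (H : X.Emb Y h) (hx : X.car x) : Y.car (ap h x) := by
  obtain ⟨x', y', _, hy, he⟩ := H.1 _ (H.pr_mem.2 ⟨hx, rfl⟩)
  rw [(pr_inj.1 he).2]; exact hy

theorem LO.Emb.lt {X Y : LO M} {h x y : M} (H : X.Emb Y h) (hx : X.car x) (hy : X.car y)
    (hlt : X.lt x y) : Y.lt (ap h x) (ap h y) :=
  H.2.2 _ _ _ _ (H.pr_mem.2 ⟨hx, rfl⟩) (H.pr_mem.2 ⟨hy, rfl⟩) hlt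

omit [PRSModel M] in
theorem LO.IsLinear.asymm {X : LO M} (hX : X.IsLinear) {x y : M} (hx : X.car x) (hy : X.car y)
    (h : X.lt x y) : ¬ X.lt y x := fun h' => hX.1 x hx (hX.2.1 x y x hx hy hx h h')

omit [PRSModel M] in
theorem LO.IsLinear.ne {X : LO M} (hX : X.IsLinear) {x y : M} (hx : X.car x)
    (h : X.lt x y) : x ≠ y := fun e => hX.1 x hx (by rwa [← e] at h)

omit [PRSModel M] in
theorem LO.lt_iff_of_mono {X Y : LO M} {t : M → M} (hX : X.IsLinear) (hY : Y.IsLinear)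
    {x y : M} (hx : X.car x) (hy : X.car y) (htx : Y.car (t x)) (hty : Y.car (t y))
    (h1 : X.lt x y → Y.lt (t x) (t y)) (h2 : X.lt y x → Y.lt (t y) (t x)) :
    (Y.lt (t x) (t y) ↔ X.lt x y) ∧ (t x = t y ↔ x = y) := by
  rcases hX.2.2 x y hx hy with h | rfl | h
  · have h' := h1 h
    exact ⟨by simp [h, h'], by simp [hX.ne hx h, hY.ne htx h']⟩
  · exact ⟨by simp [hX.1 x hx, hY.1 _ htx], by simp⟩
  · have h' := h2 h
    exact ⟨by simp [hX.asymm hy hx h, hY.asymm hty htx h'],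
      by simp [(hX.ne hy h).symm, (hY.ne hty h').symm]⟩

theorem hom_iff {m n f : M} : Hom m n f ↔ m ∊ om ∧ n ∊ om ∧ f = gr m (ap f) ∧
    (∀ i, i ∊ m → ap f i ∊ n) ∧ ∀ i j, i ∊ m → j ∊ m → i ∊ j → ap f i ∊ ap f j := by
  unfold Hom
  rw [LO.emb_iff (S := m) (fun x => Iff.rfl)]
  rfl

theorem hom_gr {m n : M} {F : M → M} (hF : PR M F) (hm : m ∊ om) (hn : n ∊ om)
    (h1 : ∀ i, i ∊ m → F i ∊ n) (h2 : ∀ i j, i ∊ m → j ∊ m → i ∊ j → F i ∊ F j) :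
    Hom m n (gr m F) := by
  refine hom_iff.2 ⟨hm, hn, ?_, fun i hi => ?_, fun i j hi hj h => ?_⟩
  · refine ext fun z => ?_
    rw [mem_gr hF, mem_gr (by fun_prop)]
    exact exists_congr fun v => and_congr_right fun hv => by rw [ap_gr hF hv]
  · rw [ap_gr hF hi]; exact h1 i hi
  · rw [ap_gr hF hi, ap_gr hF hj]; exact h2 i j hi hj h

section HomAPI

variable {m n f : M} (H : Hom m n f)
include H

theorem Hom.dom : m ∊ om := H.1
theorem Hom.cod : n ∊ om := H.2.1
theorem Hom.ap_mem {i : M} (hi : i ∊ m) : ap f i ∊ n := H.2.2.car hi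
theorem Hom.ap_lt {i j : M} (hi : i ∊ m) (hj : j ∊ m) (h : i ∊ j) : ap f i ∊ ap f j :=
  H.2.2.lt hi hj h
theorem Hom.pr_mem {i j : M} : pr i j ∊ f ↔ i ∊ m ∧ j = ap f i := H.2.2.pr_mem
theorem Hom.eq_gr : f = gr m (ap f) := (hom_iff.1 H).2.2.1
theorem Hom.lt_iff {i j : M} (hi : i ∊ m) (hj : j ∊ m) :
    (ap f i ∊ ap f j ↔ i ∊ j) ∧ (ap f i = ap f j ↔ i = j) :=
  LO.lt_iff_of_mono (t := ap f) (ofOrd_linear (ord_nat H.1)) (ofOrd_linear (ord_nat H.2.1)) hi hj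
    (H.ap_mem hi) (H.ap_mem hj) (H.ap_lt hi hj) (H.ap_lt hj hi)

end HomAPI

theorem Hom.ext {m n n' f g : M} (hf : Hom m n f) (hg : Hom m n' g)
    (h : ∀ i, i ∊ m → ap f i = ap g i) : f = g := by
  rw [hf.eq_gr, hg.eq_gr]
  refine PRS.ext fun z => ?_
  rw [mem_gr (by fun_prop), mem_gr (by fun_prop)]
  exact exists_congr fun v => and_congr_right fun hv => by rw [h v hv]

/-- linear orders on sets with a primitive recursive order relation -/
structure LO.Good (X : LO M) : Prop where
  set : ∃ A, ∀ x, X.car x ↔ x ∊ A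
  lt : PR M (fun p : M × M => X.lt p.1 p.2)
  lin : X.IsLinear

theorem LO.Good.PR_lt {X : LO M} (hX : X.Good) {f g : A → M} (hf : PR M f) (hg : PR M g) :
    PR M (fun a => X.lt (f a) (g a)) :=
  PR.comp (f := fun p : M × M => X.lt p.1 p.2) hX.lt (hf.prodMk hg)

theorem ofOrd_good {α : M} (hα : IsOrd α) : (LO.ofOrd α).Good :=
  ⟨⟨α, fun _ => Iff.rfl⟩, PR.mem (by fun_prop) (by fun_prop), ofOrd_linear hα⟩

theorem LO.enum_iff {X : LO M} {a k e : M} : X.Enum a k e ↔ k ∊ om ∧ e = gr k (ap e) ∧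
    (∀ i, i ∊ k → X.car (ap e i)) ∧
    (∀ i j, i ∊ k → j ∊ k → i ∊ j → X.lt (ap e i) (ap e j)) ∧ a = img k (ap e) := by
  unfold LO.Enum
  have hap : PR M (ap e) := by fun_prop
  constructor
  · rintro ⟨hk, he, ha⟩
    obtain ⟨h1, h2, h3⟩ := (LO.emb_iff (S := k) (fun x => Iff.rfl)).1 he
    refine ⟨hk, h1, h2, h3, PRS.ext fun z => ?_⟩
    rw [ha, mem_img hap]
    exact exists_congr fun i => he.pr_mem
  · rintro ⟨hk, h1, h2, h3, ha⟩
    have he : (LO.ofOrd k).Emb X e := (LO.emb_iff (S := k) (fun x => Iff.rfl)).2 ⟨h1, h2, h3⟩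
    refine ⟨hk, he, fun x => ?_⟩
    rw [ha, mem_img hap]
    exact exists_congr fun i => he.pr_mem.symm

theorem LO.enum_gr {X : LO M} {k : M} {F : M → M} (hF : PR M F) (hk : k ∊ om)
    (h1 : ∀ i, i ∊ k → X.car (F i))
    (h2 : ∀ i j, i ∊ k → j ∊ k → i ∊ j → X.lt (F i) (F j)) :
    X.Enum (img k F) k (gr k F) := by
  refine LO.enum_iff.2 ⟨hk, ?_, fun i hi => ?_, fun i j hi hj h => ?_, ?_⟩
  · refine PRS.ext fun z => ?_
    rw [mem_gr hF, mem_gr (by fun_prop)]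
    exact exists_congr fun v => and_congr_right fun hv => by rw [ap_gr hF hv]
  · rw [ap_gr hF hi]; exact h1 i hi
  · rw [ap_gr hF hi, ap_gr hF hj]; exact h2 i j hi hj h
  · refine PRS.ext fun z => ?_
    rw [mem_img hF, mem_img (by fun_prop)]
    exact exists_congr fun v => and_congr_right fun hv => by rw [ap_gr hF hv]

section EnumAPI

variable {X : LO M} {a k e : M} (H : X.Enum a k e)
include H

theorem LO.Enum.nat : k ∊ om := H.1
theorem LO.Enum.car {i : M} (hi : i ∊ k) : X.car (ap e i) := H.2.1.car hi
theorem LO.Enum.lt {i j : M} (hi : i ∊ k) (hj : j ∊ k) (h : i ∊ j) : X.lt (ap e i) (ap e j) :=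
  H.2.1.lt hi hj h
theorem LO.Enum.pr_mem {i j : M} : pr i j ∊ e ↔ i ∊ k ∧ j = ap e i := H.2.1.pr_mem
theorem LO.Enum.mem {x : M} : x ∊ a ↔ ∃ i, i ∊ k ∧ x = ap e i := by
  rw [H.2.2 x]; exact exists_congr fun i => H.pr_mem
theorem LO.Enum.ap_mem {i : M} (hi : i ∊ k) : ap e i ∊ a := H.mem.2 ⟨i, hi, rfl⟩
theorem LO.Enum.sub {x : M} (hx : x ∊ a) : X.car x := by
  obtain ⟨i, hi, rfl⟩ := H.mem.1 hx; exact H.car hi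
theorem LO.Enum.lt_iff (hX : X.IsLinear) {i j : M} (hi : i ∊ k) (hj : j ∊ k) :
    (X.lt (ap e i) (ap e j) ↔ i ∊ j) ∧ (ap e i = ap e j ↔ i = j) :=
  LO.lt_iff_of_mono (t := ap e) (ofOrd_linear (ord_nat H.1)) hX hi hj (H.car hi) (H.car hj)
    (H.lt hi hj) (H.lt hj hi)
theorem LO.Enum.mem_Fin {S : M} (hS : ∀ x, x ∊ a → x ∊ S) : a ∊ Fin S := by
  have h := LO.enum_iff.1 H
  rw [h.2.2.2.2]
  exact Fin_img (by fun_prop) (nat_mem_Fin (X := k) H.1 fun _ h => h)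
    fun i hi => hS _ (H.ap_mem hi)
theorem LO.Enum.graph_mem_Fin {S : M} (hS : ∀ x, x ∊ a → x ∊ S) : e ∊ Fin (times om S) := by
  have h := LO.enum_iff.1 H
  rw [h.2.1]
  exact Fin_img (by fun_prop) (nat_mem_Fin (X := k) H.1 fun _ h => h)
    fun i hi => pr_mem_times.2 ⟨trans_om _ _ H.1 hi, hS _ (H.ap_mem hi)⟩

end EnumAPI

/-- By induction on `i`: if two increasing enumerations of `a` agree below `i`, the next value of
either one is the least element of `a` that has not been listed yet. -/
theorem LO.Enum.sub_aux {X : LO M} (hX : X.IsLinear) {a k e k' e' : M} (H : X.Enum a k e)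
    (H' : X.Enum a k' e') : ∀ i, i ∊ k → i ∊ k' ∧ ap e i = ap e' i := by
  refine (ord_nat H.nat).induct (by fun_prop) fun i hi ih => ?_
  have hik' : i ∊ k' := by
    by_contra hn
    obtain ⟨j, hj, h⟩ := H'.mem.1 (H.ap_mem hi)
    have hji : j ∊ i := by
      rcases ((ord_nat H.nat).mem hi).not_mem_iff (ord_nat H'.nat) |>.1 hn with h' | h'
      · exact h' ▸ hj
      · exact ((ord_nat H.nat).mem hi).trans h' hj
    rw [← (ih j hji).2, (H.lt_iff hX hi ((ord_nat H.nat).trans hi hji)).2] at h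
    exact notMem_self _ (h ▸ hji : i ∊ i)
  refine ⟨hik', ?_⟩
  obtain ⟨j, hj, h⟩ := H'.mem.1 (H.ap_mem hi)
  obtain ⟨l, hl, h'⟩ := H.mem.1 (H'.ap_mem hik')
  have hji : ¬ j ∊ i := fun hji => by
    rw [← (ih j hji).2, (H.lt_iff hX hi ((ord_nat H.nat).trans hi hji)).2] at h
    exact notMem_self _ (h ▸ hji : i ∊ i)
  have hli : ¬ l ∊ i := fun hli => by
    rw [(ih l hli).2, (H'.lt_iff hX hik' (ih l hli).1).2] at h'
    exact notMem_self _ (h' ▸ hli : i ∊ i)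
  have oi := (ord_nat H.nat).mem hi
  rcases ((ord_nat H'.nat).mem hj).not_mem_iff oi |>.1 hji with h1 | h1
  · rw [h, h1]
  rcases ((ord_nat H.nat).mem hl).not_mem_iff oi |>.1 hli with h2 | h2
  · rw [h', h2]
  have e1 : X.lt (ap e' i) (ap e i) := by rw [h]; exact H'.lt hik' hj h1
  have e2 : X.lt (ap e i) (ap e' i) := by rw [h']; exact H.lt hi hl h2
  exact (hX.asymm (H.car hi) (H'.car hik') e2 e1).elim

theorem LO.Enum.unique {X : LO M} (hX : X.IsLinear) {a k e k' e' : M} (H : X.Enum a k e)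
    (H' : X.Enum a k' e') : k = k' ∧ e = e' := by
  have h1 := H.sub_aux hX H'
  have h2 := H'.sub_aux hX H
  have hk : k = k' := PRS.ext fun i => ⟨fun h => (h1 i h).1, fun h => (h2 i h).1⟩
  refine ⟨hk, ?_⟩
  rw [(LO.enum_iff.1 H).2.1, (LO.enum_iff.1 H').2.1]
  refine PRS.ext fun z => ?_
  rw [mem_gr (by fun_prop), mem_gr (by fun_prop), ← hk]
  exact exists_congr fun v => and_congr_right fun hv => by rw [(h1 v hv).2]

theorem LO.PR_enum {X : LO M} (hX : X.Good) {a k e : A → M} (ha : PR M a) (hk : PR M k)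
    (he : PR M e) : PR M (fun p => X.Enum (a p) (k p) (e p)) := by
  obtain ⟨S, hS⟩ := hX.set
  have hlt := hX.PR_lt (A := (A × M) × M) (f := fun q => ap (e q.1.1) q.1.2)
    (g := fun q => ap (e q.1.1) q.2) (by fun_prop) (by fun_prop)
  refine PR.congr (Q := fun p => k p ∊ om ∧ e p = gr (k p) (ap (e p)) ∧
    BAll (k p) (fun i => ap (e p) i ∊ S) ∧
    BAll (k p) (fun i => BAll (k p) fun j => i ∊ j → X.lt (ap (e p) i) (ap (e p) j)) ∧
    a p = img (k p) (ap (e p))) (by fun_prop) fun p => ?_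
  rw [LO.enum_iff]
  simp only [hS, BAll]
  have : (∀ i j, i ∊ k p → j ∊ k p → i ∊ j → X.lt (ap (e p) i) (ap (e p) j)) ↔
    ∀ z, z ∊ k p → ∀ z_1, z_1 ∊ k p → z ∊ z_1 → X.lt (ap (e p) z) (ap (e p) z_1) := by grind
  rw [this]

theorem LO.Good.exists_enum {X : LO M} (hX : X.Good) {S a : M} (ha : a ∊ Fin S)
    (hS : ∀ x, x ∊ a → X.car x) : ∃ k e, X.Enum a k e := by
  obtain ⟨D, hD⟩ := hX.set
  suffices ∀ a, a ∊ Fin D → BEx om fun k => BEx (Fin (times om D)) fun e => X.Enum a k e by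
    obtain ⟨k, -, e, -, h⟩ := this a (Fin_mono ha fun x hx => (hD x).1 (hS x hx))
    exact ⟨k, e, h⟩
  have hPR := LO.PR_enum hX (A := (M × M) × M) (a := fun p => p.1.1) (k := fun p => p.1.2)
    (e := fun p => p.2) (by fun_prop) (by fun_prop) (by fun_prop)
  refine Fin_induct (by fun_prop) ?_ ?_
  · have h := LO.enum_gr (X := X) (k := emp) (F := fun x => x) (by fun_prop) emp_mem_om
      (fun i hi => (notMem_emp hi).elim) (fun i _ hi => (notMem_emp hi).elim)
    have he : img emp (fun x : M => x) = emp := eq_emp fun z hz => by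
      rw [mem_img (by fun_prop)] at hz
      obtain ⟨v, hv, -⟩ := hz
      exact notMem_emp hv
    rw [he] at h
    exact ⟨emp, emp_mem_om, _, h.graph_mem_Fin (fun x hx => (notMem_emp hx).elim), h⟩
  · rintro a x ha hx ⟨k, hk, e, -, he⟩
    by_cases hxa : x ∊ a
    · have : adj a x = a := PRS.ext fun z => by
        rw [mem_adj]
        exact ⟨by rintro (h | rfl) <;> assumption, Or.inl⟩
      rw [this]
      exact ⟨k, hk, e, he.graph_mem_Fin (Fin_sub ha), he⟩
    have ok := ord_nat hk
    have hxX : X.car x := (hD x).2 hx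
    have hPlt : PR M fun i => X.lt (ap e i) x := hX.PR_lt (by fun_prop) (by fun_prop)
    -- The position at which `x` is to be inserted. The indices of the values below `x` form an
    -- initial segment of `k`, which is itself a number `p ≤ k`.
    obtain ⟨p, hp⟩ : ∃ p, p = sep k fun i => X.lt (ap e i) x := ⟨_, rfl⟩
    have hmp : ∀ i, i ∊ p ↔ i ∊ k ∧ X.lt (ap e i) x := fun i => by rw [hp, mem_sep hPlt]
    have op : IsOrd p := by
      rw [hp]
      refine ok.sep_ord hPlt fun β ξ hβ hξ h => ?_
      have hξk := ok.trans hβ hξ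
      exact hX.lin.2.1 _ _ _ (he.car hξk) (he.car hβ) hxX (he.lt hξk hβ hξ) h
    have hpk : p ∊ suc k := by
      rw [mem_suc]
      by_contra hn
      push Not at hn
      exact hn.1 (ok.mem_of_ssubset op.1 (fun z hz => ((hmp z).1 hz).1) hn.2)
    have hpom : p ∊ om := trans_om _ _ (suc_mem_om hk) hpk
    have hgt : ∀ i, i ∊ k → ¬ i ∊ p → X.lt x (ap e i) := fun i hi hip => by
      rcases hX.lin.2.2 _ _ (he.car hi) hxX with h | h | h
      · exact (hip ((hmp i).2 ⟨hi, h⟩)).elim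
      · exact (hxa (h ▸ he.ap_mem hi)).elim
      · exact h
    -- Values from position `p` onwards move up by one. An index above `p` is a successor, and `sU`
    -- yields its predecessor.
    obtain ⟨F, hF⟩ : ∃ F : M → M, F = fun i =>
      if i ∊ p then ap e i else if i = p then x else ap e (sU i) := ⟨_, rfl⟩
    have hFPR : PR M F := by rw [hF]; fun_prop
    have F1 : ∀ i, i ∊ p → F i = ap e i := fun i hi => by simp [hF, hi]
    have F2 : F p = x := by simp [hF, notMem_self]
    have F3 : ∀ j, j ∊ k → ¬ j ∊ p → F (suc j) = ap e j := fun j hj hjp => by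
      have h1 : ¬ suc j ∊ p := fun h => hjp (op.trans h (mem_suc_self j))
      have h2 : suc j ≠ p := fun h => hjp (h ▸ mem_suc_self j)
      simp [hF, h1, h2, sU_suc (ok.mem hj).1]
    have hcase : ∀ i, i ∊ suc k → i ∊ p ∨ i = p ∨ ∃ j, j ∊ k ∧ ¬ j ∊ p ∧ i = suc j ∧ p ∊ suc j := by
      intro i hi
      rcases (ok.suc.mem hi).trichotomy op with h | h | h
      · exact Or.inl h
      · exact Or.inr (Or.inl h)
      · obtain ⟨j, hj, rfl, hpj⟩ := exists_pred (trans_om _ _ (suc_mem_om hk) hi) h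
        refine Or.inr (Or.inr ⟨j, ?_, ?_, rfl, h⟩)
        · rcases mem_suc.1 hi with h' | h'
          · exact ok.trans h' (mem_suc_self j)
          · rw [← h']; exact mem_suc_self j
        · rcases hpj with rfl | hpj
          · exact notMem_self _
          · exact (ord_nat hj).asymm hpj
    have hsub : ∀ i, i ∊ p → i ∊ k := fun i hi => ((hmp i).1 hi).1
    have h := LO.enum_gr (X := X) (k := suc k) (F := F) hFPR (suc_mem_om hk)
      (fun i hi => by
        rcases hcase i hi with h | rfl | ⟨j, hj, hjp, rfl, -⟩
        · rw [F1 i h]; exact he.car (hsub i h)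
        · rw [F2]; exact hxX
        · rw [F3 j hj hjp]; exact he.car hj)
      (fun i j hi hj hij => by
        rcases hcase j hj with h | rfl | ⟨j', hj', hjp, rfl, hpj⟩
        · have hip := op.trans h hij
          rw [F1 i hip, F1 j h]
          exact he.lt (hsub i hip) (hsub j h) hij
        · rw [F1 i hij, F2]
          exact ((hmp i).1 hij).2
        · rw [F3 j' hj' hjp]
          rcases hcase i hi with h | rfl | ⟨i', hi', hip, rfl, -⟩
          · rw [F1 i h]
            refine he.lt (hsub i h) hj' ?_
            rcases mem_suc.1 hpj with h' | rfl
            · exact (ok.mem hj').trans h' h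
            · exact h
          · rw [F2]; exact hgt j' hj' hjp
          · rw [F3 i' hi' hip]
            refine he.lt hi' hj' ?_
            rcases mem_suc.1 hij with h' | h'
            · exact (ok.mem hj').trans h' (mem_suc_self _)
            · exact h' ▸ mem_suc_self _)
    have himg : img (suc k) F = adj a x := by
      refine PRS.ext fun z => ?_
      rw [mem_img hFPR, mem_adj]
      constructor
      · rintro ⟨i, hi, rfl⟩
        rcases hcase i hi with h | rfl | ⟨j, hj, hjp, rfl, -⟩
        · rw [F1 i h]; exact Or.inl (he.ap_mem (hsub i h))
        · exact Or.inr F2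
        · rw [F3 j hj hjp]; exact Or.inl (he.ap_mem hj)
      · rintro (h | rfl)
        · obtain ⟨i, hi, rfl⟩ := he.mem.1 h
          by_cases hip : i ∊ p
          · exact ⟨i, mem_suc.2 (Or.inl hi), (F1 i hip).symm⟩
          · exact ⟨suc i, suc_mem_suc ok hi, (F3 i hi hip).symm⟩
        · exact ⟨p, hpk, F2.symm⟩
    rw [himg] at h
    exact ⟨suc k, suc_mem_om hk, _, h.graph_mem_Fin fun y hy => by
      rcases mem_adj.1 hy with hy | rfl
      · exact Fin_sub ha y hy
      · exact hx, h⟩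

end Enumerations

end PRS

namespace PRS

/-! ### Factorization of embeddings -/

section Factor

variable {M : Type u} [PRSModel M]

/-- the argument below `k` at which `e` takes the value `y` -/
def idx (e k y : M) : M := sU (sep k fun i => ap e i = y)

@[fun_prop] theorem PR.idx {A : Type*} [Enc M A] {e k y : A → M} (he : PR M e) (hk : PR M k)
    (hy : PR M y) : PR M (fun a => idx (e a) (k a) (y a)) := by unfold PRS.idx; fun_prop

theorem LO.Enum.idx_ap {X : LO M} (hX : X.IsLinear) {a k e i : M} (H : X.Enum a k e)
    (hi : i ∊ k) : idx e k (ap e i) = i := by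
  refine ext fun z => ?_
  simp only [idx, mem_sU, mem_sep (P := fun j => ap e j = ap e i) (by fun_prop)]
  constructor
  · rintro ⟨j, ⟨hj, h⟩, hz⟩
    rwa [← (H.lt_iff hX hj hi).2.1 h]
  · exact fun h => ⟨i, ⟨hi, rfl⟩, h⟩

theorem Hom.enum {m n f : M} (H : Hom m n f) : (LO.ofOrd n).Enum (img m (ap f)) m f :=
  LO.enum_iff.2 ⟨H.1, H.eq_gr, fun _ hi => H.ap_mem hi, fun _ _ hi hj h => H.ap_lt hi hj h, rfl⟩

theorem LO.Enum.hom {n b m f : M} (hn : n ∊ om) (H : (LO.ofOrd n).Enum b m f) : Hom m n f :=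
  ⟨H.1, hn, H.2.1⟩

theorem Hom.idx_ap {m n f i : M} (H : Hom m n f) (hi : i ∊ m) : idx f m (ap f i) = i :=
  H.enum.idx_ap (ofOrd_linear (ord_nat H.2.1)) hi

theorem LO.Enum.factor {X : LO M} (hX : X.IsLinear) {a m ea c k e : M} (Ha : X.Enum a m ea)
    (Hc : X.Enum c k e) (h : ∀ x, x ∊ a → x ∊ c) :
    ∃ f, Hom m k f ∧ ∀ i, i ∊ m → ap e (ap f i) = ap ea i := by
  have key : ∀ i, i ∊ m → idx e k (ap ea i) ∊ k ∧ ap e (idx e k (ap ea i)) = ap ea i := by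
    intro i hi
    obtain ⟨j, hj, hij⟩ := Hc.mem.1 (h _ (Ha.ap_mem hi))
    rw [hij, Hc.idx_ap hX hj]
    exact ⟨hj, rfl⟩
  have hPR : PR M fun i => idx e k (ap ea i) := by fun_prop
  refine ⟨gr m fun i => idx e k (ap ea i), hom_gr hPR Ha.1 Hc.1 (fun i hi => (key i hi).1)
    (fun i j hi hj hij => ?_), fun i hi => ?_⟩
  · rw [← (Hc.lt_iff hX (key i hi).1 (key j hj).1).1, (key i hi).2, (key j hj).2]
    exact Ha.lt hi hj hij
  · rw [ap_gr hPR hi, (key i hi).2]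

/-- As the ranges of `f₀` and `g₀` cover `k`, the map `h` is prescribed everywhere. It is well
defined and increasing because `f` and `g` have the same relative position as `f₀` and `g₀`. -/
theorem Hom.join {m n k N f₀ g₀ f g : M} (hf₀ : Hom m k f₀) (hg₀ : Hom n k g₀)
    (hs : ∀ l, l ∊ k → (∃ i, i ∊ m ∧ l = ap f₀ i) ∨ ∃ j, j ∊ n ∧ l = ap g₀ j)
    (hf : Hom m N f) (hg : Hom n N g)
    (hp : ∀ i j, i ∊ m → j ∊ n → (ap f₀ i ∊ ap g₀ j ↔ ap f i ∊ ap g j) ∧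
      (ap f₀ i = ap g₀ j ↔ ap f i = ap g j)) :
    ∃ h, Hom k N h ∧ (∀ i, i ∊ m → ap h (ap f₀ i) = ap f i) ∧
      ∀ j, j ∊ n → ap h (ap g₀ j) = ap g j := by
  obtain ⟨H, hH⟩ : ∃ H : M → M, H = fun l => if BEx m (fun i => l = ap f₀ i) then
    ap f (idx f₀ m l) else ap g (idx g₀ n l) := ⟨_, rfl⟩
  have hPR : PR M H := by rw [hH]; fun_prop
  have H1 : ∀ i, i ∊ m → H (ap f₀ i) = ap f i := fun i hi => by
    have : BEx m (fun i' => ap f₀ i = ap f₀ i') := ⟨i, hi, rfl⟩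
    simp only [hH, this, if_true, hf₀.idx_ap hi]
  have H2 : ∀ j, j ∊ n → H (ap g₀ j) = ap g j := fun j hj => by
    by_cases hb : BEx m (fun i' => ap g₀ j = ap f₀ i')
    · obtain ⟨i, hi, h⟩ := hb
      rw [h, H1 i hi, (hp i j hi hj).2.1 h.symm]
    · simp only [hH, hb, if_false, hg₀.idx_ap hj]
  have ok := ord_nat hf₀.cod
  have oN := ord_nat hf.cod
  have hmem : ∀ l, l ∊ k → H l ∊ N := fun l hl => by
    rcases hs l hl with ⟨i, hi, rfl⟩ | ⟨i, hi, rfl⟩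
    · rw [H1 i hi]; exact hf.ap_mem hi
    · rw [H2 i hi]; exact hg.ap_mem hi
  refine ⟨gr k H, hom_gr hPR hf₀.cod hf.cod hmem ?_, ?_, ?_⟩
  · intro l l' hl hl' hll
    rcases hs l hl with ⟨i, hi, rfl⟩ | ⟨i, hi, rfl⟩ <;>
      rcases hs l' hl' with ⟨j, hj, rfl⟩ | ⟨j, hj, rfl⟩
    · rw [H1 i hi, H1 j hj]; exact hf.ap_lt hi hj ((hf₀.lt_iff hi hj).1.1 hll)
    · rw [H1 i hi, H2 j hj]; exact (hp i j hi hj).1.1 hll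
    · rw [H2 i hi, H1 j hj]
      have hn : ¬ ap f₀ j ∊ ap g₀ i := (ok.mem hl').asymm hll
      have hne : ap f₀ j ≠ ap g₀ i := fun e => notMem_self _ (e ▸ hll)
      rw [(hp j i hj hi).1] at hn
      rw [Ne, (hp j i hj hi).2] at hne
      rcases (oN.mem (hf.ap_mem hj)).trichotomy (oN.mem (hg.ap_mem hi)) with h | h | h
      · exact (hn h).elim
      · exact (hne h).elim
      · exact h
    · rw [H2 i hi, H2 j hj]; exact hg.ap_lt hi hj ((hg₀.lt_iff hi hj).1.1 hll)
  · intro i hi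
    rw [ap_gr hPR (hf₀.ap_mem hi), H1 i hi]
  · intro i hi
    rw [ap_gr hPR (hg₀.ap_mem hi), H2 i hi]

end Factor

/-! ### Predilators and their extension to linear orders -/

namespace PD

variable {M : Type u} [PRSModel M]

/-- the value `D(f)(σ)` -/
def mp (D : PD M) (m n f σ : M) : M := if h : ∃ τ, D.map m n f σ τ then h.choose else emp

namespace IsPredilator

variable {D : PD M} (hD : D.IsPredilator)
include hD

theorem map_iff {m n f σ τ : M} (hf : Hom m n f) (hσ : D.car m σ) :
    D.map m n f σ τ ↔ τ = D.mp m n f σ := by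
  obtain ⟨τ', h, hu⟩ := hD.map_total m n f σ hf hσ
  have h' : ∃ τ, D.map m n f σ τ := ⟨τ', h⟩
  have : D.mp m n f σ = τ' := by
    unfold mp
    rw [dif_pos h']
    exact hu _ h'.choose_spec
  rw [this]
  exact ⟨hu τ, fun e => e ▸ h⟩

theorem map_mp {m n f σ : M} (hf : Hom m n f) (hσ : D.car m σ) :
    D.map m n f σ (D.mp m n f σ) := (hD.map_iff hf hσ).2 rfl

theorem mp_car {m n f σ : M} (hf : Hom m n f) (hσ : D.car m σ) : D.car n (D.mp m n f σ) :=
  (hD.map_dom _ _ _ _ _ (hD.map_mp hf hσ)).2.2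

theorem mp_lt {m n f σ τ : M} (hf : Hom m n f) (hσ : D.car m σ) (hτ : D.car m τ) :
    (D.lt n (D.mp m n f σ) (D.mp m n f τ) ↔ D.lt m σ τ) ∧
      (D.mp m n f σ = D.mp m n f τ ↔ σ = τ) :=
  LO.lt_iff_of_mono (t := D.mp m n f) (hD.linear m hf.dom) (hD.linear n hf.cod) hσ hτ
    (hD.mp_car hf hσ) (hD.mp_car hf hτ)
    (hD.map_lt _ _ _ _ _ _ _ (hD.map_mp hf hσ) (hD.map_mp hf hτ))
    (hD.map_lt _ _ _ _ _ _ _ (hD.map_mp hf hτ) (hD.map_mp hf hσ))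

theorem mp_comp {l m n f g h σ : M} (hf : Hom l m f) (hg : Hom m n g) (hh : Hom l n h)
    (hσ : D.car l σ) (e : ∀ i, i ∊ l → ap g (ap f i) = ap h i) :
    D.mp m n g (D.mp l m f σ) = D.mp l n h σ := by
  rw [← hD.map_iff hh hσ]
  refine hD.map_comp l m n f g h σ _ _ hh (fun i j k hij hjk => ?_) (hD.map_mp hf hσ)
    (hD.map_mp hg (hD.mp_car hf hσ))
  rw [hf.pr_mem] at hij
  rw [hg.pr_mem] at hjk
  rw [hh.pr_mem]
  refine ⟨hij.1, ?_⟩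
  rw [hjk.2, hij.2, e i hij.1]

theorem mp_mono {m n f g σ : M} (hf : Hom m n f) (hg : Hom m n g) (hσ : D.car m σ)
    (h : ∀ i, i ∊ m → ap f i = ap g i ∨ ap f i ∊ ap g i) :
    D.mp m n f σ = D.mp m n g σ ∨ D.lt n (D.mp m n f σ) (D.mp m n g σ) := by
  refine hD.monotone m n f g σ _ _ (fun i j j' hj hj' => ?_) (hD.map_mp hf hσ) (hD.map_mp hg hσ)
  rw [hf.pr_mem] at hj
  rw [hg.pr_mem] at hj'
  rw [hj.2, hj'.2]
  exact h i hj.1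

theorem mapLt_iff {m n N f g σ τ : M} (hf : Hom m N f) (hg : Hom n N g) (hσ : D.car m σ)
    (hτ : D.car n τ) : D.MapLt m n N f g σ τ ↔ D.lt N (D.mp m N f σ) (D.mp n N g τ) := by
  unfold MapLt
  simp only [hD.map_iff hf hσ, hD.map_iff hg hτ]
  constructor
  · rintro ⟨_, _, rfl, rfl, h⟩; exact h
  · exact fun h => ⟨_, _, rfl, rfl, h⟩

theorem supp_mp {m n f σ b : M} (hf : Hom m n f) (hσ : D.Tr σ m)
    (hb : D.supp n (D.mp m n f σ) b) : b = img m (ap f) := by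
  refine PRS.ext fun j => ?_
  rw [hD.supp_nat _ _ _ _ _ _ _ (hD.map_mp hf hσ.1) hσ.2 hb, mem_img (by fun_prop)]
  exact exists_congr fun i => by rw [hf.pr_mem]; tauto

/-- By naturality, the support of the common value is the range of `f` and also that of `g`.
Increasing enumerations are unique, so the morphisms agree, and embeddings are injective. -/
theorem mp_inj {m n N f g σ τ : M} (hf : Hom m N f) (hg : Hom n N g) (hσ : D.Tr σ m)
    (hτ : D.Tr τ n) (h : D.mp m N f σ = D.mp n N g τ) : m = n ∧ f = g ∧ σ = τ := by
  obtain ⟨b, hb, -⟩ := hD.supp_total N _ (hD.mp_car hf hσ.1)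
  have h1 := hD.supp_mp hf hσ hb
  rw [h] at hb
  have h2 := hD.supp_mp hg hτ hb
  have e1 := hf.enum
  have e2 := hg.enum
  rw [← h1] at e1
  rw [← h2] at e2
  obtain ⟨rfl, rfl⟩ := e1.unique (ofOrd_linear (ord_nat hf.cod)) e2
  exact ⟨rfl, rfl, (hD.mp_lt hf hσ.1 hτ.1).2.1 h⟩

/-- Enumerate the support of `τ` and pull `τ` back along the enumeration, which the support
condition permits. By naturality the preimage has full support, i.e. it belongs to the trace. -/
theorem normalForm {n τ : M} (hn : n ∊ om) (hτ : D.car n τ) :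
    ∃ m f σ, Hom m n f ∧ D.Tr σ m ∧ τ = D.mp m n f σ := by
  obtain ⟨b, hb, -⟩ := hD.supp_total n τ hτ
  have hbn := (hD.supp_dom _ _ _ hb).2
  have hbF : b ∊ Fin n := Fin_of_sub (nat_mem_Fin hn fun _ h => h) hbn
  obtain ⟨m, f, hE⟩ := (ofOrd_good (ord_nat hn)).exists_enum hbF hbn
  have hf := hE.hom hn
  obtain ⟨σ, hσ⟩ := hD.supp_range m n f τ b hf hb fun j hj => by
    obtain ⟨i, hi, h⟩ := hE.mem.1 hj
    exact ⟨i, hE.pr_mem.2 ⟨hi, h⟩⟩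
  have hσc := (hD.map_dom _ _ _ _ _ hσ).2.1
  refine ⟨m, f, σ, hf, ⟨hσc, ?_⟩, (hD.map_iff hf hσc).1 hσ⟩
  obtain ⟨a, ha, -⟩ := hD.supp_total m σ hσc
  convert ha using 1
  refine PRS.ext fun i => ⟨fun hi => ?_, (hD.supp_dom _ _ _ ha).2 i⟩
  obtain ⟨i', hi', h⟩ := (hD.supp_nat _ _ _ _ _ _ _ hσ ha hb _).1 (hE.ap_mem hi)
  have := (hf.pr_mem.1 h)
  rwa [(hf.lt_iff hi this.1).2.1 this.2]

theorem lt_joint {m n k N f₀ g₀ f g σ τ : M} (hσ : D.car m σ) (hτ : D.car n τ)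
    (hf₀ : Hom m k f₀) (hg₀ : Hom n k g₀)
    (hs : ∀ l, l ∊ k → (∃ i, i ∊ m ∧ l = ap f₀ i) ∨ ∃ j, j ∊ n ∧ l = ap g₀ j)
    (hf : Hom m N f) (hg : Hom n N g)
    (hp : ∀ i j, i ∊ m → j ∊ n → (ap f₀ i ∊ ap g₀ j ↔ ap f i ∊ ap g j) ∧
      (ap f₀ i = ap g₀ j ↔ ap f i = ap g j)) :
    D.lt k (D.mp m k f₀ σ) (D.mp n k g₀ τ) ↔ D.lt N (D.mp m N f σ) (D.mp n N g τ) := by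
  obtain ⟨h, hh, h1, h2⟩ := hf₀.join hg₀ hs hf hg hp
  rw [← hD.mp_comp hf₀ hh hf hσ h1, ← hD.mp_comp hg₀ hh hg hτ h2,
    (hD.mp_lt hh (hD.mp_car hf₀ hσ) (hD.mp_car hg₀ hτ)).1]

omit hD in
theorem exists_joint {X : LO M} (hX : X.Good) {a b m n ea eb : M}
    (ha : X.Enum a m ea) (hb : X.Enum b n eb) : ∃ k e f g, X.Enum (union a b) k e ∧
      Hom m k f ∧ Hom n k g ∧ (∀ i, i ∊ m → ap e (ap f i) = ap ea i) ∧
      (∀ j, j ∊ n → ap e (ap g j) = ap eb j) ∧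
      ∀ l, l ∊ k → (∃ i, i ∊ m ∧ l = ap f i) ∨ ∃ j, j ∊ n ∧ l = ap g j := by
  have hc : ∀ x, x ∊ union a b → X.car x := fun x hx => by
    rcases mem_union.1 hx with hx | hx
    · exact ha.sub hx
    · exact hb.sub hx
  have hF : union a b ∊ Fin (union a b) := Fin_union
    (ha.mem_Fin fun x hx => mem_union.2 (Or.inl hx)) (hb.mem_Fin fun x hx => mem_union.2 (Or.inr hx))
  obtain ⟨k, e, hE⟩ := hX.exists_enum hF hc
  obtain ⟨f, hf, h1⟩ := ha.factor hX.lin hE fun x hx => mem_union.2 (Or.inl hx)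
  obtain ⟨g, hg, h2⟩ := hb.factor hX.lin hE fun x hx => mem_union.2 (Or.inr hx)
  refine ⟨k, e, f, g, hE, hf, hg, h1, h2, fun l hl => ?_⟩
  rcases mem_union.1 (hE.ap_mem hl) with h | h
  · obtain ⟨i, hi, hh⟩ := ha.mem.1 h
    rw [← h1 i hi] at hh
    exact Or.inl ⟨i, hi, (hE.lt_iff hX.lin hl (hf.ap_mem hi)).2.1 hh⟩
  · obtain ⟨i, hi, hh⟩ := hb.mem.1 h
    rw [← h2 i hi] at hh
    exact Or.inr ⟨i, hi, (hE.lt_iff hX.lin hl (hg.ap_mem hi)).2.1 hh⟩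

/-- the comparison of `D(f)(σ)` and `D(g)(τ)` depends on the relative position of the values of
`f` and `g` only -/
theorem lt_pattern {m n N N' f g f' g' σ τ : M} (hσ : D.car m σ) (hτ : D.car n τ)
    (hf : Hom m N f) (hg : Hom n N g) (hf' : Hom m N' f') (hg' : Hom n N' g')
    (hp : ∀ i j, i ∊ m → j ∊ n → (ap f i ∊ ap g j ↔ ap f' i ∊ ap g' j) ∧
      (ap f i = ap g j ↔ ap f' i = ap g' j)) :
    D.lt N (D.mp m N f σ) (D.mp n N g τ) ↔ D.lt N' (D.mp m N' f' σ) (D.mp n N' g' τ) := by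
  have hN := ofOrd_good (ord_nat hf.cod)
  obtain ⟨k, e, f₀, g₀, hE, hf₀, hg₀, h1, h2, hs⟩ := exists_joint hN hf.enum hg.enum
  have he := hE.hom hf.cod
  have key : ∀ i j, i ∊ m → j ∊ n → (ap f₀ i ∊ ap g₀ j ↔ ap f i ∊ ap g j) ∧
      (ap f₀ i = ap g₀ j ↔ ap f i = ap g j) := fun i j hi hj => by
    rw [← h1 i hi, ← h2 j hj, (he.lt_iff (hf₀.ap_mem hi) (hg₀.ap_mem hj)).1,
      (he.lt_iff (hf₀.ap_mem hi) (hg₀.ap_mem hj)).2]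
    simp
  rw [← hD.lt_joint hσ hτ hf₀ hg₀ hs hf hg key, hD.lt_joint hσ hτ hf₀ hg₀ hs hf' hg']
  intro i j hi hj
  rw [(key i j hi hj).1, (key i j hi hj).2]
  exact hp i j hi hj

omit hD in
theorem ext_car {X : LO M} {σ a : M} :
    (D.ext X).car (pr σ a) ↔ ∃ k e, X.Enum a k e ∧ D.Tr σ k := by
  constructor
  · rintro ⟨σ', a', k, e, h, h1, h2⟩
    obtain ⟨rfl, rfl⟩ := pr_inj.1 h
    exact ⟨k, e, h1, h2⟩
  · rintro ⟨k, e, h1, h2⟩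
    exact ⟨σ, a, k, e, rfl, h1, h2⟩

/-- The order on `D(X)` is defined via enumerations of `a ∪ b`. Since only the relative position of
the arguments matters, any morphisms into a common `N` that realize this position can be used
instead. -/
theorem ext_lt_iff {X : LO M} (hX : X.Good) {a b m n ea eb N f g σ τ : M}
    (ha : X.Enum a m ea) (hb : X.Enum b n eb) (hσ : D.Tr σ m) (hτ : D.Tr τ n)
    (hf : Hom m N f) (hg : Hom n N g)
    (hp : ∀ i j, i ∊ m → j ∊ n → (X.lt (ap ea i) (ap eb j) ↔ ap f i ∊ ap g j) ∧
      (ap ea i = ap eb j ↔ ap f i = ap g j)) :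
    (D.ext X).lt (pr σ a) (pr τ b) ↔ D.lt N (D.mp m N f σ) (D.mp n N g τ) := by
  have key : ∀ k e f₀ g₀ c, X.Enum c k e → Hom m k f₀ → Hom n k g₀ →
      (∀ i, i ∊ m → ap e (ap f₀ i) = ap ea i) → (∀ j, j ∊ n → ap e (ap g₀ j) = ap eb j) →
      ∀ i j, i ∊ m → j ∊ n → (ap f₀ i ∊ ap g₀ j ↔ ap f i ∊ ap g j) ∧
      (ap f₀ i = ap g₀ j ↔ ap f i = ap g j) := by
    intro k e f₀ g₀ c hE hf₀ hg₀ h1 h2 i j hi hj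
    rw [← (hp i j hi hj).1, ← (hp i j hi hj).2, ← h1 i hi, ← h2 j hj,
      (hE.lt_iff hX.lin (hf₀.ap_mem hi) (hg₀.ap_mem hj)).1,
      (hE.lt_iff hX.lin (hf₀.ap_mem hi) (hg₀.ap_mem hj)).2]
    simp
  constructor
  · rintro ⟨σ', a', τ', b', c, hz, hw, -, ka, ea', kb, eb', kc, ec, f', g', ha', hb', hc, hf', hg',
      h1, h2, hlt⟩
    obtain ⟨rfl, rfl⟩ := pr_inj.1 hz
    obtain ⟨rfl, rfl⟩ := pr_inj.1 hw
    obtain ⟨rfl, rfl⟩ := ha.unique hX.lin ha'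
    obtain ⟨rfl, rfl⟩ := hb.unique hX.lin hb'
    rw [hD.mapLt_iff hf' hg' hσ.1 hτ.1] at hlt
    refine (hD.lt_pattern hσ.1 hτ.1 hf' hg' hf hg (key kc ec f' g' c hc hf' hg' ?_ ?_)).1 hlt
    · intro i hi
      have := h1 i (ap f' i) (ap ea i) (hf'.pr_mem.2 ⟨hi, rfl⟩) (ha.pr_mem.2 ⟨hi, rfl⟩)
      exact (hc.pr_mem.1 this).2.symm
    · intro i hi
      have := h2 i (ap g' i) (ap eb i) (hg'.pr_mem.2 ⟨hi, rfl⟩) (hb.pr_mem.2 ⟨hi, rfl⟩)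
      exact (hc.pr_mem.1 this).2.symm
  · intro hlt
    obtain ⟨k, e, f₀, g₀, hE, hf₀, hg₀, h1, h2, hs⟩ := exists_joint hX ha hb
    rw [← hD.lt_joint hσ.1 hτ.1 hf₀ hg₀ hs hf hg (key k e f₀ g₀ _ hE hf₀ hg₀ h1 h2),
      ← hD.mapLt_iff hf₀ hg₀ hσ.1 hτ.1] at hlt
    refine ⟨σ, a, τ, b, union a b, rfl, rfl, fun x => mem_union, m, ea, n, eb, k, e, f₀, g₀,
      ha, hb, hE, hf₀, hg₀, fun i j x hij hx => ?_, fun i j x hij hx => ?_, hlt⟩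
    · rw [hf₀.pr_mem] at hij
      rw [ha.pr_mem] at hx
      rw [hE.pr_mem, hij.2, hx.2]
      exact ⟨hf₀.ap_mem hij.1, (h1 i hij.1).symm⟩
    · rw [hg₀.pr_mem] at hij
      rw [hb.pr_mem] at hx
      rw [hE.pr_mem, hij.2, hx.2]
      exact ⟨hg₀.ap_mem hij.1, (h2 i hij.1).symm⟩

theorem ext_lt_val {X : LO M} (hX : X.Good) {a b c m n N ea eb e f g σ τ : M}
    (ha : X.Enum a m ea) (hb : X.Enum b n eb) (hc : X.Enum c N e) (hσ : D.Tr σ m) (hτ : D.Tr τ n)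
    (hf : Hom m N f) (hg : Hom n N g) (h1 : ∀ i, i ∊ m → ap e (ap f i) = ap ea i)
    (h2 : ∀ j, j ∊ n → ap e (ap g j) = ap eb j) :
    ((D.ext X).lt (pr σ a) (pr τ b) ↔ D.lt N (D.mp m N f σ) (D.mp n N g τ)) ∧
      (pr σ a = pr τ b ↔ D.mp m N f σ = D.mp n N g τ) := by
  constructor
  · refine hD.ext_lt_iff hX ha hb hσ hτ hf hg fun i j hi hj => ?_
    rw [← h1 i hi, ← h2 j hj]
    exact hc.lt_iff hX.lin (hf.ap_mem hi) (hg.ap_mem hj)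
  · constructor
    · intro h
      obtain ⟨rfl, rfl⟩ := pr_inj.1 h
      obtain ⟨rfl, rfl⟩ := ha.unique hX.lin hb
      have : f = g := hf.ext hg fun i hi =>
        (hc.lt_iff hX.lin (hf.ap_mem hi) (hg.ap_mem hi)).2.1 (by rw [h1 i hi, h2 i hi])
      rw [this]
    · intro h
      obtain ⟨rfl, rfl, rfl⟩ := hD.mp_inj hf hg hσ hτ h
      rw [pr_inj]
      refine ⟨rfl, PRS.ext fun x => ?_⟩
      rw [ha.mem, hb.mem]
      exact exists_congr fun i => and_congr_right fun hi => by rw [← h1 i hi, ← h2 i hi]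

/-- finitely many elements of `D(X)` can be compared in some `D(N)` -/
theorem exists_val {X : LO M} (hX : X.Good) {c S : M} (hc : c ∊ Fin S)
    (hcX : ∀ x, x ∊ c → X.car x) : ∃ (N : M) (v : M → M), N ∊ om ∧
      (∀ σ a, (D.ext X).car (pr σ a) → (∀ x, x ∊ a → x ∊ c) → D.car N (v (pr σ a))) ∧
      ∀ σ a τ b, (D.ext X).car (pr σ a) → (∀ x, x ∊ a → x ∊ c) →
        (D.ext X).car (pr τ b) → (∀ x, x ∊ b → x ∊ c) →
        ((D.ext X).lt (pr σ a) (pr τ b) ↔ D.lt N (v (pr σ a)) (v (pr τ b))) ∧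
        (pr σ a = pr τ b ↔ v (pr σ a) = v (pr τ b)) := by
  obtain ⟨N, e, hE⟩ := hX.exists_enum hc hcX
  have key : ∀ z, ∃ w, ∀ σ a, z = pr σ a → (D.ext X).car (pr σ a) → (∀ x, x ∊ a → x ∊ c) →
      ∃ k ea f, X.Enum a k ea ∧ D.Tr σ k ∧ Hom k N f ∧
        (∀ i, i ∊ k → ap e (ap f i) = ap ea i) ∧ w = D.mp k N f σ := by
    intro z
    by_cases hz : ∃ σ a, z = pr σ a ∧ (D.ext X).car (pr σ a) ∧ ∀ x, x ∊ a → x ∊ c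
    · obtain ⟨σ, a, rfl, hcar, hsub⟩ := hz
      obtain ⟨k, ea, ha, hσ⟩ := ext_car.1 hcar
      obtain ⟨f, hf, h⟩ := ha.factor hX.lin hE hsub
      refine ⟨D.mp k N f σ, fun σ' a' h' _ _ => ?_⟩
      obtain ⟨rfl, rfl⟩ := pr_inj.1 h'
      exact ⟨k, ea, f, ha, hσ, hf, h, rfl⟩
    · exact ⟨emp, fun σ a h1 h2 h3 => (hz ⟨σ, a, h1, h2, h3⟩).elim⟩
  choose v hv using key
  refine ⟨N, v, hE.nat, fun σ a h1 h2 => ?_, fun σ a τ b h1 h2 h3 h4 => ?_⟩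
  · obtain ⟨k, ea, f, ha, hσ, hf, -, h⟩ := hv _ σ a rfl h1 h2
    rw [h]
    exact hD.mp_car hf hσ.1
  · obtain ⟨k, ea, f, ha, hσ, hf, hfe, h⟩ := hv _ σ a rfl h1 h2
    obtain ⟨l, eb, g, hb, hτ, hg, hge, h'⟩ := hv _ τ b rfl h3 h4
    rw [h, h']
    exact hD.ext_lt_val hX ha hb hE hσ hτ hf hg hfe hge

omit hD in
theorem ext_car_dest {X : LO M} {z : M} (h : (D.ext X).car z) : ∃ σ a, z = pr σ a := by
  obtain ⟨σ, a, k, e, rfl, -⟩ := h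
  exact ⟨σ, a, rfl⟩

/-- The axioms of linear orders involve at most three elements at a time. These can be evaluated in
a single `D(N)`, where `N` enumerates the union of their supports. -/
theorem ext_linear {X : LO M} (hX : X.Good) : (D.ext X).IsLinear := by
  have key : ∀ x y z, (D.ext X).car x → (D.ext X).car y → (D.ext X).car z →
      ∃ (N : M) (v : M → M), N ∊ om ∧ (D.car N (v x) ∧ D.car N (v y) ∧ D.car N (v z)) ∧
        ((D.ext X).lt x y ↔ D.lt N (v x) (v y)) ∧ ((D.ext X).lt y x ↔ D.lt N (v y) (v x)) ∧
        ((D.ext X).lt y z ↔ D.lt N (v y) (v z)) ∧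
        ((D.ext X).lt x z ↔ D.lt N (v x) (v z)) ∧ (x = y ↔ v x = v y) := by
    intro x y z hx hy hz
    obtain ⟨σ, a, rfl⟩ := ext_car_dest hx
    obtain ⟨τ, b, rfl⟩ := ext_car_dest hy
    obtain ⟨ρ, c, rfl⟩ := ext_car_dest hz
    obtain ⟨_, _, ha, -⟩ := ext_car.1 hx
    obtain ⟨_, _, hb, -⟩ := ext_car.1 hy
    obtain ⟨_, _, hc, -⟩ := ext_car.1 hz
    have ma : ∀ x, x ∊ a → x ∊ union (union a b) c := fun x hx => by simp [hx]
    have mb : ∀ x, x ∊ b → x ∊ union (union a b) c := fun x hx => by simp [hx]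
    have mc : ∀ x, x ∊ c → x ∊ union (union a b) c := fun x hx => by simp [hx]
    have hF := Fin_union (Fin_union (ha.mem_Fin ma) (hb.mem_Fin mb)) (hc.mem_Fin mc)
    obtain ⟨N, v, hN, h1, h2⟩ := hD.exists_val hX hF fun x hx => by
      simp only [mem_union] at hx
      rcases hx with (hx | hx) | hx
      · exact ha.sub hx
      · exact hb.sub hx
      · exact hc.sub hx
    exact ⟨N, v, hN, ⟨h1 _ _ hx ma, h1 _ _ hy mb, h1 _ _ hz mc⟩, (h2 _ _ _ _ hx ma hy mb).1,
      (h2 _ _ _ _ hy mb hx ma).1, (h2 _ _ _ _ hy mb hz mc).1, (h2 _ _ _ _ hx ma hz mc).1,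
      (h2 _ _ _ _ hx ma hy mb).2⟩
  refine ⟨fun x hx => ?_, fun x y z hx hy hz => ?_, fun x y hx hy => ?_⟩
  · obtain ⟨N, v, hN, hc, h, -⟩ := key x x x hx hx hx
    rw [h]
    exact (hD.linear N hN).1 _ hc.1
  · obtain ⟨N, v, hN, hc, h1, -, h2, h3, -⟩ := key x y z hx hy hz
    rw [h1, h2, h3]
    exact (hD.linear N hN).2.1 _ _ _ hc.1 hc.2.1 hc.2.2
  · obtain ⟨N, v, hN, hc, h1, h2, -, -, h3⟩ := key x y x hx hy hx
    rw [h1, h2, h3]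
    exact (hD.linear N hN).2.2 _ _ hc.1 hc.2.1

omit hD in
theorem _root_.PRS.LO.Enum.image {X Y : LO M} {t : M → M} (ht : PR M t) {a k e : M}
    (ha : X.Enum a k e) (h1 : ∀ x, x ∊ a → Y.car (t x))
    (h2 : ∀ x y, x ∊ a → y ∊ a → X.lt x y → Y.lt (t x) (t y)) :
    Y.Enum (img a t) k (gr k fun i => t (ap e i)) := by
  have := LO.enum_gr (X := Y) (k := k) (F := fun i => t (ap e i)) (by fun_prop) ha.nat
    (fun i hi => h1 _ (ha.ap_mem hi)) fun i j hi hj h => h2 _ _ (ha.ap_mem hi) (ha.ap_mem hj)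
      (ha.lt hi hj h)
  convert this using 1
  refine PRS.ext fun z => ?_
  rw [mem_img ht, mem_img (by fun_prop)]
  constructor
  · rintro ⟨v, hv, rfl⟩
    obtain ⟨i, hi, rfl⟩ := ha.mem.1 hv
    exact ⟨i, hi, rfl⟩
  · rintro ⟨i, hi, rfl⟩
    exact ⟨_, ha.ap_mem hi, rfl⟩

/-- strictly increasing maps induce embeddings -/
theorem ext_image {X Y : LO M} (hX : X.Good) (hY : Y.Good) {t : M → M} (ht : PR M t)
    (h1 : ∀ x, X.car x → Y.car (t x))
    (h2 : ∀ x y, X.car x → X.car y → X.lt x y → Y.lt (t x) (t y)) {σ a τ b : M}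
    (hσ : (D.ext X).car (pr σ a)) (hτ : (D.ext X).car (pr τ b)) :
    (D.ext Y).lt (pr σ (img a t)) (pr τ (img b t)) ↔ (D.ext X).lt (pr σ a) (pr τ b) := by
  obtain ⟨m, ea, ha, hσ⟩ := ext_car.1 hσ
  obtain ⟨n, eb, hb, hτ⟩ := ext_car.1 hτ
  obtain ⟨k, e, f, g, hE, hf, hg, hfe, hge, -⟩ := exists_joint hX ha hb
  rw [(hD.ext_lt_val hX ha hb hE hσ hτ hf hg hfe hge).1]
  have ha' := ha.image ht (fun x hx => h1 x (ha.sub hx))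
    fun x y hx hy => h2 x y (ha.sub hx) (ha.sub hy)
  have hb' := hb.image ht (fun x hx => h1 x (hb.sub hx))
    fun x y hx hy => h2 x y (hb.sub hx) (hb.sub hy)
  refine hD.ext_lt_iff hY ha' hb' hσ hτ hf hg fun i j hi hj => ?_
  have hPa : PR M fun i => t (ap ea i) := by fun_prop
  have hPb : PR M fun i => t (ap eb i) := by fun_prop
  rw [ap_gr hPa hi, ap_gr hPb hj]
  have cx := ha.car hi
  have cy := hb.car hj
  have := LO.lt_iff_of_mono hX.lin hY.lin cx cy (h1 _ cx) (h1 _ cy) (h2 _ _ cx cy) (h2 _ _ cy cx)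
  rw [this.1, this.2, ← hfe i hi, ← hge j hj]
  exact hE.lt_iff hX.lin (hf.ap_mem hi) (hg.ap_mem hj)

omit hD in
theorem ext_image_car {X Y : LO M} {t : M → M} (ht : PR M t)
    (h1 : ∀ x, X.car x → Y.car (t x))
    (h2 : ∀ x y, X.car x → X.car y → X.lt x y → Y.lt (t x) (t y)) {σ a : M}
    (hσ : (D.ext X).car (pr σ a)) : (D.ext Y).car (pr σ (img a t)) := by
  obtain ⟨m, ea, ha, hσ⟩ := ext_car.1 hσ
  exact ext_car.2 ⟨m, _, ha.image ht (fun x hx => h1 x (ha.sub hx))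
    (fun x y hx hy => h2 x y (ha.sub hx) (ha.sub hy)), hσ⟩

/-- monotonicity for the extension of `D` to arbitrary orders -/
theorem ext_mono {X : LO M} (hX : X.Good) {a b k ea eb σ : M} (hσ : D.Tr σ k)
    (ha : X.Enum a k ea) (hb : X.Enum b k eb)
    (h : ∀ i, i ∊ k → ap ea i = ap eb i ∨ X.lt (ap ea i) (ap eb i)) :
    pr σ a = pr σ b ∨ (D.ext X).lt (pr σ a) (pr σ b) := by
  obtain ⟨N, e, f, g, hE, hf, hg, hfe, hge, -⟩ := exists_joint hX ha hb
  have := hD.ext_lt_val hX ha hb hE hσ hσ hf hg hfe hge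
  rw [this.1, this.2]
  refine hD.mp_mono hf hg hσ.1 fun i hi => ?_
  have h' := hE.lt_iff hX.lin (hf.ap_mem hi) (hg.ap_mem hi)
  rw [← h'.1, ← h'.2, hfe i hi, hge i hi]
  exact h i hi

end IsPredilator

end PD

end PRS

/-! ### Leading arguments: uniqueness and thresholds -/

namespace PRS

variable {M : Type u} [PRSModel M]

/-- the composition of `f`, with domain `m`, and `t` -/
def cmp (m f t : M) : M := gr m fun i => ap t (ap f i)

theorem ap_cmp {m f t i : M} (hi : i ∊ m) : ap (cmp m f t) i = ap t (ap f i) :=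
  ap_gr (f := fun i => ap t (ap f i)) (by fun_prop) hi

theorem Hom.cmp {m n N f t : M} (hf : Hom m n f) (ht : Hom n N t) : Hom m N (cmp m f t) :=
  hom_gr (by fun_prop) hf.dom ht.cod (fun _ hi => ht.ap_mem (hf.ap_mem hi))
    fun _ _ hi hj h => ht.ap_lt (hf.ap_mem hi) (hf.ap_mem hj) (hf.ap_lt hi hj h)

theorem Hom.mem_Fin {m n f : M} (hf : Hom m n f) : f ∊ Fin (times om om) :=
  hf.enum.graph_mem_Fin fun x hx => by
    obtain ⟨i, hi, rfl⟩ := hf.enum.mem.1 hx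
    exact trans_om _ _ hf.cod (hf.ap_mem hi)

@[fun_prop] theorem PR.Hom {A : Type*} [Enc M A] {m n f : A → M} (hm : PR M m) (hn : PR M n)
    (hf : PR M f) : PR M (fun a => Hom (m a) (n a) (f a)) := by
  refine PR.congr (Q := fun a => m a ∊ om ∧ n a ∊ om ∧ f a = PRS.gr (m a) (PRS.ap (f a)) ∧
    PRS.BAll (m a) (fun i => PRS.ap (f a) i ∊ n a) ∧ PRS.BAll (m a) fun i => PRS.BAll (m a) fun j =>
      i ∊ j → PRS.ap (f a) i ∊ PRS.ap (f a) j) (by fun_prop) fun a => ?_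
  rw [hom_iff]
  simp only [PRS.BAll]
  grind

/-- the sum of `m` and `n` in the sense of `NatSum` exists -/
theorem natSum_oadd {m n : M} (hm : m ∊ om) (hn : n ∊ om) : NatSum m n (oadd m n) := by
  have hne : (suc emp : M) ≠ emp := fun h => notMem_emp (h ▸ mem_suc_self (emp : M))
  let t : M → M := fun z => if fst z = emp then snd z else oadd m (snd z)
  have ht : PR M t := by fun_prop
  have t1 : ∀ x, t (LO.inl x) = x := fun x => by simp [t, LO.inl]
  have t2 : ∀ x, t (LO.inr x) = oadd m x := fun x => by simp [t, LO.inr, hne]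
  let S : M := union (img m LO.inl) (img n LO.inr)
  have hl : PR M (LO.inl : M → M) := by unfold LO.inl; fun_prop
  have hr : PR M (LO.inr : M → M) := by unfold LO.inr; fun_prop
  have hS : ∀ x, ((LO.ofOrd m).add (LO.ofOrd n)).car x ↔ x ∊ S := fun x => by
    rw [mem_union, mem_img hl, mem_img hr]
    rfl
  have hgr : ∀ x, x ∊ S → ap (gr S t) x = t x := fun x hx => ap_gr ht hx
  refine ⟨oadd_nat hm hn, gr S t, (LO.emb_iff hS).2 ⟨?_, fun x hx => ?_, fun x x' hx hx' h => ?_⟩,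
    fun y hy => ?_⟩
  · refine ext fun z => ?_
    rw [mem_gr ht, mem_gr (by fun_prop)]
    exact exists_congr fun v => and_congr_right fun hv => by rw [hgr v hv]
  · rw [hgr x hx]
    rcases (hS x).2 hx with ⟨y, hy, rfl⟩ | ⟨y, hy, rfl⟩
    · rw [t1]; exact mem_oadd_left hy
    · rw [t2]; exact oadd_mem hy
  · rw [hgr x hx, hgr x' hx']
    rcases h with ⟨a, b, ha, hb, hab, rfl, rfl⟩ | ⟨a, b, ha, hb, rfl, rfl⟩ | ⟨a, b, ha, hb, hab, rfl, rfl⟩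
    · rw [t1, t1]; exact hab
    · rw [t1, t2]; exact mem_oadd_left ha
    · rw [t2, t2]; exact oadd_mem hab
  · rcases mem_oadd.1 hy with hy | ⟨ξ, hξ, rfl⟩
    · exact ⟨LO.inl y, (pr_mem_gr ht).2 ⟨(hS _).1 (Or.inl ⟨y, hy, rfl⟩), (t1 y).symm⟩⟩
    · exact ⟨LO.inr ξ, (pr_mem_gr ht).2 ⟨(hS _).1 (Or.inr ⟨ξ, hξ, rfl⟩), (t2 ξ).symm⟩⟩

namespace PD

/-- the leading argument, with respect to embeddings into arbitrary `N` -/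
def SLead (D : PD M) (σ n i : M) : Prop :=
  i ∊ n ∧ ∀ N f g, Hom n N f → Hom n N g → ap f i ∊ ap g i →
    D.lt N (D.mp n N f σ) (D.mp n N g σ)

/-- the comparison relation of `D` is definable -/
def Def (D : PD M) : Prop :=
  ∀ m n N σ τ, PR M (fun p : M × M => D.MapLt m n N p.1 p.2 σ τ)

namespace IsPredilator

variable {D : PD M} (hD : D.IsPredilator)
include hD

theorem nat_of_Tr {σ n : M} (h : D.Tr σ n) : n ∊ om := hD.car_dom _ _ h.1

theorem mp_cmp {m n N f t σ : M} (hf : Hom m n f) (ht : Hom n N t) (hσ : D.car m σ) :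
    D.mp m N (cmp m f t) σ = D.mp n N t (D.mp m n f σ) :=
  (hD.mp_comp hf ht (hf.cmp ht) hσ fun _ hi => (ap_cmp hi).symm).symm

theorem lt_cmp {m m' n N f f' t σ τ : M} (hf : Hom m n f) (hf' : Hom m' n f') (ht : Hom n N t)
    (hσ : D.car m σ) (hτ : D.car m' τ) :
    D.lt N (D.mp m N (cmp m f t) σ) (D.mp m' N (cmp m' f' t) τ) ↔
      D.lt n (D.mp m n f σ) (D.mp m' n f' τ) := by
  rw [hD.mp_cmp hf ht hσ, hD.mp_cmp hf' ht hτ, (hD.mp_lt ht (hD.mp_car hf hσ) (hD.mp_car hf' hτ)).1]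

theorem lead_of_sLead {σ n i : M} (hσ : D.Tr σ n) (h : D.SLead σ n i) : D.Lead σ n i := by
  refine ⟨h.1, fun N f g _ hf hg hfg => ?_⟩
  rw [hD.mapLt_iff hf hg hσ.1 hσ.1]
  exact h.2 N f g hf hg (hfg _ _ (hf.pr_mem.2 ⟨h.1, rfl⟩) (hg.pr_mem.2 ⟨h.1, rfl⟩))

/-- Suppose `i < j` both lead. The map that fixes the numbers below `j` and adds `n` to all others
lies below the successor map at `i` but above it at `j`. The two leading arguments would thus give
opposite comparisons. -/
theorem lead_unique_aux {σ n i j : M} (hσ : D.Tr σ n) (hi : D.Lead σ n i) (hj : D.Lead σ n j) :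
    ¬ i ∊ j := by
  intro hij
  have hn := hD.nat_of_Tr hσ
  have on := ord_nat hn
  let F : M → M := fun l => if l ∊ j then l else oadd n l
  have hF : PR M F := by fun_prop
  have F1 : ∀ l, l ∊ j → F l = l := fun l hl => by simp [F, hl]
  have F2 : ∀ l, ¬ l ∊ j → F l = oadd n l := fun l hl => by simp [F, hl]
  have hN := oadd_nat hn hn
  have hf : Hom n (oadd n n) (gr n F) := by
    refine hom_gr hF hn hN (fun l hl => ?_) fun l l' hl hl' h => ?_
    · by_cases hlj : l ∊ j
      · rw [F1 l hlj]; exact mem_oadd_left hl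
      · rw [F2 l hlj]; exact oadd_mem hl
    · by_cases hlj' : l' ∊ j
      · rw [F1 l ((on.mem hj.1).trans hlj' h), F1 l' hlj']; exact h
      · rw [F2 l' hlj']
        by_cases hlj : l ∊ j
        · rw [F1 l hlj]; exact mem_oadd_left hl
        · rw [F2 l hlj]; exact oadd_mem h
  have h0 : (emp : M) ∊ n := by
    rcases mem_om.1 hn with rfl | ⟨y, hy, rfl⟩
    · exact (notMem_emp hi.1).elim
    · exact emp_mem_suc hy
  have hsub : ∀ l, l ∊ suc n → l ∊ oadd n n := fun l hl => by
    rcases mem_suc.1 hl with h | rfl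
    · exact mem_oadd_left h
    · have := oadd_mem (α := l) h0
      rwa [oadd_emp] at this
  have hg : Hom n (oadd n n) (gr n suc) :=
    hom_gr (by fun_prop) hn hN (fun l hl => hsub _ (suc_mem_suc on hl)) fun l l' _ hl' h => by
      exact suc_mem_suc (on.mem hl') h
  have hsPR : PR M (suc : M → M) := by fun_prop
  have h1 := hi.2 _ _ _ (natSum_oadd hn hn) hf hg fun x y hx hy => by
    rw [pr_mem_gr hF] at hx
    rw [pr_mem_gr hsPR] at hy
    rw [hx.2, hy.2, F1 i hij]
    exact mem_suc_self i
  have h2 := hj.2 _ _ _ (natSum_oadd hn hn) hg hf fun x y hx hy => by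
    rw [pr_mem_gr hF] at hy
    rw [pr_mem_gr hsPR] at hx
    rw [hx.2, hy.2, F2 j (notMem_self j)]
    rcases mem_suc.1 (suc_mem_suc on hj.1) with h | h
    · exact mem_oadd_left h
    · rw [h]
      have := oadd_mem (α := n) hij
      by_cases hi0 : j = emp
      · rw [hi0] at hij; exact (notMem_emp hij).elim
      · have : (emp : M) ∊ j := by
          rcases mem_om.1 (trans_om _ _ hn hj.1) with h' | ⟨y, hy', rfl⟩
          · exact (hi0 h').elim
          · exact emp_mem_suc hy'
        have := oadd_mem (α := n) this
        rwa [oadd_emp] at this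
  rw [hD.mapLt_iff hf hg hσ.1 hσ.1] at h1
  rw [hD.mapLt_iff hg hf hσ.1 hσ.1] at h2
  exact (hD.linear _ hN).asymm (hD.mp_car hf hσ.1) (hD.mp_car hg hσ.1) h1 h2

theorem lead_unique {σ n i j : M} (hσ : D.Tr σ n) (hi : D.Lead σ n i) (hj : D.Lead σ n j) :
    i = j := by
  have on := ord_nat (hD.nat_of_Tr hσ)
  rcases (on.mem hi.1).trichotomy (on.mem hj.1) with h | h | h
  · exact (hD.lead_unique_aux hσ hi hj h).elim
  · exact h
  · exact (hD.lead_unique_aux hσ hj hi h).elim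

/-- Monotonicity gives a weak inequality. Equality is excluded because the support of the value
determines the morphism. -/
theorem lt_of_le {n N f g σ i : M} (hσ : D.Tr σ n) (hf : Hom n N f) (hg : Hom n N g)
    (h : ∀ l, l ∊ n → ap f l = ap g l ∨ ap f l ∊ ap g l) (hlt : ap f i ∊ ap g i) :
    D.lt N (D.mp n N f σ) (D.mp n N g σ) := by
  rcases hD.mp_mono hf hg hσ.1 h with h | h
  · obtain ⟨-, rfl, -⟩ := hD.mp_inj hf hg hσ hσ h
    exact (notMem_self _ hlt).elim
  · exact h

theorem lt_or_gt {n N f g σ i : M} (hσ : D.Tr σ n) (hf : Hom n N f) (hg : Hom n N g)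
    (hne : ap f i ≠ ap g i) :
    D.lt N (D.mp n N f σ) (D.mp n N g σ) ∨ D.lt N (D.mp n N g σ) (D.mp n N f σ) := by
  rcases (hD.linear N hf.cod).2.2 _ _ (hD.mp_car hf hσ.1) (hD.mp_car hg hσ.1) with h | h | h
  · exact Or.inl h
  · obtain ⟨-, rfl, -⟩ := hD.mp_inj hf hg hσ hσ h
    exact (hne rfl).elim
  · exact Or.inr h

end IsPredilator

/-- `f` and `g` are interleaved, with `g < f` precisely below `k` -/
structure Pat (n k f g : M) : Prop where
  gt : ∀ l, l ∊ n → l ∊ k → ap g l ∊ ap f l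
  lt : ∀ l, l ∊ n → ¬ l ∊ k → ap f l ∊ ap g l
  fg : ∀ l l', l ∊ n → l' ∊ n → l ∊ l' → ap f l ∊ ap g l'
  gf : ∀ l l', l ∊ n → l' ∊ n → l ∊ l' → ap g l ∊ ap f l'

namespace IsPredilator

variable {D : PD M} (hD : D.IsPredilator)
include hD

/-- A pattern determines the relative position of all values of `f` and `g`, so that the outcome of
the comparison depends on `k` only. -/
theorem lt_of_pat {n k N N' f g f' g' σ : M} (hσ : D.Tr σ n) (hf : Hom n N f) (hg : Hom n N g)
    (hf' : Hom n N' f') (hg' : Hom n N' g') (hp : Pat n k f g) (hp' : Pat n k f' g') :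
    D.lt N (D.mp n N g σ) (D.mp n N f σ) ↔ D.lt N' (D.mp n N' g' σ) (D.mp n N' f' σ) := by
  have on := ord_nat (hD.nat_of_Tr hσ)
  have key : ∀ {N f g : M}, Hom n N f → Hom n N g → Pat n k f g → ∀ i j, i ∊ n → j ∊ n →
      (ap g i ∊ ap f j ↔ i ∊ j ∨ i = j ∧ i ∊ k) ∧ ap g i ≠ ap f j := by
    intro N f g hf hg hp i j hi hj
    have oN := ord_nat hf.cod
    rcases (on.mem hi).trichotomy (on.mem hj) with h | rfl | h
    · have := hp.gf i j hi hj h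
      exact ⟨by simp [this, h], fun e => notMem_self _ (e ▸ this)⟩
    · by_cases hik : i ∊ k
      · have := hp.gt i hi hik
        exact ⟨by simp [this, hik], fun e => notMem_self _ (e ▸ this)⟩
      · have := hp.lt i hi hik
        have h' := (oN.mem (hg.ap_mem hi)).asymm this
        exact ⟨by simp [h', hik, notMem_self], fun e => notMem_self _ (e ▸ this)⟩
    · have := hp.fg j i hj hi h
      have h' := (oN.mem (hg.ap_mem hi)).asymm this
      have h1 : ¬ i ∊ j := (on.mem hi).asymm h
      have h2 : i ≠ j := fun e => notMem_self _ (e ▸ h)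
      exact ⟨by simp [h', h1, h2], fun e => notMem_self _ (e ▸ this)⟩
  refine hD.lt_pattern hσ.1 hσ.1 hg hf hg' hf' fun i j hi hj => ?_
  have h1 := key hf hg hp i j hi hj
  have h2 := key hf' hg' hp' i j hi hj
  rw [h1.1, h2.1]
  exact ⟨Iff.rfl, by simp [h1.2, h2.2]⟩

/-- a threshold index -/
theorem exists_threshold (hdef : D.Def) {σ n : M} (hσ : D.Tr σ n) (hn0 : n ≠ emp) :
    ∃ i, i ∊ n ∧
      (∀ N f g, Hom n N f → Hom n N g → Pat n i f g → ¬ D.lt N (D.mp n N g σ) (D.mp n N f σ)) ∧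
      ∀ N f g, Hom n N f → Hom n N g → Pat n (suc i) f g →
        D.lt N (D.mp n N g σ) (D.mp n N f σ) := by
  have hn := hD.nat_of_Tr hσ
  have on := ord_nat hn
  -- A standard pair with pattern `k`: both maps use the slots `3l` and `3l + 1`, and their roles
  -- are exchanged at `k`.
  let F : M → M → M := fun k l => if l ∊ k then suc (triple l) else triple l
  let G : M → M → M := fun k l => if l ∊ k then triple l else suc (triple l)
  have hF : PR M (fun p : M × M => F p.1 p.2) := by fun_prop
  have hG : PR M (fun p : M × M => G p.1 p.2) := by fun_prop
  have hFk : ∀ k, PR M (F k) := fun k => by fun_prop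
  have hGk : ∀ k, PR M (G k) := fun k => by fun_prop
  have hN := triple_nat hn
  have oN := ord_nat hN
  have h0 : ∀ k l l', l ∊ n → l' ∊ n → l ∊ l' → F k l ∊ F k l' ∧ G k l ∊ G k l' ∧ F k l ∊ G k l' ∧
      G k l ∊ F k l' := by
    intro k l l' hl hl' h
    obtain ⟨t1, t2, t3⟩ := triple_lt h
    by_cases h1 : l ∊ k <;> by_cases h2 : l' ∊ k <;> simp [F, G, h1, h2, t1, t2, mem_suc]
  have hm : ∀ k l, l ∊ n → F k l ∊ triple n ∧ G k l ∊ triple n := fun k l hl => by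
    obtain ⟨t1, t2, t3⟩ := triple_lt hl
    by_cases h1 : l ∊ k <;> simp [F, G, h1, t1, t2]
  have hf : ∀ k, Hom n (triple n) (gr n (F k)) := fun k =>
    hom_gr (hFk k) hn hN (fun l hl => (hm k l hl).1) fun l l' hl hl' h => (h0 k l l' hl hl' h).1
  have hg : ∀ k, Hom n (triple n) (gr n (G k)) := fun k =>
    hom_gr (hGk k) hn hN (fun l hl => (hm k l hl).2) fun l l' hl hl' h => (h0 k l l' hl hl' h).2.1
  have hp : ∀ k, Pat n k (gr n (F k)) (gr n (G k)) := fun k =>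
    { gt := fun l hl hlk => by
        rw [ap_gr (hFk k) hl, ap_gr (hGk k) hl]
        simpa [F, G, hlk] using mem_suc_self _
      lt := fun l hl hlk => by
        rw [ap_gr (hFk k) hl, ap_gr (hGk k) hl]
        simpa [F, G, hlk] using mem_suc_self _
      fg := fun l l' hl hl' h => by
        rw [ap_gr (hFk k) hl, ap_gr (hGk k) hl']
        exact (h0 k l l' hl hl' h).2.2.1
      gf := fun l l' hl hl' h => by
        rw [ap_gr (hFk k) hl', ap_gr (hGk k) hl]
        exact (h0 k l l' hl hl' h).2.2.2 }
  by_contra hc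
  push Not at hc
  -- Without a threshold, the failure of `D(g)(σ) < D(f)(σ)` would be passed on from pattern `0`,
  -- where `f` is pointwise below `g`, up to pattern `n`. There `g` is strictly below `f`
  -- everywhere, so the inequality holds.
  have key := nat_induct (P := fun k => k ∊ suc n →
    ¬ D.MapLt n n (triple n) (gr n (G k)) (gr n (F k)) σ σ) (by
      have := hdef n n (triple n) σ σ
      have h' : PR M (fun k => D.MapLt n n (triple n) (gr n (G k)) (gr n (F k)) σ σ) :=
        PR.comp (h := fun k => (gr n (G k), gr n (F k))) this (by fun_prop)
      fun_prop) ?_ ?_ n hn (mem_suc_self n)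
  · rw [hD.mapLt_iff (hg n) (hf n) hσ.1 hσ.1] at key
    have hl : ∀ l, l ∊ n → ap (gr n (G n)) l ∊ ap (gr n (F n)) l := fun l hl => (hp n).gt l hl hl
    have he : (emp : M) ∊ n := by
      rcases mem_om.1 hn with h | ⟨y, hy, rfl⟩
      · exact (hn0 h).elim
      · exact emp_mem_suc hy
    exact key (hD.lt_of_le hσ (hg n) (hf n) (fun l h => Or.inr (hl l h)) (hl _ he))
  · rintro - h
    rw [hD.mapLt_iff (hg _) (hf _) hσ.1 hσ.1] at h
    have hl : ∀ l, l ∊ n → ap (gr n (F emp)) l ∊ ap (gr n (G emp)) l :=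
      fun l hl => (hp emp).lt l hl notMem_emp
    rcases hD.mp_mono (hf emp) (hg emp) hσ.1 fun l h => Or.inr (hl l h) with h' | h'
    · exact (hD.linear _ hN).1 _ (hD.mp_car (hg emp) hσ.1) (by rwa [h'] at h)
    · exact (hD.linear _ hN).asymm (hD.mp_car (hg emp) hσ.1) (hD.mp_car (hf emp) hσ.1) h h'
  · intro k hk ih hkn h
    have hkn' : k ∊ n := by
      rcases mem_suc.1 hkn with h | h
      · exact on.trans h (mem_suc_self k)
      · rw [← h]; exact mem_suc_self k
    have ih := ih (mem_suc.2 (Or.inl hkn'))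
    rw [hD.mapLt_iff (hg k) (hf k) hσ.1 hσ.1] at ih
    rw [hD.mapLt_iff (hg _) (hf _) hσ.1 hσ.1] at h
    obtain ⟨N, f, g, hf', hg', hp', hn'⟩ := hc k hkn' fun N f g hf' hg' hp' => by
      rwa [← hD.lt_of_pat hσ (hf k) (hg k) hf' hg' (hp k) hp']
    rw [← hD.lt_of_pat hσ (hf _) (hg _) hf' hg' (hp _) hp'] at hn'
    exact hn' h

end IsPredilator

/-- The inequality is split by an intermediate map `H` in the tripled codomain. It lies above `f`
and `g` at arguments below `i`, below both at arguments above `i`, and strictly between them at `i`.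
The passage from `f` to `H` has pattern `i + 1` and the passage from `H` to `g` has pattern `i`, so
both go upwards by the choice of the threshold. -/
theorem lt_interleaved {D : PD M} (hD : D.IsPredilator) {σ n i : M} (hσ : D.Tr σ n) (hi : i ∊ n)
    (h1 : ∀ N f g, Hom n N f → Hom n N g → Pat n i f g →
      ¬ D.lt N (D.mp n N g σ) (D.mp n N f σ))
    (h2 : ∀ N f g, Hom n N f → Hom n N g → Pat n (suc i) f g →
      D.lt N (D.mp n N g σ) (D.mp n N f σ))
    {N f g : M} (hf : Hom n N f) (hg : Hom n N g)
    (hfg : ∀ l l', l ∊ n → l' ∊ n → l ∊ l' → ap f l ∊ ap g l' ∧ ap g l ∊ ap f l')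
    (hlt : ap f i ∊ ap g i) : D.lt N (D.mp n N f σ) (D.mp n N g σ) := by
  have hn := hD.nat_of_Tr hσ
  have on := ord_nat hn
  have hN := hf.cod
  have oN := ord_nat hN
  have ht : Hom N (triple N) (gr N fun x => suc (triple x)) :=
    hom_gr (by fun_prop) hN (triple_nat hN) (fun x hx => (triple_lt hx).2.1) fun x y hx hy h =>
      mem_suc.2 (Or.inl (triple_lt h).2.1)
  have hPt : PR M fun x : M => suc (triple x) := by fun_prop
  -- The reference point near which `H` is placed: the maximum of `f(l)` and `g(l)` for `l < i`,
  -- their minimum for `l > i`, and `f(i)` at the threshold. The given maps occupy the middle slots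
  -- `3x + 1`, while `H` takes the upper slot up to `i` and the lower slot afterwards.
  let c : M → M := fun l => if l ∊ i then (if ap f l ∊ ap g l then ap g l else ap f l) else
    if l = i then ap f i else if ap f l ∊ ap g l then ap f l else ap g l
  let H : M → M := fun l => if l ∊ suc i then suc (suc (triple (c l))) else triple (c l)
  have hHPR : PR M H := by fun_prop
  have hc : ∀ l, l ∊ n → c l = ap f l ∨ c l = ap g l := fun l hl => by
    simp only [c]; split_ifs with a b e <;> simp [*]
  have hcl : ∀ l l', l ∊ n → l' ∊ n → l ∊ l' → c l ∊ ap f l' ∧ c l ∊ ap g l' ∧ ap f l ∊ c l' ∧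
      ap g l ∊ c l' ∧ c l ∊ c l' := by
    intro l l' hl hl' h
    have a1 := hfg l l' hl hl' h
    have a2 := hf.ap_lt hl hl' h
    have a3 := hg.ap_lt hl hl' h
    rcases hc l hl with e | e <;> rcases hc l' hl' with e' | e' <;> simp only [e, e', a1, a2, a3, and_self]
  have hH : ∀ l, l ∊ n → H l = suc (suc (triple (c l))) ∨ H l = triple (c l) := fun l hl => by
    simp only [H]; split_ifs <;> simp
  have hcN : ∀ l, l ∊ n → c l ∊ N := fun l hl => by
    rcases hc l hl with e | e <;> rw [e]
    · exact hf.ap_mem hl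
    · exact hg.ap_mem hl
  have hHlt : ∀ l x, l ∊ n → c l ∊ x → H l ∊ triple x := fun l x hl h => by
    have := triple_lt h
    rcases hH l hl with e | e <;> rw [e]
    · exact this.2.2
    · exact this.1
  have hltH : ∀ l x, l ∊ n → x ∊ triple (c l) → x ∊ H l := fun l x hl h => by
    rcases hH l hl with e | e <;> rw [e]
    · simp [mem_suc, h]
    · exact h
  have hHH : Hom n (triple N) (gr n H) := hom_gr hHPR hn (triple_nat hN)
    (fun l hl => hHlt l N hl (hcN l hl)) fun l l' hl hl' h =>
      hltH l' _ hl' (hHlt l _ hl (hcl l l' hl hl' h).2.2.2.2)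
  have hap : ∀ {k : M}, Hom n N k → ∀ l, l ∊ n → ap (cmp n k (gr N fun x => suc (triple x))) l =
      suc (triple (ap k l)) := fun hk l hl => by
    rw [ap_cmp hl, ap_gr hPt (hk.ap_mem hl)]
  have hHf : ∀ k, (k = f ∨ k = g) → ∀ l l', l ∊ n → l' ∊ n → l ∊ l' →
      H l ∊ suc (triple (ap k l')) ∧ suc (triple (ap k l)) ∊ H l' := by
    rintro k hk l l' hl hl' h
    have := hcl l l' hl hl' h
    have h1 : c l ∊ ap k l' := by rcases hk with rfl | rfl; exacts [this.1, this.2.1]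
    have h2 : ap k l ∊ c l' := by rcases hk with rfl | rfl; exacts [this.2.2.1, this.2.2.2.1]
    exact ⟨mem_suc.2 (Or.inl (hHlt l _ hl h1)), hltH l' _ hl' (triple_lt h2).2.1⟩
  have hbelow : ∀ k, (k = f ∨ k = g) → ∀ l, l ∊ n → l ∊ i → suc (triple (ap k l)) ∊ H l := by
    intro k hk l hl hli
    have h' : l ∊ suc i := mem_suc.2 (Or.inl hli)
    have : ap k l = c l ∨ ap k l ∊ c l := by
      simp only [c, hli, if_true]
      split_ifs with h
      · rcases hk with rfl | rfl
        · exact Or.inr h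
        · exact Or.inl rfl
      · rcases hk with rfl | rfl
        · exact Or.inl rfl
        · rw [(oN.mem (hf.ap_mem hl)).not_mem_iff (oN.mem (hg.ap_mem hl))] at h
          exact h
    simp only [H, h', if_true]
    rcases this with h | h
    · rw [h]; exact mem_suc_self _
    · simp [mem_suc, (triple_lt h).2.1]
  have habove : ∀ k, (k = f ∨ k = g) → ∀ l, l ∊ n → ¬ l ∊ suc i → H l ∊ suc (triple (ap k l)) := by
    intro k hk l hl hli
    have h1 : ¬ l ∊ i := fun h => hli (mem_suc.2 (Or.inl h))
    have h2 : l ≠ i := fun h => hli (mem_suc.2 (Or.inr h))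
    have : c l = ap k l ∨ c l ∊ ap k l := by
      simp only [c, h1, h2, if_false]
      split_ifs with h
      · rcases hk with rfl | rfl
        · exact Or.inl rfl
        · exact Or.inr h
      · rcases hk with rfl | rfl
        · rw [(oN.mem (hf.ap_mem hl)).not_mem_iff (oN.mem (hg.ap_mem hl))] at h
          exact h
        · exact Or.inl rfl
    simp only [H, hli, if_false]
    rcases this with h | h
    · rw [h]; exact mem_suc_self _
    · simp [mem_suc, (triple_lt h).1]
  have hci : c i = ap f i := by simp [c, notMem_self]
  have hHi : H i = suc (suc (triple (ap f i))) := by simp [H, mem_suc_self, hci]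
  have P1 : Pat n i (gr n H) (cmp n g (gr N fun x => suc (triple x))) :=
    { gt := fun l hl h => by
        rw [ap_gr hHPR hl, hap hg l hl]; exact hbelow g (Or.inr rfl) l hl h
      lt := fun l hl h => by
        rw [ap_gr hHPR hl, hap hg l hl]
        by_cases e : l = i
        · rw [e, hHi]; exact mem_suc.2 (Or.inl (triple_lt hlt).2.2)
        · exact habove g (Or.inr rfl) l hl (by simp [mem_suc, h, e])
      fg := fun l l' hl hl' h => by
        rw [ap_gr hHPR hl, hap hg l' hl']; exact (hHf g (Or.inr rfl) l l' hl hl' h).1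
      gf := fun l l' hl hl' h => by
        rw [ap_gr hHPR hl', hap hg l hl]; exact (hHf g (Or.inr rfl) l l' hl hl' h).2 }
  have P2 : Pat n (suc i) (gr n H) (cmp n f (gr N fun x => suc (triple x))) :=
    { gt := fun l hl h => by
        rw [ap_gr hHPR hl, hap hf l hl]
        rcases mem_suc.1 h with h | rfl
        · exact hbelow f (Or.inl rfl) l hl h
        · rw [hHi]; exact mem_suc_self _
      lt := fun l hl h => by
        rw [ap_gr hHPR hl, hap hf l hl]; exact habove f (Or.inl rfl) l hl h
      fg := fun l l' hl hl' h => by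
        rw [ap_gr hHPR hl, hap hf l' hl']; exact (hHf f (Or.inl rfl) l l' hl hl' h).1
      gf := fun l l' hl hl' h => by
        rw [ap_gr hHPR hl', hap hf l hl]; exact (hHf f (Or.inl rfl) l l' hl hl' h).2 }
  rw [← hD.lt_cmp hf hg ht hσ.1 hσ.1]
  have e1 := h1 _ _ _ hHH (hg.cmp ht) P1
  have e2 := h2 _ _ _ hHH (hf.cmp ht) P2
  have e3 := hD.lt_or_gt (i := i) hσ hHH (hg.cmp ht) fun e => by
    have := P1.lt i hi (notMem_self i)
    rw [e] at this
    exact notMem_self _ this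
  exact (hD.linear _ (triple_nat hN)).2.1 _ _ _ (hD.mp_car (hf.cmp ht) hσ.1) (hD.mp_car hHH hσ.1)
    (hD.mp_car (hg.cmp ht) hσ.1) e2 (e3.resolve_right e1)

end PD

end PRS

/-! ### Existence and dominance of leading arguments -/

namespace PRS

variable {M : Type u} [PRSModel M]

theorem IsOrd.mem_of_notMem {a b c : M} (hb : IsOrd b) (hc : IsOrd c) (h : a ∊ b) (h' : ¬ c ∊ b) :
    a ∊ c := by
  rcases (hb.mem h).trichotomy hc with e | rfl | e
  · exact e
  · exact (h' h).elim
  · exact (h' (hb.trans h e)).elim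

theorem IsOrd.lt_of_le {a b c : M} (hc : IsOrd c) (h : a = b ∨ a ∊ b) (h' : b ∊ c) : a ∊ c := by
  rcases h with rfl | h
  · exact h'
  · exact hc.trans h' h

namespace PD

/-- a predilator whose trace elements have leading arguments that dominate all comparisons -/
structure Led (D : PD M) : Prop where
  pred : D.IsPredilator
  ex : ∀ σ n, D.Tr σ n → ∃ i, D.SLead σ n i
  lt : ∀ σ m i τ n j, D.Tr σ m → D.Tr τ n → D.SLead σ m i → D.SLead τ n j →
    ∀ N f g, Hom m N f → Hom n N g → ap f i ∊ ap g j → D.lt N (D.mp m N f σ) (D.mp n N g τ)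

/-- The threshold index leads. When `f(i) < g(i)` and there is enough room above `f(i)`, one can
transform `f` into a map that is pointwise below `g`: at each argument where `f` exceeds `g`, lower
`f` to `g` and compensate by raising `f(i)` by one. Each such step increases the value by
`lt_interleaved`, and monotonicity handles the last comparison. -/
theorem exists_sLead {D : PD M} (hD : D.IsPredilator) (hdef : D.Def) {σ n : M} (hσ : D.Tr σ n)
    (hn0 : n ≠ emp) : ∃ i, D.SLead σ n i := by
  obtain ⟨i, hi, h1, h2⟩ := hD.exists_threshold hdef hσ hn0
  refine ⟨i, hi, fun N₀ f₀ g₀ hf₀ hg₀ hlt₀ => ?_⟩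
  have hn := hD.nat_of_Tr hσ
  have on := ord_nat hn
  have hN₀ := hf₀.cod
  obtain ⟨x, hx⟩ : ∃ x, x = ap f₀ i := ⟨_, rfl⟩
  have hxN : x ∊ N₀ := hx ▸ hf₀.ap_mem hi
  have hxo : x ∊ om := trans_om _ _ hN₀ hxN
  -- Room for the `n` possible increments of `f(i)`, which starts at `x`. Everything that was above
  -- `x` is moved to `B` or beyond.
  obtain ⟨B, hB⟩ : ∃ B, B = suc (oadd x n) := ⟨_, rfl⟩
  have hBo : B ∊ om := hB ▸ suc_mem_om (oadd_nat hxo hn)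
  have oB := ord_nat hBo
  obtain ⟨N, hN⟩ : ∃ N, N = oadd B N₀ := ⟨_, rfl⟩
  have hNo : N ∊ om := hN ▸ oadd_nat hBo hN₀
  have oN := ord_nat hNo
  -- downward induction on the number of arguments at which `f` lies below `g`
  let P : M → Prop := fun k => BAll (Fin (times om om)) fun f => BAll (Fin (times om om)) fun g =>
    Hom n N f → Hom n N g → ap f i ∊ suc (oadd x k) → ¬ ap g i ∊ B →
    BAll n (fun l => i ∊ l → ¬ ap f l ∊ B) → BAll n (fun l => l ∊ k → ap f l = ap g l ∨ ap f l ∊ ap g l) →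
    D.MapLt n n N f g σ σ
  have hPR : PR M P := by
    have : PR M (fun p : (M × M) × M => D.MapLt n n N p.1.2 p.2 σ σ) :=
      PR.comp (h := fun p : (M × M) × M => (p.1.2, p.2)) (hdef n n N σ σ) (by fun_prop)
    fun_prop
  have hstep : ∀ k, k ∊ n → P (suc k) → P k := by
    intro k hk ih f hfF g hgF hf hg a1 a2 a3 a4
    have hkn : oadd x (suc k) ∊ B := by
      rw [hB, mem_suc]
      rcases mem_suc.1 (suc_mem_suc on hk) with h | h
      · exact Or.inl (oadd_mem h)
      · exact Or.inr (by rw [h])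
    have hfB : suc (ap f i) ∊ B := by
      refine oB.lt_of_le ?_ hkn
      rw [oadd_suc]
      have := suc_mem_suc (ord_nat (suc_mem_om (oadd_nat hxo (trans_om _ _ hn hk)))) a1
      exact (mem_suc.1 this).symm
    have hfB' : ap f i ∊ B := oB.trans hfB (mem_suc_self _)
    have ogi : IsOrd (ap g i) := oN.mem (hg.ap_mem hi)
    have hfg : suc (ap f i) ∊ ap g i := oB.mem_of_notMem ogi hfB a2
    have hfg' : ap f i ∊ ap g i := ogi.trans hfg (mem_suc_self _)
    have a1' : ap f i ∊ suc (oadd x (suc k)) := by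
      rw [oadd_suc]; exact mem_suc.2 (Or.inl a1)
    by_cases hgk : ap g k ∊ ap f k
    swap
    · have hle : ap f k = ap g k ∨ ap f k ∊ ap g k := by
        rcases (oN.mem (hg.ap_mem hk)).not_mem_iff (oN.mem (hf.ap_mem hk)) |>.1 hgk with h | h
        · exact Or.inl h
        · exact Or.inr h
      refine ih f hfF g hgF hf hg a1' a2 a3 fun l hl hlk => ?_
      rcases mem_suc.1 hlk with h | rfl
      · exact a4 l hl h
      · exact hle
    have hki : k ≠ i := by
      rintro rfl
      exact ogi.asymm hfg' hgk
    -- One transformation step. The map remains increasing: `g(k)` lies above the earlier values of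
    -- `f`, which are already bounded by `g`, and `f(i) + 1` stays below `B`, hence below the later
    -- values of `f`.
    let H : M → M := fun l => if l = k then ap g k else if l = i then suc (ap f i) else ap f l
    have hHPR : PR M H := by fun_prop
    have Hk : H k = ap g k := by simp [H]
    have Hi : H i = suc (ap f i) := by simp [H, hki.symm]
    have Hl : ∀ l, l ≠ k → l ≠ i → H l = ap f l := fun l e1 e2 => by simp [H, e1, e2]
    have hcase : ∀ l, l = k ∨ l = i ∨ (l ≠ k ∧ l ≠ i) := fun l => by tauto
    have hiB : ∀ l, l ∊ n → i ∊ l → suc (ap f i) ∊ ap f l := fun l hl h =>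
      oB.mem_of_notMem (oN.mem (hf.ap_mem hl)) hfB (a3 l hl h)
    have hHH : ∀ l l', l ∊ n → l' ∊ n → l ∊ l' → H l ∊ H l' ∧ ap f l ∊ H l' ∧ H l ∊ ap f l' := by
      intro l l' hl hl' h
      have hff := hf.ap_lt hl hl' h
      have of' := oN.mem (hf.ap_mem hl')
      have og' := oN.mem (hg.ap_mem hl')
      have c1 : l ≠ i → H l = ap f l ∨ H l ∊ ap f l := fun e => by
        by_cases e' : l = k
        · subst e'; rw [Hk]; exact Or.inr hgk
        · exact Or.inl (Hl l e' e)
      have c2 : H l ∊ ap f l' := by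
        by_cases e : l = i
        · subst e; rw [Hi]; exact hiB l' hl' h
        · exact of'.lt_of_le (c1 e) hff
      have c3 : l' = k → ap f l ∊ ap g l' := fun e => by
        subst e
        exact og'.lt_of_le (a4 l hl h) (hg.ap_lt hl hl' h)
      have c4 : ap f l ∊ H l' := by
        rcases hcase l' with rfl | rfl | ⟨e1, e2⟩
        · rw [Hk]; exact c3 rfl
        · rw [Hi]; exact mem_suc.2 (Or.inl hff)
        · rw [Hl _ e1 e2]; exact hff
      refine ⟨?_, c4, c2⟩
      rcases hcase l' with rfl | rfl | ⟨e1, e2⟩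
      · rw [Hk]
        by_cases e : l = i
        · subst e
          rw [Hi]
          have : ap g l ∊ ap g l' := hg.ap_lt hl hl' h
          exact og'.trans this hfg
        · exact og'.lt_of_le (c1 e) (c3 rfl)
      · rw [Hi]; exact mem_suc.2 (Or.inl c2)
      · rw [Hl _ e1 e2]; exact c2
    have hH : Hom n N (gr n H) := by
      refine hom_gr hHPR hn hNo (fun l hl => ?_) fun l l' hl hl' h => (hHH l l' hl hl' h).1
      rcases hcase l with rfl | rfl | ⟨e1, e2⟩
      · rw [Hk]; exact hg.ap_mem hl
      · rw [Hi]; exact oN.trans (hg.ap_mem hl) hfg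
      · rw [Hl _ e1 e2]; exact hf.ap_mem hl
    have l1 : D.lt N (D.mp n N f σ) (D.mp n N (gr n H) σ) := by
      refine lt_interleaved hD hσ hi h1 h2 hf hH (fun l l' hl hl' h => ?_) ?_
      · rw [ap_gr hHPR hl, ap_gr hHPR hl']
        exact (hHH l l' hl hl' h).2
      · rw [ap_gr hHPR hi, Hi]; exact mem_suc_self _
    have l2 := ih (gr n H) hH.mem_Fin g hgF hH hg (by
        rw [ap_gr hHPR hi, Hi, oadd_suc]
        exact suc_mem_suc (ord_nat (suc_mem_om (oadd_nat hxo (trans_om _ _ hn hk)))) a1) a2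
      (fun l hl hil => by
        rw [ap_gr hHPR hl]
        rcases hcase l with rfl | rfl | ⟨e1, e2⟩
        · rw [Hk]
          exact fun h => a2 (oB.trans h (hg.ap_lt hi hl hil))
        · exact (notMem_self _ hil).elim
        · rw [Hl _ e1 e2]; exact a3 l hl hil)
      (fun l hl hlk => by
        rw [ap_gr hHPR hl]
        rcases hcase l with rfl | rfl | ⟨e1, e2⟩
        · exact Or.inl Hk
        · rw [Hi]; exact Or.inr hfg
        · rw [Hl _ e1 e2]
          rcases mem_suc.1 hlk with h | h
          · exact a4 l hl h
          · exact (e1 h).elim)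
    rw [hD.mapLt_iff hH hg hσ.1 hσ.1] at l2
    rw [hD.mapLt_iff hf hg hσ.1 hσ.1]
    exact (hD.linear N hNo).2.1 _ _ _ (hD.mp_car hf hσ.1) (hD.mp_car hH hσ.1) (hD.mp_car hg hσ.1)
      l1 l2
  have hPn : P n := by
    intro f _ g _ hf hg a1 a2 a3 a4
    rw [hD.mapLt_iff hf hg hσ.1 hσ.1]
    refine hD.lt_of_le hσ hf hg (fun l hl => a4 l hl hl) (i := i) ?_
    exact oB.mem_of_notMem (oN.mem (hg.ap_mem hi)) (hB ▸ a1) a2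
  have hP0 : P emp := by
    by_contra hc
    refine nat_induct (P := fun k => k ∊ suc n → ¬ P k) (by fun_prop) (fun _ => hc)
      (fun k _ ih hkn h => ?_) n hn (mem_suc_self n) hPn
    have hk : k ∊ n := by
      rcases mem_suc.1 hkn with h | h
      · exact on.trans h (mem_suc_self k)
      · rw [← h]; exact mem_suc_self k
    exact ih (mem_suc.2 (Or.inl hk)) (hstep k hk h)
  -- stretch the given embeddings
  let t : M → M := fun y => if y ∊ suc x then y else oadd B y
  have htPR : PR M t := by fun_prop
  have t1 : ∀ y, y ∊ suc x → t y = y := fun y h => by simp [t, h]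
  have t2 : ∀ y, ¬ y ∊ suc x → t y = oadd B y := fun y h => by simp [t, h]
  have osx : IsOrd (suc x) := ord_nat (suc_mem_om hxo)
  have hsxB : ∀ y, y ∊ suc x → y ∊ B := fun y hy => by
    rw [hB, mem_suc]
    rcases mem_suc.1 hy with h | rfl
    · exact Or.inl (mem_oadd_left h)
    · left
      have : (emp : M) ∊ n := by
        rcases mem_om.1 hn with h | ⟨y, hy', rfl⟩
        · exact (hn0 h).elim
        · exact emp_mem_suc hy'
      have := oadd_mem (α := y) this
      rwa [oadd_emp] at this
  have ht : Hom N₀ N (gr N₀ t) := by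
    refine hom_gr htPR hN₀ hNo (fun y hy => ?_) fun y z hy hz h => ?_
    · by_cases h : y ∊ suc x
      · rw [t1 y h, hN]; exact mem_oadd_left (hsxB y h)
      · rw [t2 y h, hN]; exact oadd_mem hy
    · by_cases h' : z ∊ suc x
      · rw [t1 z h', t1 y (osx.trans h' h)]; exact h
      · rw [t2 z h']
        by_cases h'' : y ∊ suc x
        · rw [t1 y h'']; exact mem_oadd_left (hsxB y h'')
        · rw [t2 y h'']; exact oadd_mem h
  rw [← hD.lt_cmp hf₀ hg₀ ht hσ.1 hσ.1, ← hD.mapLt_iff (hf₀.cmp ht) (hg₀.cmp ht) hσ.1 hσ.1]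
  have hgt : ∀ y, y ∊ N₀ → x ∊ y → ¬ t y ∊ B := fun y hy h => by
    have : ¬ y ∊ suc x := fun h' => by
      rcases mem_suc.1 h' with e | rfl
      · exact (ord_nat hxo).asymm e h
      · exact notMem_self _ h
    rw [t2 y this]
    exact oadd_notMem _ _
  refine hP0 _ (hf₀.cmp ht).mem_Fin _ (hg₀.cmp ht).mem_Fin (hf₀.cmp ht) (hg₀.cmp ht) ?_ ?_
    (fun l hl hil => ?_) (fun l hl h => (notMem_emp h).elim)
  · rw [ap_cmp hi, ap_gr htPR (hf₀.ap_mem hi), ← hx, t1 x (mem_suc_self x), oadd_emp]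
    exact mem_suc_self x
  · rw [ap_cmp hi, ap_gr htPR (hg₀.ap_mem hi)]
    exact hgt _ (hg₀.ap_mem hi) (hx ▸ hlt₀)
  · rw [ap_cmp hl, ap_gr htPR (hf₀.ap_mem hl)]
    exact hgt _ (hf₀.ap_mem hl) (hx ▸ hf₀.ap_lt hi hl hil)

/-- A trace element without arguments has one and the same image under all embeddings. Its
comparison with another trace element is then independent of embeddings, which contradicts
connectedness. Another element exists because `D` is not `1`. -/
theorem Tr_ne_emp {D : PD M} (hD : D.IsPredilator) (hconn : D.IsConnected) (hone : ¬ D.IsOne)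
    {σ n : M} (hσ : D.Tr σ n) : n ≠ emp := by
  rintro rfl
  unfold IsOne at hone
  push Not at hone
  obtain ⟨n, hn, hne⟩ := hone
  have hhom : ∀ n, n ∊ (om : M) → Hom emp n (gr emp fun x => x) := fun n hn =>
    hom_gr (by fun_prop) emp_mem_om hn (fun i hi => (notMem_emp hi).elim)
      fun i _ hi => (notMem_emp hi).elim
  have : ∃ τ', D.car n τ' ∧ τ' ≠ D.mp emp n (gr emp fun x => x) σ := by
    by_contra hc
    push Not at hc
    exact hne ⟨_, hD.mp_car (hhom n hn) hσ.1, hc⟩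
  obtain ⟨τ', hτ', hne'⟩ := this
  obtain ⟨m, f, τ, hf, hτ, rfl⟩ := hD.normalForm hn hτ'
  have hm := hf.dom
  have hcar := hD.mp_car (hhom m hm) hσ.1
  have hcomp : ∀ {N g z}, Hom m N g → Hom emp N z →
      D.mp m N g (D.mp emp m (gr emp fun x => x) σ) = D.mp emp N z σ := fun hg hz =>
    hD.mp_comp (hhom m hm) hg hz hσ.1 fun i hi => (notMem_emp hi).elim
  rcases (hD.linear m hm).2.2 _ _ hcar hτ.1 with h | h | h
  · refine (hconn.2 σ emp τ m hσ hτ).1 fun N z g _ hz hg => ?_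
    rw [hD.mapLt_iff hz hg hσ.1 hτ.1, ← hcomp hg hz, (hD.mp_lt hg hcar hτ.1).1]
    exact h
  · exact hne' (by rw [← h]; exact hcomp hf (hhom n hn))
  · refine (hconn.2 σ emp τ m hσ hτ).2 fun N g z _ hg hz => ?_
    rw [hD.mapLt_iff hg hz hτ.1 hσ.1, ← hcomp hg hz, (hD.mp_lt hg hτ.1 hcar).1]
    exact h

/-- Since `τ ≪ σ` fails, some morphisms `g`, `f` into a common `N₂` satisfy `D(f)(σ) ≤ D(g)(τ)`. If
`f₁(i) < g₁(j)`, a copy of `N₂` is inserted directly above `f₁(i)` and thus below `g₁(j)`. The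
leading arguments then give `D(f₁)(σ) < D(f)(σ) ≤ D(g)(τ) < D(g₁)(τ)` in the enlarged order. -/
theorem led_of_connected {D : PD M} (hD : D.IsPredilator) (hdef : D.Def) (hconn : D.IsConnected)
    (hone : ¬ D.IsOne) : D.Led := by
  refine ⟨hD, fun σ n hσ => exists_sLead hD hdef hσ (Tr_ne_emp hD hconn hone hσ), ?_⟩
  intro σ m i τ n j hσ hτ hi hj N₁ f₁ g₁ hf₁ hg₁ hlt
  have hc := (hconn.2 τ n σ m hτ hσ).1
  unfold Below at hc
  push Not at hc
  obtain ⟨N₂, g, f, -, hg, hf, hngf⟩ := hc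
  rw [hD.mapLt_iff hg hf hτ.1 hσ.1] at hngf
  obtain ⟨x, hx⟩ : ∃ x, x = ap f₁ i := ⟨_, rfl⟩
  have hN₁ := hf₁.cod
  have hN₂ := hf.cod
  have hxN : x ∊ N₁ := hx ▸ hf₁.ap_mem hi.1
  have hxo : x ∊ om := trans_om _ _ hN₁ hxN
  have hsx := suc_mem_om hxo
  have osx := ord_nat hsx
  obtain ⟨B, hB⟩ : ∃ B, B = oadd (suc x) N₂ := ⟨_, rfl⟩
  have hBo : B ∊ om := hB ▸ oadd_nat hsx hN₂
  obtain ⟨N, hN⟩ : ∃ N, N = oadd B N₁ := ⟨_, rfl⟩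
  have hNo : N ∊ om := hN ▸ oadd_nat hBo hN₁
  have oN := ord_nat hNo
  let t : M → M := fun y => if y ∊ suc x then y else oadd B y
  have htPR : PR M t := by fun_prop
  have t1 : ∀ y, y ∊ suc x → t y = y := fun y h => by simp [t, h]
  have t2 : ∀ y, ¬ y ∊ suc x → t y = oadd B y := fun y h => by simp [t, h]
  have ht : Hom N₁ N (gr N₁ t) := by
    refine hom_gr htPR hN₁ hNo (fun y hy => ?_) fun y z hy hz h => ?_
    · by_cases h : y ∊ suc x
      · rw [t1 y h, hN, hB]; exact mem_oadd_left (mem_oadd_left h)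
      · rw [t2 y h, hN]; exact oadd_mem hy
    · by_cases h' : z ∊ suc x
      · rw [t1 z h', t1 y (osx.trans h' h)]; exact h
      · rw [t2 z h']
        by_cases h'' : y ∊ suc x
        · rw [t1 y h'', hB]; exact mem_oadd_left (mem_oadd_left h'')
        · rw [t2 y h'']; exact oadd_mem h
  have hsPR : PR M (oadd (suc x)) := by fun_prop
  have hs : Hom N₂ N (gr N₂ (oadd (suc x))) :=
    hom_gr hsPR hN₂ hNo (fun y hy => by rw [hN, hB]; exact mem_oadd_left (oadd_mem hy))
      fun y z _ _ h => oadd_mem h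
  rw [← hD.lt_cmp hg hf hs hτ.1 hσ.1] at hngf
  rw [← hD.lt_cmp hf₁ hg₁ ht hσ.1 hτ.1]
  have l1 := hi.2 N _ _ (hf₁.cmp ht) (hf.cmp hs) (by
    rw [ap_cmp hi.1, ap_cmp hi.1, ap_gr htPR (hf₁.ap_mem hi.1), ap_gr hsPR (hf.ap_mem hi.1), ← hx,
      t1 x (mem_suc_self x)]
    exact mem_oadd_left (mem_suc_self x))
  have l2 := hj.2 N _ _ (hg.cmp hs) (hg₁.cmp ht) (by
    rw [ap_cmp hj.1, ap_cmp hj.1, ap_gr htPR (hg₁.ap_mem hj.1), ap_gr hsPR (hg.ap_mem hj.1),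
      t2 _ (fun h => by
        rw [hx] at h
        rcases mem_suc.1 h with h | h
        · exact ((ord_nat hN₁).mem (hf₁.ap_mem hi.1)).asymm h hlt
        · exact notMem_self _ (h ▸ hlt))]
    rw [hB]
    exact mem_oadd_left (oadd_mem (hg.ap_mem hj.1)))
  have c1 := hD.mp_car (hf₁.cmp ht) hσ.1
  have c2 := hD.mp_car (hf.cmp hs) hσ.1
  have c3 := hD.mp_car (hg.cmp hs) hτ.1
  have c4 := hD.mp_car (hg₁.cmp ht) hτ.1
  have lin := hD.linear N hNo
  rcases lin.2.2 _ _ c3 c2 with h | h | h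
  · exact (hngf h).elim
  · rw [h] at l2
    exact lin.2.1 _ _ _ c1 c2 c4 l1 l2
  · exact lin.2.1 _ _ _ c1 c2 c4 l1 (lin.2.1 _ _ _ c2 c3 c4 h l2)

end PD

end PRS

/-! ### Separation of variables: shifts, restrictions and leading arguments -/

namespace PRS

variable {M : Type u} [PRSModel M]

namespace LO

@[fun_prop] theorem PR_inl {A : Type*} [Enc M A] {f : A → M} (hf : PR M f) :
    PR M (fun a => inl (f a)) := by unfold inl; fun_prop

@[fun_prop] theorem PR_inr {A : Type*} [Enc M A] {f : A → M} (hf : PR M f) :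
    PR M (fun a => inr (f a)) := by unfold inr; fun_prop

theorem one_ne : (suc emp : M) ≠ emp := fun h => notMem_emp (h ▸ mem_suc_self (emp : M))

@[simp] theorem inl_inj {x y : M} : inl x = inl y ↔ x = y := by simp [inl, pr_inj]
@[simp] theorem inr_inj {x y : M} : inr x = inr y ↔ x = y := by simp [inr, pr_inj]
@[simp] theorem inl_ne_inr {x y : M} : inl x ≠ inr y := fun h => one_ne (pr_inj.1 h).1.symm
@[simp] theorem inr_ne_inl {x y : M} : inr x ≠ inl y := fun h => one_ne (pr_inj.1 h).1
@[simp] theorem fst_inl (x : M) : fst (inl x) = emp := fst_pr _ _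
@[simp] theorem snd_inl (x : M) : snd (inl x) = x := snd_pr _ _
@[simp] theorem fst_inr (x : M) : fst (inr x) = suc emp := fst_pr _ _
@[simp] theorem snd_inr (x : M) : snd (inr x) = x := snd_pr _ _

variable {X Y : LO M} {x x' y y' : M}

@[simp] theorem add_inl : (X.add Y).car (inl x) ↔ X.car x := by simp [add]
@[simp] theorem add_inr : (X.add Y).car (inr x) ↔ Y.car x := by simp [add]
@[simp] theorem add_inl_inl : (X.add Y).lt (inl x) (inl x') ↔ X.car x ∧ X.car x' ∧ X.lt x x' := by
  simp only [add, inl_inj, inl_ne_inr, and_false, or_false, exists_false]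
  constructor
  · rintro ⟨a, b, h1, h2, h3, rfl, rfl⟩; exact ⟨h1, h2, h3⟩
  · rintro ⟨h1, h2, h3⟩; exact ⟨_, _, h1, h2, h3, rfl, rfl⟩
@[simp] theorem add_inl_inr : (X.add Y).lt (inl x) (inr y) ↔ X.car x ∧ Y.car y := by
  simp only [add, inl_inj, inr_inj, inl_ne_inr, inr_ne_inl, and_false, false_and, or_false, false_or,
    exists_false]
  constructor
  · rintro ⟨a, b, h1, h2, rfl, rfl⟩; exact ⟨h1, h2⟩
  · rintro ⟨h1, h2⟩; exact ⟨_, _, h1, h2, rfl, rfl⟩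
@[simp] theorem add_inr_inl : ¬ (X.add Y).lt (inr y) (inl x) := by
  simp [add]
@[simp] theorem add_inr_inr : (X.add Y).lt (inr y) (inr y') ↔ Y.car y ∧ Y.car y' ∧ Y.lt y y' := by
  simp only [add, inr_inj, inr_ne_inl, and_false, false_and, false_or, exists_false]
  constructor
  · rintro ⟨a, b, h1, h2, h3, rfl, rfl⟩; exact ⟨h1, h2, h3⟩
  · rintro ⟨h1, h2, h3⟩; exact ⟨_, _, h1, h2, h3, rfl, rfl⟩

theorem add_good (hX : X.Good) (hY : Y.Good) : (X.add Y).Good := by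
  obtain ⟨A, hA⟩ := hX.set
  obtain ⟨B, hB⟩ := hY.set
  refine ⟨⟨union (img A inl) (img B inr), fun x => ?_⟩, ?_, ?_, ?_, ?_⟩
  · rw [mem_union, mem_img (by fun_prop), mem_img (by fun_prop)]
    simp only [← hA, ← hB]
    rfl
  · have h1 := hX.PR_lt (A := ((M × M) × M) × M) (f := fun p => p.1.2) (g := fun p => p.2)
      (by fun_prop) (by fun_prop)
    have h2 := hY.PR_lt (A := ((M × M) × M) × M) (f := fun p => p.1.2) (g := fun p => p.2)
      (by fun_prop) (by fun_prop)
    refine PR.congr (Q := fun p : M × M =>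
      BEx A (fun x => BEx A fun x' => X.lt x x' ∧ p.1 = inl x ∧ p.2 = inl x') ∨
      BEx A (fun x => BEx B fun y => p.1 = inl x ∧ p.2 = inr y) ∨
      BEx B (fun y => BEx B fun y' => Y.lt y y' ∧ p.1 = inr y ∧ p.2 = inr y')) (by fun_prop) ?_
    intro p
    simp only [add, BEx, hA, hB]
    grind
  · rintro x (⟨y, hy, rfl⟩ | ⟨y, hy, rfl⟩)
    · simp [hX.lin.1 y hy]
    · simp [hY.lin.1 y hy]
  · rintro x y z (⟨x, hx, rfl⟩ | ⟨x, hx, rfl⟩) (⟨y, hy, rfl⟩ | ⟨y, hy, rfl⟩)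
      (⟨z, hz, rfl⟩ | ⟨z, hz, rfl⟩) <;> simp [hx, hy, hz]
    · exact hX.lin.2.1 _ _ _ hx hy hz
    · exact hY.lin.2.1 _ _ _ hx hy hz
  · rintro x y (⟨x, hx, rfl⟩ | ⟨x, hx, rfl⟩) (⟨y, hy, rfl⟩ | ⟨y, hy, rfl⟩) <;> simp [hx, hy]
    · exact hX.lin.2.2 _ _ hx hy
    · exact hY.lin.2.2 _ _ hx hy

end LO

open LO

theorem base_good {γ n : M} (hγ : IsOrd γ) (hn : IsOrd n) : (PD.base γ n).Good :=
  add_good (ofOrd_good hγ) (ofOrd_good hn)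

/-- the map `γ + f` -/
def sh (f z : M) : M := if fst z = emp then z else inr (ap f (snd z))

@[fun_prop] theorem PR.sh {A : Type*} [Enc M A] {f g : A → M} (hf : PR M f) (hg : PR M g) :
    PR M (fun a => sh (f a) (g a)) := by unfold PRS.sh; fun_prop

@[simp] theorem sh_inl (f x : M) : sh f (inl x) = inl x := by simp [sh]
@[simp] theorem sh_inr (f x : M) : sh f (inr x) = inr (ap f x) := by simp [sh, one_ne]

theorem sh_car {γ m n f x : M} (hf : Hom m n f) (hx : (PD.base γ m).car x) :
    (PD.base γ n).car (sh f x) := by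
  rcases hx with ⟨y, hy, rfl⟩ | ⟨y, hy, rfl⟩
  · rw [sh_inl]; exact add_inl.2 hy
  · rw [sh_inr]; exact add_inr.2 (hf.ap_mem hy)

theorem sh_lt {γ m n f x y : M} (hf : Hom m n f) (hx : (PD.base γ m).car x)
    (hy : (PD.base γ m).car y) (h : (PD.base γ m).lt x y) :
    (PD.base γ n).lt (sh f x) (sh f y) := by
  unfold PD.base at *
  rcases hx with ⟨x, hx, rfl⟩ | ⟨x, hx, rfl⟩ <;> rcases hy with ⟨y, hy, rfl⟩ | ⟨y, hy, rfl⟩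
  · simpa using h
  · simp only [sh_inl, sh_inr, add_inl_inr] at *
    exact ⟨hx, hf.ap_mem hy⟩
  · simp at h
  · simp only [sh_inr, add_inr_inr] at *
    exact ⟨hf.ap_mem hx, hf.ap_mem hy, hf.ap_lt hx hy h.2.2⟩

namespace PD

section Shift

variable {D : PD M} {γ : M}

theorem img_sh {m n f a b k e : M} (hf : Hom m n f) (ha : (base γ m).Enum a k e) :
    (b = img a (sh f)) ↔ ∀ y, y ∊ b ↔ (y ∊ a ∧ ∃ x, x ∊ γ ∧ y = LO.inl x) ∨
        ∃ i j, LO.inr i ∊ a ∧ pr i j ∊ f ∧ y = LO.inr j := by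
  have key : ∀ y, y ∊ img a (sh f) ↔ (y ∊ a ∧ ∃ x, x ∊ γ ∧ y = LO.inl x) ∨
        ∃ i j, LO.inr i ∊ a ∧ pr i j ∊ f ∧ y = LO.inr j := fun y => by
    rw [mem_img (by fun_prop)]
    constructor
    · rintro ⟨v, hv, rfl⟩
      rcases ha.sub hv with ⟨x, hx, rfl⟩ | ⟨x, hx, rfl⟩
      · rw [sh_inl]; exact Or.inl ⟨hv, x, hx, rfl⟩
      · rw [sh_inr]; exact Or.inr ⟨x, _, hv, hf.pr_mem.2 ⟨hx, rfl⟩, rfl⟩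
    · rintro (⟨hy, x, hx, rfl⟩ | ⟨i, j, hi, hij, rfl⟩)
      · exact ⟨_, hy, (sh_inl _ _).symm⟩
      · exact ⟨_, hi, by rw [sh_inr, (hf.pr_mem.1 hij).2]⟩
  constructor
  · rintro rfl; exact key
  · exact fun h => PRS.ext fun y => by rw [h, key]

theorem shift_map {m n f σ a w : M} (hf : Hom m n f) (h : (D.ext (base γ m)).car (pr σ a)) :
    (D.shift γ).map m n f (pr σ a) w ↔ w = pr σ (img a (sh f)) := by
  obtain ⟨k, e, ha, hσ⟩ := IsPredilator.ext_car.1 h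
  constructor
  · rintro ⟨_, _, σ', a', b, hz, rfl, hb⟩
    obtain ⟨rfl, rfl⟩ := pr_inj.1 hz
    rw [(img_sh hf ha).2 hb]
  · rintro rfl
    exact ⟨hf, h, σ, a, _, rfl, rfl, (img_sh hf ha).1 rfl⟩

theorem shift_map_dest {m n f z w : M} (h : (D.shift γ).map m n f z w) :
    ∃ σ a, z = pr σ a ∧ Hom m n f ∧ (D.ext (base γ m)).car (pr σ a) ∧ w = pr σ (img a (sh f)) := by
  obtain ⟨hf, hz, σ, a, b, rfl, rfl, -⟩ := id h
  exact ⟨σ, a, rfl, hf, hz, (shift_map hf hz).1 h⟩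

theorem sh_ext_car {m n f σ a : M} (hf : Hom m n f) (h : (D.ext (base γ m)).car (pr σ a)) :
    (D.ext (base γ n)).car (pr σ (img a (sh f))) :=
  IsPredilator.ext_image_car (by fun_prop) (fun _ => sh_car hf) (fun _ _ => sh_lt hf) h

theorem IsPredilator.shift (hD : D.IsPredilator) (hγ : IsOrd γ) : (D.shift γ).IsPredilator := by
  have good : ∀ {n : M}, n ∊ om → (base γ n).Good := fun hn => base_good hγ (ord_nat hn)
  refine
  { car_dom := fun n σ h => h.1
    lt_dom := fun n σ τ h => ⟨⟨h.1, h.2.1⟩, ⟨h.1, h.2.2.1⟩⟩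
    map_dom := fun m n f z w h => ?_
    supp_dom := fun n z c h => ?_
    linear := fun n hn => ?_
    map_total := fun m n f z hf hz => ?_
    map_lt := fun m n f z z' w w' h h' hlt => ?_
    map_id := fun n f z hf hid hz => ?_
    map_comp := fun l m n f g h z w v hh hfg Hf Hg => ?_
    monotone := fun m n f g z w w' hfg Hf Hg => ?_
    supp_total := fun n z hz => ?_
    supp_nat := fun m n f z w a b Hf ha hb j => ?_
    supp_range := fun m n f w b hf hb hj => ?_ }
  · obtain ⟨σ, a, rfl, hf, hz, rfl⟩ := shift_map_dest h
    exact ⟨hf, ⟨hf.dom, hz⟩, ⟨hf.cod, sh_ext_car hf hz⟩⟩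
  · obtain ⟨hn, hz, σ, a, rfl, hc⟩ := h
    exact ⟨⟨hn, hz⟩, fun i hi => ((hc i).1 hi).1⟩
  · have := hD.ext_linear (good hn)
    exact ⟨fun x hx h => this.1 x hx.2 h.2.2.2,
      fun x y z hx hy hz h h' => ⟨hn, hx.2, hz.2, this.2.1 x y z hx.2 hy.2 hz.2 h.2.2.2 h'.2.2.2⟩,
      fun x y hx hy => (this.2.2 x y hx.2 hy.2).imp (fun h => ⟨hn, hx.2, hy.2, h⟩)
        (Or.imp id fun h => ⟨hn, hy.2, hx.2, h⟩)⟩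
  · obtain ⟨σ, a, rfl⟩ := ext_car_dest hz.2
    simp only [shift_map hf hz.2]
    exact ⟨_, rfl, fun _ h => h⟩
  · obtain ⟨σ, a, rfl, hf, hz, rfl⟩ := shift_map_dest h
    obtain ⟨τ, b, rfl, -, hz', rfl⟩ := shift_map_dest h'
    refine ⟨hf.cod, sh_ext_car hf hz, sh_ext_car hf hz', ?_⟩
    exact (hD.ext_image (good hf.dom) (good hf.cod) (by fun_prop) (fun _ => sh_car hf)
      (fun _ _ => sh_lt hf) hz hz').2 hlt.2.2.2
  · obtain ⟨σ, a, rfl⟩ := ext_car_dest hz.2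
    rw [shift_map hf hz.2, pr_inj]
    refine ⟨rfl, ?_⟩
    obtain ⟨k, e, ha, -⟩ := ext_car.1 hz.2
    have : ∀ x, x ∊ a → sh f x = x := fun x hx => by
      rcases ha.sub hx with ⟨y, hy, rfl⟩ | ⟨y, hy, rfl⟩
      · rw [sh_inl]
      · rw [sh_inr, ← (hf.pr_mem.1 (hid y hy)).2]
    refine PRS.ext fun x => ?_
    rw [mem_img (by fun_prop)]
    exact ⟨fun hx => ⟨x, hx, (this x hx).symm⟩, by rintro ⟨v, hv, rfl⟩; rwa [this v hv]⟩
  · obtain ⟨σ, a, rfl, hf, hz, rfl⟩ := shift_map_dest Hf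
    obtain ⟨σ', a', he, hg, hz', rfl⟩ := shift_map_dest Hg
    obtain ⟨rfl, rfl⟩ := pr_inj.1 he
    rw [shift_map hh hz, pr_inj]
    refine ⟨rfl, ?_⟩
    obtain ⟨k, e, ha, -⟩ := ext_car.1 hz
    have : ∀ x, x ∊ a → sh g (sh f x) = sh h x := fun x hx => by
      rcases ha.sub hx with ⟨y, hy, rfl⟩ | ⟨y, hy, rfl⟩
      · simp
      · have h1 := hfg y _ _ (hf.pr_mem.2 ⟨hy, rfl⟩) (hg.pr_mem.2 ⟨hf.ap_mem hy, rfl⟩)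
        rw [sh_inr, sh_inr, sh_inr, (hh.pr_mem.1 h1).2]
    refine PRS.ext fun x => ?_
    rw [mem_img (by fun_prop), mem_img (by fun_prop)]
    constructor
    · rintro ⟨v, hv, rfl⟩
      obtain ⟨y, hy, rfl⟩ := (mem_img (by fun_prop)).1 hv
      exact ⟨y, hy, this y hy⟩
    · rintro ⟨y, hy, rfl⟩
      exact ⟨_, (mem_img (by fun_prop)).2 ⟨y, hy, rfl⟩, (this y hy).symm⟩
  · obtain ⟨σ, a, rfl, hf, hz, rfl⟩ := shift_map_dest Hf
    obtain ⟨σ', a', he, hg, hz', rfl⟩ := shift_map_dest Hg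
    obtain ⟨rfl, rfl⟩ := pr_inj.1 he
    obtain ⟨k, e, ha, hσ⟩ := ext_car.1 hz
    have hfa := ha.image (Y := base γ n) (t := sh f) (by fun_prop) (fun x hx => sh_car hf (ha.sub hx))
      fun x y hx hy => sh_lt hf (ha.sub hx) (ha.sub hy)
    have hga := ha.image (Y := base γ n) (t := sh g) (by fun_prop) (fun x hx => sh_car hg (ha.sub hx))
      fun x y hx hy => sh_lt hg (ha.sub hx) (ha.sub hy)
    rcases hD.ext_mono (good hf.cod) hσ hfa hga (fun i hi => by
      have p1 : PR M fun i => sh f (ap e i) := by fun_prop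
      have p2 : PR M fun i => sh g (ap e i) := by fun_prop
      rw [ap_gr p1 hi, ap_gr p2 hi]
      rcases ha.car hi with ⟨y, hy, h⟩ | ⟨y, hy, h⟩
      · rw [h, sh_inl, sh_inl]; exact Or.inl rfl
      · rw [h, sh_inr, sh_inr]
        unfold base
        rw [add_inr_inr, inr_inj]
        rcases hfg y _ _ (hf.pr_mem.2 ⟨hy, rfl⟩) (hg.pr_mem.2 ⟨hy, rfl⟩) with h | h
        · exact Or.inl h
        · exact Or.inr ⟨hf.ap_mem hy, hg.ap_mem hy, h⟩) with h | h
    · exact Or.inl h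
    · exact Or.inr ⟨hf.cod, sh_ext_car hf hz, sh_ext_car hg hz, h⟩
  · obtain ⟨σ, a, rfl⟩ := ext_car_dest hz.2
    refine ⟨sep n fun i => inr i ∊ a, ⟨hz.1, hz.2, σ, a, rfl, fun i => mem_sep (by fun_prop)⟩, ?_⟩
    rintro c ⟨-, -, σ', a', h, hc⟩
    obtain ⟨rfl, rfl⟩ := pr_inj.1 h
    exact PRS.ext fun i => by rw [hc, mem_sep (by fun_prop)]
  · obtain ⟨σ, s, rfl, hf, hz, rfl⟩ := shift_map_dest Hf
    obtain ⟨-, -, σ', s', h, ha⟩ := ha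
    obtain ⟨rfl, rfl⟩ := pr_inj.1 h
    obtain ⟨-, -, σ', s', h, hb⟩ := hb
    obtain ⟨rfl, rfl⟩ := pr_inj.1 h
    rw [hb, mem_img (by fun_prop)]
    obtain ⟨k, e, hs, -⟩ := ext_car.1 hz
    constructor
    · rintro ⟨hj, v, hv, h⟩
      rcases hs.sub hv with ⟨y, hy, rfl⟩ | ⟨y, hy, rfl⟩
      · simp at h
      · rw [sh_inr, inr_inj] at h
        exact ⟨y, (ha y).2 ⟨hy, hv⟩, hf.pr_mem.2 ⟨hy, h⟩⟩
    · rintro ⟨i, hi, hij⟩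
      have := hf.pr_mem.1 hij
      rw [this.2]
      exact ⟨hf.ap_mem this.1, _, ((ha i).1 hi).2, (sh_inr _ _).symm⟩
  · obtain ⟨hn, hz, τ, s, rfl, hs⟩ := hb
    obtain ⟨k, e, hE, hτ⟩ := ext_car.1 hz
    -- The partial inverse of `γ + f`. It is increasing on the support `s`, because the right part
    -- of `s` lies in the range of `f`.
    let t : M → M := fun z => if fst z = emp then z else inr (idx f m (snd z))
    have ht : PR M t := by fun_prop
    have t1 : ∀ x, t (inl x) = inl x := fun x => by simp [t]
    have t2 : ∀ i, i ∊ m → t (inr (ap f i)) = inr i := fun i hi => by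
      simp [t, one_ne, hf.idx_ap hi]
    have hcase : ∀ x, x ∊ s → (∃ y, y ∊ γ ∧ x = inl y) ∨ ∃ i, i ∊ m ∧ x = inr (ap f i) := by
      intro x hx
      rcases hE.sub hx with ⟨y, hy, rfl⟩ | ⟨y, hy, rfl⟩
      · exact Or.inl ⟨y, hy, rfl⟩
      · obtain ⟨i, hi⟩ := hj y ((hs y).2 ⟨hy, hx⟩)
        have := hf.pr_mem.1 hi
        exact Or.inr ⟨i, this.1, by rw [this.2]⟩
    have hE' := hE.image (Y := base γ m) ht (fun x hx => by
      rcases hcase x hx with ⟨y, hy', rfl⟩ | ⟨y, hy', rfl⟩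
      · rw [t1]; exact add_inl.2 hy'
      · rw [t2 y hy']; exact add_inr.2 hy') fun x y hx hy h => by
        unfold base at *
        rcases hcase x hx with ⟨x, hx', rfl⟩ | ⟨x, hx', rfl⟩ <;>
          rcases hcase y hy with ⟨y, hy', rfl⟩ | ⟨y, hy', rfl⟩
        · simpa [t1] using h
        · rw [t1, t2 y hy', add_inl_inr]; exact ⟨hx', hy'⟩
        · simp at h
        · rw [t2 x hx', t2 y hy', add_inr_inr]
          rw [add_inr_inr] at h
          exact ⟨hx', hy', (hf.lt_iff hx' hy').1.1 h.2.2⟩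
    have hcar : (D.ext (base γ m)).car (pr τ (img s t)) := ext_car.2 ⟨k, _, hE', hτ⟩
    refine ⟨pr τ (img s t), ?_⟩
    rw [shift_map hf hcar, pr_inj]
    refine ⟨rfl, PRS.ext fun x => ?_⟩
    have : ∀ x, x ∊ s → sh f (t x) = x := fun x hx => by
      rcases hcase x hx with ⟨y, hy', rfl⟩ | ⟨y, hy', rfl⟩
      · rw [t1, sh_inl]
      · rw [t2 y hy', sh_inr]
    rw [mem_img (by fun_prop)]
    constructor
    · exact fun hx => ⟨t x, (mem_img ht).2 ⟨x, hx, rfl⟩, (this x hx).symm⟩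
    · rintro ⟨v, hv, rfl⟩
      obtain ⟨y, hy, rfl⟩ := (mem_img ht).1 hv
      rwa [this y hy]

theorem IsPredilator.mp_shift (hD : D.IsPredilator) (hγ : IsOrd γ) {m n f σ a : M} (hf : Hom m n f)
    (h : (D.ext (base γ m)).car (pr σ a)) :
    (D.shift γ).mp m n f (pr σ a) = pr σ (img a (sh f)) := by
  have := (hD.shift hγ).map_mp hf ⟨hf.dom, h⟩
  exact (shift_map hf h).1 this

end Shift

section Restrict

variable {D : PD M} {Q : M → M → Prop} (hD : D.IsPredilator)
  (hQ : ∀ m n f z w, D.map m n f z w → (Q m z ↔ Q n w))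
include hD hQ

/-- Both directions of the naturality of `Q` matter: preservation makes the maps restrict, and
reflection yields the support condition. -/
theorem IsPredilator.restrict : (D.restrict Q).IsPredilator := by
  refine
  { car_dom := fun n σ h => hD.car_dom n σ h.1
    lt_dom := fun n σ τ h => ⟨⟨(hD.lt_dom _ _ _ h.1).1, h.2.1⟩, ⟨(hD.lt_dom _ _ _ h.1).2, h.2.2⟩⟩
    map_dom := fun m n f z w h => ?_
    supp_dom := fun n z c h => ⟨⟨(hD.supp_dom _ _ _ h.1).1, h.2⟩, (hD.supp_dom _ _ _ h.1).2⟩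
    linear := fun n hn => ?_
    map_total := fun m n f z hf hz => ?_
    map_lt := fun m n f z z' w w' h h' hlt =>
      ⟨hD.map_lt _ _ _ _ _ _ _ h.1 h'.1 hlt.1, h.2.2, h'.2.2⟩
    map_id := fun n f z hf hid hz => ⟨hD.map_id _ _ _ hf hid hz.1, hz.2, hz.2⟩
    map_comp := fun l m n f g h z w v hh hfg hf hg =>
      ⟨hD.map_comp _ _ _ _ _ _ _ _ _ hh hfg hf.1 hg.1, hf.2.1, hg.2.2⟩
    monotone := fun m n f g z w w' hfg hf hg =>
      (hD.monotone _ _ _ _ _ _ _ hfg hf.1 hg.1).imp id fun h => ⟨h, hf.2.2, hg.2.2⟩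
    supp_total := fun n z hz => ?_
    supp_nat := fun m n f z w a b hf ha hb j => hD.supp_nat _ _ _ _ _ _ _ hf.1 ha.1 hb.1 j
    supp_range := fun m n f w b hf hb hj => ?_ }
  · have := hD.map_dom _ _ _ _ _ h.1
    exact ⟨this.1, ⟨this.2.1, h.2.1⟩, ⟨this.2.2, h.2.2⟩⟩
  · have := hD.linear n hn
    exact ⟨fun x hx h => this.1 x hx.1 h.1,
      fun x y z hx hy hz h h' => ⟨this.2.1 x y z hx.1 hy.1 hz.1 h.1 h'.1, hx.2, hz.2⟩,
      fun x y hx hy => (this.2.2 x y hx.1 hy.1).imp (fun h => ⟨h, hx.2, hy.2⟩)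
        (Or.imp id fun h => ⟨h, hy.2, hx.2⟩)⟩
  · obtain ⟨τ, h, hu⟩ := hD.map_total m n f z hf hz.1
    exact ⟨τ, ⟨h, hz.2, (hQ _ _ _ _ _ h).1 hz.2⟩, fun τ' h' => hu τ' h'.1⟩
  · obtain ⟨c, h, hu⟩ := hD.supp_total n z hz.1
    exact ⟨c, ⟨h, hz.2⟩, fun c' h' => hu c' h'.1⟩
  · obtain ⟨σ, h⟩ := hD.supp_range m n f w b hf hb.1 hj
    exact ⟨σ, h, (hQ _ _ _ _ _ h).2 hb.2, hb.2⟩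

theorem IsPredilator.mp_restrict {m n f σ : M} (hf : Hom m n f) (hσ : D.car m σ) (h : Q m σ) :
    (D.restrict Q).mp m n f σ = D.mp m n f σ := by
  have := (hD.restrict hQ).map_mp hf ⟨hσ, h⟩
  exact (hD.map_iff hf hσ).1 this.1

omit hD hQ [PRSModel M] in
theorem Tr_restrict {σ n : M} : (D.restrict Q).Tr σ n ↔ D.Tr σ n ∧ Q n σ :=
  ⟨fun h => ⟨⟨h.1.1, h.2.1⟩, h.1.2⟩, fun h => ⟨⟨h.1.1, h.2⟩, ⟨h.1.2, h.2⟩⟩⟩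

theorem IsPredilator.ext_restrict_lt {X : LO M} (hX : X.Good) {z w : M}
    (hz : ((D.restrict Q).ext X).car z) (hw : ((D.restrict Q).ext X).car w) :
    ((D.restrict Q).ext X).lt z w ↔ (D.ext X).lt z w := by
  obtain ⟨σ, a, rfl⟩ := ext_car_dest hz
  obtain ⟨τ, b, rfl⟩ := ext_car_dest hw
  obtain ⟨m, ea, ha, hσ⟩ := ext_car.1 hz
  obtain ⟨n, eb, hb, hτ⟩ := ext_car.1 hw
  obtain ⟨k, e, f, g, hE, hf, hg, hfe, hge, -⟩ := exists_joint hX ha hb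
  rw [((hD.restrict hQ).ext_lt_val hX ha hb hE hσ hτ hf hg hfe hge).1]
  rw [Tr_restrict] at hσ hτ
  rw [(hD.ext_lt_val hX ha hb hE hσ.1 hτ.1 hf hg hfe hge).1, hD.mp_restrict hQ hf hσ.1.1 hσ.2,
    hD.mp_restrict hQ hg hτ.1.1 hτ.2]
  refine ⟨fun h => h.1, fun h => ⟨h, ?_, ?_⟩⟩
  · exact (hQ _ _ _ _ _ (hD.map_mp hf hσ.1.1)).1 hσ.2
  · exact (hQ _ _ _ _ _ (hD.map_mp hg hτ.1.1)).1 hτ.2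

end Restrict

section LArg

/-- `y` is the leading argument of `z` in `D(X)` -/
def LArg (D : PD M) (X : LO M) (z y : M) : Prop :=
  ∃ σ a k e i, z = pr σ a ∧ X.Enum a k e ∧ D.Tr σ k ∧ D.SLead σ k i ∧ y = ap e i

variable {D : PD M} (hD : D.Led)
include hD

/-- The definition of `Lead` tests morphisms into `2n` only, which already determines the argument
uniquely. As an argument with the stronger property exists, the two notions agree. -/
theorem Led.lead_iff {σ n i : M} (hσ : D.Tr σ n) : D.Lead σ n i ↔ D.SLead σ n i := by
  refine ⟨fun h => ?_, hD.pred.lead_of_sLead hσ⟩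
  obtain ⟨j, hj⟩ := hD.ex σ n hσ
  rwa [hD.pred.lead_unique hσ h (hD.pred.lead_of_sLead hσ hj)]

theorem Led.lead_unique {σ n i j : M} (hσ : D.Tr σ n) (hi : D.SLead σ n i) (hj : D.SLead σ n j) :
    i = j :=
  hD.pred.lead_unique hσ (hD.pred.lead_of_sLead hσ hi) (hD.pred.lead_of_sLead hσ hj)

theorem Led.exists_larg {X : LO M} {z : M} (hz : (D.ext X).car z) : ∃ y, D.LArg X z y := by
  obtain ⟨σ, a, k, e, rfl, hE, hσ⟩ := hz
  obtain ⟨i, hi⟩ := hD.ex σ k hσ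
  exact ⟨_, σ, a, k, e, i, rfl, hE, hσ, hi, rfl⟩

theorem Led.larg_unique {X : LO M} (hX : X.IsLinear) {z y y' : M} (h : D.LArg X z y)
    (h' : D.LArg X z y') : y = y' := by
  obtain ⟨σ, a, k, e, i, rfl, hE, hσ, hi, rfl⟩ := h
  obtain ⟨σ', a', k', e', i', hz, hE', -, hi', rfl⟩ := h'
  obtain ⟨rfl, rfl⟩ := pr_inj.1 hz
  obtain ⟨rfl, rfl⟩ := hE.unique hX hE'
  rw [hD.lead_unique hσ hi hi']

omit hD in
theorem LArg.arg_car {X : LO M} {z y : M} (h : D.LArg X z y) : X.car y := by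
  obtain ⟨σ, a, k, e, i, rfl, hE, hσ, hi, rfl⟩ := h
  exact hE.car hi.1

theorem Led.larg_lt {X : LO M} (hX : X.Good) {z w x y : M} (hz : D.LArg X z x)
    (hw : D.LArg X w y) (h : X.lt x y) : (D.ext X).lt z w := by
  obtain ⟨σ, a, m, ea, i, rfl, ha, hσ, hi, rfl⟩ := hz
  obtain ⟨τ, b, n, eb, j, rfl, hb, hτ, hj, rfl⟩ := hw
  obtain ⟨k, e, f, g, hE, hf, hg, hfe, hge, -⟩ := IsPredilator.exists_joint hX ha hb
  rw [(hD.pred.ext_lt_val hX ha hb hE hσ hτ hf hg hfe hge).1]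
  refine hD.lt σ m i τ n j hσ hτ hi hj k f g hf hg ?_
  rw [← hfe i hi.1, ← hge j hj.1] at h
  exact (hE.lt_iff hX.lin (hf.ap_mem hi.1) (hg.ap_mem hj.1)).1.1 h

omit hD in
theorem LArg.image {X Y : LO M} {t : M → M} (ht : PR M t)
    (h1 : ∀ x, X.car x → Y.car (t x))
    (h2 : ∀ x y, X.car x → X.car y → X.lt x y → Y.lt (t x) (t y)) {σ a y : M}
    (h : D.LArg X (pr σ a) y) : D.LArg Y (pr σ (img a t)) (t y) := by
  obtain ⟨σ', a', k, e, i, hz, hE, hσ, hi, rfl⟩ := h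
  obtain ⟨rfl, rfl⟩ := pr_inj.1 hz
  refine ⟨σ, _, k, _, i, rfl, hE.image ht (fun x hx => h1 x (hE.sub hx))
    (fun x y hx hy => h2 x y (hE.sub hx) (hE.sub hy)), hσ, hi, ?_⟩
  have : PR M fun i => t (ap e i) := by fun_prop
  rw [ap_gr this hi.1]

theorem Led.leadArg_iff {γ n z y : M} (hn : IsOrd n) (hγ : IsOrd γ)
    (hz : (D.ext (base γ n)).car z) : D.LeadArg γ n z y ↔ D.LArg (base γ n) z y := by
  constructor
  · rintro ⟨σ, a, k, e, i, rfl, hE, hi, hy⟩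
    obtain ⟨k', e', hE', hσ⟩ := IsPredilator.ext_car.1 hz
    obtain ⟨rfl, rfl⟩ := hE.unique (base_good hγ hn).lin hE'
    exact ⟨σ, a, k, e, i, rfl, hE, hσ, (hD.lead_iff hσ).1 hi, (hE.pr_mem.1 hy).2⟩
  · rintro ⟨σ, a, k, e, i, rfl, hE, hσ, hi, rfl⟩
    exact ⟨σ, a, k, e, i, rfl, hE, (hD.lead_iff hσ).2 hi, hE.pr_mem.2 ⟨hi.1, rfl⟩⟩

theorem Led.leadArg_map {γ m n f z w : M} (hγ : IsOrd γ) (h : (D.shift γ).map m n f z w) (y : M)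
    (hy : D.LArg (base γ m) z y) : D.LeadArg γ n w (sh f y) := by
  obtain ⟨σ, a, rfl, hf, hz, rfl⟩ := shift_map_dest h
  rw [hD.leadArg_iff (ord_nat hf.cod) hγ (sh_ext_car hf hz)]
  exact hy.image (by fun_prop) (fun _ => sh_car hf) (fun _ _ => sh_lt hf)

theorem Led.minus_natural {γ : M} (hγ : IsOrd γ) (m n f z w : M) (h : (D.shift γ).map m n f z w) :
    (∃ x, x ∊ γ ∧ D.LeadArg γ m z (LO.inl x)) ↔ ∃ x, x ∊ γ ∧ D.LeadArg γ n w (LO.inl x) := by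
  obtain ⟨hf, hz, hw⟩ := (hD.pred.shift hγ).map_dom _ _ _ _ _ h
  obtain ⟨y, hy⟩ := hD.exists_larg hz.2
  have hy' := hD.leadArg_map hγ h y hy
  have hlin := (base_good hγ (ord_nat hf.dom)).lin
  have hlin' := (base_good hγ (ord_nat hf.cod)).lin
  simp only [hD.leadArg_iff (ord_nat hf.cod) hγ hw.2] at hy' ⊢
  simp only [hD.leadArg_iff (ord_nat hf.dom) hγ hz.2]
  rcases hy.arg_car with ⟨x, hx, rfl⟩ | ⟨x, hx, rfl⟩
  · rw [sh_inl] at hy'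
    exact ⟨fun _ => ⟨x, hx, hy'⟩, fun _ => ⟨x, hx, hy⟩⟩
  · rw [sh_inr] at hy'
    constructor
    · rintro ⟨x', _, h'⟩
      exact (inl_ne_inr (hD.larg_unique hlin h' hy)).elim
    · rintro ⟨x', _, h'⟩
      exact (inl_ne_inr (hD.larg_unique hlin' h' hy')).elim

theorem Led.plus_natural {γ : M} (hγ : IsOrd γ) (m n f z w : M) (h : (D.shift γ).map m n f z w) :
    (∃ x, x ∊ m ∧ D.LeadArg γ m z (LO.inr x)) ↔ ∃ x, x ∊ n ∧ D.LeadArg γ n w (LO.inr x) := by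
  obtain ⟨hf, hz, hw⟩ := (hD.pred.shift hγ).map_dom _ _ _ _ _ h
  obtain ⟨y, hy⟩ := hD.exists_larg hz.2
  have hy' := hD.leadArg_map hγ h y hy
  have hlin := (base_good hγ (ord_nat hf.dom)).lin
  have hlin' := (base_good hγ (ord_nat hf.cod)).lin
  simp only [hD.leadArg_iff (ord_nat hf.cod) hγ hw.2] at hy' ⊢
  simp only [hD.leadArg_iff (ord_nat hf.dom) hγ hz.2]
  rcases hy.arg_car with ⟨x, hx, rfl⟩ | ⟨x, hx, rfl⟩
  · rw [sh_inl] at hy'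
    constructor
    · rintro ⟨x', _, h'⟩
      exact (inr_ne_inl (hD.larg_unique hlin h' hy)).elim
    · rintro ⟨x', _, h'⟩
      exact (inr_ne_inl (hD.larg_unique hlin' h' hy')).elim
  · rw [sh_inr] at hy'
    exact ⟨fun _ => ⟨_, hf.ap_mem hx, hy'⟩, fun _ => ⟨x, hx, hy⟩⟩

theorem Led.plus_pred {γ : M} (hγ : IsOrd γ) : (D.plus γ).IsPredilator :=
  (hD.pred.shift hγ).restrict (hD.plus_natural hγ)

theorem Led.plus_tr {γ ρ k : M} (hγ : IsOrd γ) (h : (D.plus γ).Tr ρ k) :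
    (D.ext (base γ k)).car ρ ∧ (∀ i, i ∊ k → inr i ∊ snd ρ) ∧
      ∃ i, i ∊ k ∧ D.LArg (base γ k) ρ (inr i) := by
  obtain ⟨⟨⟨hk, hρ⟩, i, hi, hl⟩, ⟨_, _, σ, a, rfl, hs⟩, -⟩ := h
  refine ⟨hρ, fun i hi => ?_, i, hi, (hD.leadArg_iff (ord_nat hk) hγ hρ).1 hl⟩
  rw [snd_pr]
  exact ((hs i).1 hi).2

theorem Led.plus_mp_larg {γ ρ k N f i : M} (hγ : IsOrd γ) (h : (D.plus γ).Tr ρ k)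
    (hi : D.LArg (base γ k) ρ (inr i)) (hf : Hom k N f) :
    D.LArg (base γ N) ((D.plus γ).mp k N f ρ) (inr (ap f i)) := by
  have h1 : (D.plus γ).mp k N f ρ = (D.shift γ).mp k N f ρ :=
    (hD.pred.shift hγ).mp_restrict (hD.plus_natural hγ) hf h.1.1 h.1.2
  have hρ := (hD.plus_tr hγ h).1
  obtain ⟨σ, a, rfl⟩ := IsPredilator.ext_car_dest hρ
  rw [h1, hD.pred.mp_shift hγ hf hρ, ← sh_inr]
  exact hi.image (by fun_prop) (fun _ => sh_car hf) (fun _ _ => sh_lt hf)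

theorem Led.plus_lt {γ ρ m ρ' n N f g i j : M} (hγ : IsOrd γ) (h : (D.plus γ).Tr ρ m)
    (h' : (D.plus γ).Tr ρ' n) (hi : D.LArg (base γ m) ρ (inr i)) (hj : D.LArg (base γ n) ρ' (inr j))
    (hf : Hom m N f) (hg : Hom n N g) (hlt : ap f i ∊ ap g j) :
    (D.plus γ).lt N ((D.plus γ).mp m N f ρ) ((D.plus γ).mp n N g ρ') := by
  have l1 := hD.plus_mp_larg hγ h hi hf
  have l2 := hD.plus_mp_larg hγ h' hj hg
  have c1 := (hD.plus_pred hγ).mp_car hf h.1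
  have c2 := (hD.plus_pred hγ).mp_car hg h'.1
  refine ⟨⟨hf.cod, c1.1.2, c2.1.2, hD.larg_lt (base_good hγ (ord_nat hf.cod)) l1 l2 ?_⟩, c1.2, c2.2⟩
  exact add_inr_inr.2 ⟨add_inr.1 l1.arg_car, add_inr.1 l2.arg_car, hlt⟩

/-- A trace element of `D_+^γ` is an element of `D(γ + k)` whose leading argument lies in the
summand `k`. Dominance in `D` makes the position of this argument in `k` a leading argument for
`D_+^γ`, and by uniqueness there is no other. -/
theorem Led.plus_sLead {γ ρ k i : M} (hγ : IsOrd γ) (h : (D.plus γ).Tr ρ k) :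
    (D.plus γ).SLead ρ k i ↔ D.LArg (base γ k) ρ (inr i) := by
  have key : ∀ i, D.LArg (base γ k) ρ (inr i) → (D.plus γ).SLead ρ k i := fun i hi =>
    ⟨add_inr.1 hi.arg_car, fun N f g hf hg hlt => hD.plus_lt hγ h h hi hi hf hg hlt⟩
  refine ⟨fun hi => ?_, key i⟩
  obtain ⟨j, _, hj⟩ := (hD.plus_tr hγ h).2.2
  have hP := hD.plus_pred hγ
  rwa [hP.lead_unique h (hP.lead_of_sLead h hi) (hP.lead_of_sLead h (key j hj))]

/-- Comparisons in `D_+^γ` are comparisons in `D`, and the leading arguments correspond. Hence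
dominance is inherited and can be iterated along a sequence of ordinals. -/
theorem Led.plus {γ : M} (hγ : IsOrd γ) : (D.plus γ).Led := by
  refine ⟨hD.plus_pred hγ, fun ρ k h => ?_, fun ρ m i ρ' n j h h' hi hj N f g hf hg hlt => ?_⟩
  · obtain ⟨i, _, hi⟩ := (hD.plus_tr hγ h).2.2
    exact ⟨i, (hD.plus_sLead hγ h).2 hi⟩
  · exact hD.plus_lt hγ h h' ((hD.plus_sLead hγ h).1 hi) ((hD.plus_sLead hγ h').1 hj) hf hg hlt

end LArg

end PD

end PRS

/-! ### Elements of D^γ(X) as elements of D(Y), for an order Y that contains copies of γ and X -/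

namespace PRS

variable {M : Type u} [PRSModel M]

theorem img_img {a : M} {s t : M → M} (hs : PR M s) (ht : PR M t) :
    img (img a s) t = img a fun x => t (s x) := by
  refine ext fun z => ?_
  rw [mem_img ht, mem_img (by fun_prop)]
  constructor
  · rintro ⟨v, hv, rfl⟩
    obtain ⟨w, hw, rfl⟩ := (mem_img hs).1 hv
    exact ⟨w, hw, rfl⟩
  · rintro ⟨w, hw, rfl⟩
    exact ⟨_, (mem_img hs).2 ⟨w, hw, rfl⟩, rfl⟩

theorem img_congr {a : M} {s t : M → M} (hs : PR M s) (ht : PR M t) (h : ∀ x, x ∊ a → s x = t x) :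
    img a s = img a t := by
  refine ext fun z => ?_
  rw [mem_img hs, mem_img ht]
  exact exists_congr fun v => and_congr_right fun hv => by rw [h v hv]

theorem img_id {a : M} {s : M → M} (hs : PR M s) (h : ∀ x, x ∊ a → s x = x) : img a s = a := by
  refine ext fun z => ?_
  rw [mem_img hs]
  exact ⟨by rintro ⟨v, hv, rfl⟩; rwa [h v hv], fun hz => ⟨z, hz, (h z hz).symm⟩⟩

namespace LO

/-- the set of elements of an order, if there is one -/
def field (X : LO M) : M := if h : ∃ A, ∀ x, X.car x ↔ x ∊ A then h.choose else emp

theorem Good.mem_field {X : LO M} (hX : X.Good) {x : M} : x ∊ X.field ↔ X.car x := by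
  unfold field
  rw [dif_pos hX.set]
  exact (hX.set.choose_spec x).symm

/-- the increasing enumeration of a finite subset -/
def en (X : LO M) (c : M) : M :=
  sU (sep (Fin (times om X.field)) fun e => BEx om fun k => X.Enum c k e)

theorem Good.PR_en {X : LO M} (hX : X.Good) : PR M fun c => X.en c := by
  unfold en
  have := PR_enum hX (A := (M × M) × M) (a := fun p => p.1.1) (k := fun p => p.2)
    (e := fun p => p.1.2) (by fun_prop) (by fun_prop) (by fun_prop)
  fun_prop

theorem Good.en_eq {X : LO M} (hX : X.Good) {c k e : M} (h : X.Enum c k e) : X.en c = e := by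
  have := PR_enum hX (A := M × M) (a := fun _ => c) (k := fun p => p.2)
    (e := fun p => p.1) (by fun_prop) (by fun_prop) (by fun_prop)
  refine sU_sep_unique (by fun_prop) (h.graph_mem_Fin fun x hx => hX.mem_field.2 (h.sub hx)) fun e' => ?_
  constructor
  · rintro ⟨k', -, h'⟩
    exact (h'.unique hX.lin h).2
  · rintro rfl
    exact ⟨k, h.nat, h⟩

/-- the length of the increasing enumeration of a finite subset -/
def len (X : LO M) (c : M) : M :=
  sU (sep om fun k => BEx (Fin (times om X.field)) fun e => X.Enum c k e)

theorem Good.PR_len {X : LO M} (hX : X.Good) : PR M fun c => X.len c := by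
  unfold len
  have := PR_enum hX (A := (M × M) × M) (a := fun p => p.1.1) (k := fun p => p.1.2)
    (e := fun p => p.2) (by fun_prop) (by fun_prop) (by fun_prop)
  fun_prop

theorem Good.len_eq {X : LO M} (hX : X.Good) {c k e : M} (h : X.Enum c k e) : X.len c = k := by
  have := PR_enum hX (A := M × M) (a := fun _ => c) (k := fun p => p.1)
    (e := fun p => p.2) (by fun_prop) (by fun_prop) (by fun_prop)
  refine sU_sep_unique (by fun_prop) h.nat fun k' => ?_
  constructor
  · rintro ⟨e', -, h'⟩
    exact (h'.unique hX.lin h).1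
  · rintro rfl
    exact ⟨e, h.graph_mem_Fin fun x hx => hX.mem_field.2 (h.sub hx), h⟩

end LO

open LO

/-- `u` and `v` embed the ordinal `γ` and the order `X` into `Y`, the former below the latter. -/
structure Split (γ : M) (X Y : LO M) (u v : M → M) : Prop where
  ord : IsOrd γ
  hX : X.Good
  hY : Y.Good
  hu : PR M u
  hv : PR M v
  ucar : ∀ ξ, ξ ∊ γ → Y.car (u ξ)
  vcar : ∀ x, X.car x → Y.car (v x)
  ult : ∀ ξ η, ξ ∊ γ → η ∊ γ → ξ ∊ η → Y.lt (u ξ) (u η)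
  vlt : ∀ x y, X.car x → X.car y → X.lt x y → Y.lt (v x) (v y)
  uv : ∀ ξ x, ξ ∊ γ → X.car x → Y.lt (u ξ) (v x)

/-- the map `γ + k → Y` induced by `u` and by `v ∘ e` -/
def tmap (u v : M → M) (e z : M) : M := if fst z = emp then u (snd z) else v (ap e (snd z))

/-- the embedding of `D^γ(X)` into `D(Y)` -/
def J (X : LO M) (u v : M → M) (z : M) : M :=
  pr (fst (fst z)) (img (snd (fst z)) (tmap u v (X.en (snd z))))

namespace Split

variable {γ : M} {X Y : LO M} {u v : M → M} (H : Split γ X Y u v)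
include H

theorem v_inj {x y : M} (hx : X.car x) (hy : X.car y) (h : v x = v y) : x = y :=
  (lt_iff_of_mono H.hX.lin H.hY.lin hx hy (H.vcar x hx) (H.vcar y hy) (H.vlt x y hx hy)
    (H.vlt y x hy hx)).2.1 h

theorem u_inj {x y : M} (hx : x ∊ γ) (hy : y ∊ γ) (h : u x = u y) : x = y :=
  (lt_iff_of_mono (ofOrd_linear H.ord) H.hY.lin hx hy (H.ucar x hx) (H.ucar y hy) (H.ult x y hx hy)
    (H.ult y x hy hx)).2.1 h

theorem v_lt_iff {x y : M} (hx : X.car x) (hy : X.car y) : Y.lt (v x) (v y) ↔ X.lt x y :=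
  (lt_iff_of_mono H.hX.lin H.hY.lin hx hy (H.vcar x hx) (H.vcar y hy) (H.vlt x y hx hy)
    (H.vlt y x hy hx)).1

theorem u_lt_iff {x y : M} (hx : x ∊ γ) (hy : y ∊ γ) : Y.lt (u x) (u y) ↔ x ∊ y :=
  (lt_iff_of_mono (ofOrd_linear H.ord) H.hY.lin hx hy (H.ucar x hx) (H.ucar y hy) (H.ult x y hx hy)
    (H.ult y x hy hx)).1

theorem u_ne_v {ξ x : M} (hξ : ξ ∊ γ) (hx : X.car x) : u ξ ≠ v x :=
  H.hY.lin.ne (H.ucar ξ hξ) (H.uv ξ x hξ hx)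

theorem PR_tmap (e : M) : PR M (tmap u v e) := by
  have := H.hu
  have := H.hv
  unfold tmap
  fun_prop

theorem PR_J : PR M (J X u v) := by
  have := H.hu
  have := H.hv
  have := H.hX.PR_en
  unfold J tmap
  fun_prop

omit H in
@[simp] theorem _root_.PRS.tmap_inl (u v : M → M) (e x : M) : tmap u v e (inl x) = u x := by simp [tmap]
omit H in
@[simp] theorem _root_.PRS.tmap_inr (u v : M → M) (e x : M) : tmap u v e (inr x) = v (ap e x) := by
  simp [tmap, one_ne]

theorem tmap_car {c k e : M} (hE : X.Enum c k e) {z : M} (hz : (PD.base γ k).car z) :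
    Y.car (tmap u v e z) := by
  rcases hz with ⟨y, hy, rfl⟩ | ⟨y, hy, rfl⟩
  · rw [tmap_inl]; exact H.ucar y hy
  · rw [tmap_inr]; exact H.vcar _ (hE.car hy)

theorem tmap_lt {c k e : M} (hE : X.Enum c k e) {z w : M} (hz : (PD.base γ k).car z)
    (hw : (PD.base γ k).car w) (h : (PD.base γ k).lt z w) : Y.lt (tmap u v e z) (tmap u v e w) := by
  unfold PD.base at *
  rcases hz with ⟨y, hy, rfl⟩ | ⟨y, hy, rfl⟩ <;> rcases hw with ⟨y', hy', rfl⟩ | ⟨y', hy', rfl⟩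
  · rw [tmap_inl, tmap_inl]
    exact H.ult _ _ hy hy' (add_inl_inl.1 h).2.2
  · rw [tmap_inl, tmap_inr]
    exact H.uv _ _ hy (hE.car hy')
  · exact (add_inr_inl h).elim
  · rw [tmap_inr, tmap_inr]
    exact H.vlt _ _ (hE.car hy) (hE.car hy') (hE.lt hy hy' (add_inr_inr.1 h).2.2)

theorem J_eq {σ a c k e : M} (hE : X.Enum c k e) :
    J X u v (pr (pr σ a) c) = pr σ (img a (tmap u v e)) := by
  unfold J
  rw [fst_pr, fst_pr, snd_pr, snd_pr, H.hX.en_eq hE]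

variable {D : PD M}

omit H in
theorem dest {z : M} (hz : ((D.shift γ).ext X).car z) : ∃ σ a c k e, z = pr (pr σ a) c ∧
    X.Enum c k e ∧ (D.shift γ).Tr (pr σ a) k ∧ (D.ext (PD.base γ k)).car (pr σ a) ∧
    ∀ i, i ∊ k → inr i ∊ a := by
  obtain ⟨ρ, c, k, e, rfl, hE, hρ⟩ := hz
  obtain ⟨σ, a, h⟩ := PD.IsPredilator.ext_car_dest hρ.1.2
  subst h
  refine ⟨σ, a, c, k, e, rfl, hE, hρ, hρ.1.2, fun i hi => ?_⟩
  obtain ⟨_, _, σ', a', h, hs⟩ := hρ.2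
  obtain ⟨rfl, rfl⟩ := pr_inj.1 h
  exact ((hs i).1 hi).2

theorem J_car {z : M} (hz : ((D.shift γ).ext X).car z) : (D.ext Y).car (J X u v z) := by
  obtain ⟨σ, a, c, k, e, rfl, hE, -, hρ, -⟩ := dest hz
  rw [H.J_eq hE]
  exact PD.IsPredilator.ext_image_car (H.PR_tmap e) (fun _ => H.tmap_car hE)
    (fun _ _ => H.tmap_lt hE) hρ

theorem img_factor {σ a m e f e' : M} (hfe : ∀ i, i ∊ m → ap e' (ap f i) = ap e i)
    (hρ : (D.ext (PD.base γ m)).car (pr σ a)) :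
    img (img a (sh f)) (tmap u v e') = img a (tmap u v e) := by
  obtain ⟨k, ea, ha, -⟩ := PD.IsPredilator.ext_car.1 hρ
  have p1 := H.PR_tmap e'
  rw [img_img (by fun_prop) p1]
  refine img_congr (by fun_prop) (H.PR_tmap e) fun x hx => ?_
  rcases ha.sub hx with ⟨y, hy, rfl⟩ | ⟨y, hy, rfl⟩
  · rw [sh_inl, tmap_inl, tmap_inl]
  · rw [sh_inr, tmap_inr, tmap_inr, hfe y hy]

/-- Both elements are first compared in `D(γ + N)`, for an enumeration of the union of their
supports in `X`. The map from `γ + N` into `Y` is strictly increasing, so it preserves and reflects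
this comparison. -/
theorem J_lt (hD : D.IsPredilator) {z w : M} (hz : ((D.shift γ).ext X).car z)
    (hw : ((D.shift γ).ext X).car w) :
    (D.ext Y).lt (J X u v z) (J X u v w) ↔ ((D.shift γ).ext X).lt z w := by
  obtain ⟨σ, a, c, m, e, rfl, hE, hσ, hρ, -⟩ := dest hz
  obtain ⟨σ', a', c', n, e', rfl, hE', hσ', hρ', -⟩ := dest hw
  obtain ⟨N, ec, f, g, hEc, hf, hg, hfe, hge, -⟩ := PD.IsPredilator.exists_joint H.hX hE hE'
  rw [((hD.shift H.ord).ext_lt_val H.hX hE hE' hEc hσ hσ' hf hg hfe hge).1,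
    hD.mp_shift H.ord hf hρ, hD.mp_shift H.ord hg hρ', H.J_eq hE, H.J_eq hE',
    ← H.img_factor hfe hρ, ← H.img_factor hge hρ',
    hD.ext_image (base_good H.ord (ord_nat hf.cod)) H.hY (H.PR_tmap ec) (fun _ => H.tmap_car hEc)
      (fun _ _ => H.tmap_lt hEc) (PD.sh_ext_car hf hρ) (PD.sh_ext_car hg hρ')]
  exact ⟨fun h => ⟨hf.cod, PD.sh_ext_car hf hρ, PD.sh_ext_car hg hρ', h⟩, fun h => h.2.2.2⟩

theorem J_inj (hD : D.IsPredilator) {z w : M} (hz : ((D.shift γ).ext X).car z)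
    (hw : ((D.shift γ).ext X).car w) (h : J X u v z = J X u v w) : z = w := by
  have hl := (hD.ext_linear H.hY).1 _ (H.J_car hw)
  rcases ((hD.shift H.ord).ext_linear H.hX).2.2 z w hz hw with h1 | h1 | h1
  · exact (hl (by rw [← H.J_lt hD hz hw, h] at h1; exact h1)).elim
  · exact h1
  · exact (hl (by rw [← H.J_lt hD hw hz, h] at h1; exact h1)).elim

theorem mem_supp_v {z : M} (hz : ((D.shift γ).ext X).car z) {x : M} (hx : X.car x) :
    v x ∊ snd (J X u v z) ↔ x ∊ snd z := by
  obtain ⟨σ, a, c, k, e, rfl, hE, -, hρ, hs⟩ := dest hz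
  obtain ⟨l, ea, ha, -⟩ := PD.IsPredilator.ext_car.1 hρ
  rw [H.J_eq hE, snd_pr, snd_pr, mem_img (H.PR_tmap e), hE.mem]
  constructor
  · rintro ⟨y, hy, h⟩
    rcases ha.sub hy with ⟨y, hy', rfl⟩ | ⟨y, hy', rfl⟩
    · rw [tmap_inl] at h
      exact (H.u_ne_v hy' hx h.symm).elim
    · rw [tmap_inr] at h
      exact ⟨y, hy', H.v_inj hx (hE.car hy') h⟩
  · rintro ⟨i, hi, rfl⟩
    exact ⟨inr i, hs i hi, (tmap_inr _ _ _ _).symm⟩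

theorem supp_cases {z : M} (hz : ((D.shift γ).ext X).car z) {y : M} (hy : y ∊ snd (J X u v z)) :
    (∃ ξ, ξ ∊ γ ∧ y = u ξ) ∨ ∃ x, X.car x ∧ x ∊ snd z ∧ y = v x := by
  obtain ⟨σ, a, c, k, e, rfl, hE, -, hρ, hs⟩ := dest hz
  obtain ⟨l, ea, ha, -⟩ := PD.IsPredilator.ext_car.1 hρ
  rw [H.J_eq hE, snd_pr, mem_img (H.PR_tmap e)] at hy
  obtain ⟨y, hy, rfl⟩ := hy
  rcases ha.sub hy with ⟨y, hy', rfl⟩ | ⟨y, hy', rfl⟩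
  · exact Or.inl ⟨y, hy', tmap_inl _ _ _ _⟩
  · refine Or.inr ⟨ap e y, hE.car hy', ?_, tmap_inr _ _ _ _⟩
    rw [snd_pr]
    exact hE.ap_mem hy'

/-- The range of `J` consists of the elements with support in the ranges of `u` and `v`. The inverse
is provided as a primitive recursive function, because the final embedding is formed as a set by
composing with it; pointwise existence would not suffice. -/
theorem exists_inverse (D : PD M) : ∃ f, PR M f ∧ ∀ w, (D.ext Y).car w →
    (∀ y, y ∊ snd w → (∃ ξ, ξ ∊ γ ∧ y = u ξ) ∨ ∃ x, X.car x ∧ y = v x) →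
    ((D.shift γ).ext X).car (f w) ∧ J X u v (f w) = w := by
  have hu := H.hu
  have hv := H.hv
  have hen := H.hX.PR_en
  have hlen := H.hX.PR_len
  let ui : M → M := fun y => sU (sep γ fun ξ => u ξ = y)
  let vi : M → M := fun y => sU (sep X.field fun x => v x = y)
  have ui_eq : ∀ ξ, ξ ∊ γ → ui (u ξ) = ξ := fun ξ hξ => by
    have : sep γ (fun η => u η = u ξ) = sing ξ := ext fun z => by
      rw [mem_sep (by fun_prop), mem_sing]
      exact ⟨fun h => H.u_inj h.1 hξ h.2, by rintro rfl; exact ⟨hξ, rfl⟩⟩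
    show sU (sep γ fun η => u η = u ξ) = ξ
    rw [this]
    exact ext fun z => by simp
  have vi_eq : ∀ x, X.car x → vi (v x) = x := fun x hx => by
    have : sep X.field (fun y => v y = v x) = sing x := ext fun z => by
      rw [mem_sep (by fun_prop), mem_sing]
      exact ⟨fun h => H.v_inj (H.hX.mem_field.1 h.1) hx h.2,
        by rintro rfl; exact ⟨H.hX.mem_field.2 hx, rfl⟩⟩
    show sU (sep X.field fun y => v y = v x) = x
    rw [this]
    exact ext fun z => by simp
  -- The support in `X`: the part of `b` in the range of `v`, pulled back along `v`.
  let C : M → M := fun b => img (sep b fun y => BEx X.field fun x => y = v x) vi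
  -- The inverse of `tmap`. It relies on the definable enumeration `X.en c` rather than on a chosen
  -- one, so that it is primitive recursive in `c`.
  let s' : M → M → M := fun c y => if BEx γ (fun ξ => y = u ξ) then inl (ui y) else
    inr (idx (X.en c) (X.len c) (vi y))
  refine ⟨fun w => pr (pr (fst w) (img (snd w) (s' (C (snd w))))) (C (snd w)), by fun_prop, ?_⟩
  rintro _ ⟨σ, b, l, eb, rfl, hEb, hσ⟩ hb
  rw [snd_pr] at hb
  beta_reduce
  rw [fst_pr, snd_pr]
  let c : M := C b
  have hc : ∀ x, x ∊ c ↔ X.car x ∧ v x ∊ b := fun x => by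
    show x ∊ img (sep b fun y => BEx X.field fun x => y = v x) vi ↔ _
    rw [mem_img (by fun_prop)]
    constructor
    · rintro ⟨y, hy, rfl⟩
      rw [mem_sep (by fun_prop)] at hy
      obtain ⟨hy, x, hx, rfl⟩ := hy
      rw [vi_eq x (H.hX.mem_field.1 hx)]
      exact ⟨H.hX.mem_field.1 hx, hy⟩
    · rintro ⟨hx, hy⟩
      exact ⟨v x, (mem_sep (by fun_prop)).2 ⟨hy, x, H.hX.mem_field.2 hx, rfl⟩, (vi_eq x hx).symm⟩
  have hcF : c ∊ Fin X.field := by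
    refine Fin_img (X := b) (by fun_prop) (Fin_of_sub (hEb.mem_Fin fun _ h => h)
      fun x hx => ((mem_sep (by fun_prop)).1 hx).1) fun x hx => ?_
    rw [mem_sep (by fun_prop)] at hx
    obtain ⟨hy, x, hx, rfl⟩ := hx
    rwa [vi_eq x (H.hX.mem_field.1 hx)]
  obtain ⟨k, e, hE⟩ := H.hX.exists_enum hcF fun x hx => ((hc x).1 hx).1
  let s : M → M := fun y => if BEx γ (fun ξ => y = u ξ) then inl (ui y) else inr (idx e k (vi y))
  have hs : PR M s := by fun_prop
  have hs' : s' (C b) = s := by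
    show (fun y => if BEx γ (fun ξ => y = u ξ) then inl (ui y) else
      inr (idx (X.en c) (X.len c) (vi y))) = s
    rw [H.hX.en_eq hE, H.hX.len_eq hE]
  rw [hs']
  have s_u : ∀ ξ, ξ ∊ γ → s (u ξ) = inl ξ := fun ξ hξ => by
    show (if _ then _ else _) = _
    rw [if_pos ⟨ξ, hξ, rfl⟩, ui_eq ξ hξ]
  have s_v : ∀ i, i ∊ k → s (v (ap e i)) = inr i := fun i hi => by
    show (if _ then _ else _) = _
    rw [if_neg, vi_eq _ (hE.car hi), hE.idx_ap H.hX.lin hi]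
    rintro ⟨ξ, hξ, h⟩
    exact H.u_ne_v hξ (hE.car hi) h.symm
  have hb' : ∀ y, y ∊ b → (∃ ξ, ξ ∊ γ ∧ y = u ξ) ∨ ∃ i, i ∊ k ∧ y = v (ap e i) := by
    intro y hy
    rcases hb y hy with h | ⟨x, hx, rfl⟩
    · exact Or.inl h
    · obtain ⟨i, hi, h⟩ := hE.mem.1 ((hc x).2 ⟨hx, hy⟩)
      exact Or.inr ⟨i, hi, by rw [h]⟩
  have hts : ∀ y, y ∊ b → tmap u v e (s y) = y := fun y hy => by
    rcases hb' y hy with ⟨ξ, hξ, rfl⟩ | ⟨i, hi, rfl⟩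
    · rw [s_u ξ hξ, tmap_inl]
    · rw [s_v i hi, tmap_inr]
  have hEa := hEb.image (Y := PD.base γ k) hs (fun y hy => by
    rcases hb' y hy with ⟨ξ, hξ, rfl⟩ | ⟨i, hi, rfl⟩
    · rw [s_u ξ hξ]; exact add_inl.2 hξ
    · rw [s_v i hi]; exact add_inr.2 hi) fun x y hx hy h => by
      unfold PD.base
      rcases hb' x hx with ⟨ξ, hξ, rfl⟩ | ⟨i, hi, rfl⟩ <;>
        rcases hb' y hy with ⟨η, hη, rfl⟩ | ⟨j, hj, rfl⟩
      · rw [s_u ξ hξ, s_u η hη, add_inl_inl]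
        exact ⟨hξ, hη, (H.u_lt_iff hξ hη).1 h⟩
      · rw [s_u ξ hξ, s_v j hj, add_inl_inr]
        exact ⟨hξ, hj⟩
      · exact (H.hY.lin.asymm (hEb.sub hx) (hEb.sub hy) h (H.uv _ _ hη (hE.car hi))).elim
      · rw [s_v i hi, s_v j hj, add_inr_inr]
        exact ⟨hi, hj, (hE.lt_iff H.hX.lin hi hj).1.1 ((H.v_lt_iff (hE.car hi) (hE.car hj)).1 h)⟩
  have hρ : (D.ext (PD.base γ k)).car (pr σ (img b s)) := PD.IsPredilator.ext_car.2 ⟨l, _, hEa, hσ⟩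
  refine ⟨PD.IsPredilator.ext_car.2 ⟨k, e, hE, ⟨hE.nat, hρ⟩, hE.nat, hρ, σ,
    img b s, rfl, fun i => ⟨fun hi => ⟨hi, ?_⟩, fun h => h.1⟩⟩, ?_⟩
  · rw [mem_img hs]
    exact ⟨_, ((hc _).1 (hE.ap_mem hi)).2, (s_v i hi).symm⟩
  · have ht := H.PR_tmap e
    rw [H.J_eq hE, img_img hs ht, img_id (by fun_prop) hts]

theorem J_surj {w : M} (hw : (D.ext Y).car w)
    (hb : ∀ y, y ∊ snd w → (∃ ξ, ξ ∊ γ ∧ y = u ξ) ∨ ∃ x, X.car x ∧ y = v x) :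
    ∃ z, ((D.shift γ).ext X).car z ∧ J X u v z = w := by
  obtain ⟨f, -, hf⟩ := H.exists_inverse D
  exact ⟨f w, hf w hw hb⟩

section Leads

variable (hD : D.Led)
include hD

theorem exists_lead {σ a c k e : M} (hE : X.Enum c k e)
    (hρ : (D.ext (PD.base γ k)).car (pr σ a)) :
    ∃ y, D.LArg (PD.base γ k) (pr σ a) y ∧ D.LArg Y (J X u v (pr (pr σ a) c)) (tmap u v e y) := by
  obtain ⟨y, hy⟩ := hD.exists_larg hρ
  refine ⟨y, hy, ?_⟩
  rw [H.J_eq hE]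
  exact hy.image (H.PR_tmap e) (fun _ => H.tmap_car hE) (fun _ _ => H.tmap_lt hE)

/-- Seen in `D(Y)`, the two subfunctors are distinguished by the leading argument, which comes from
`γ` here and from `X` in the case of `plus`. The position is invariant because increasing maps
preserve leading arguments. -/
theorem minus_car {z : M} : ((D.minus γ).ext X).car z ↔
    ((D.shift γ).ext X).car z ∧ ∃ ξ, ξ ∊ γ ∧ D.LArg Y (J X u v z) (u ξ) := by
  constructor
  · rintro ⟨ρ, c, k, e, rfl, hE, hρ⟩
    obtain ⟨hρ, ξ, hξ, hl⟩ := PD.Tr_restrict.1 hρ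
    have hz : ((D.shift γ).ext X).car (pr ρ c) := PD.IsPredilator.ext_car.2 ⟨k, e, hE, hρ⟩
    refine ⟨hz, ξ, hξ, ?_⟩
    rw [hD.leadArg_iff (ord_nat hE.nat) H.ord hρ.1.2] at hl
    obtain ⟨σ, a, rfl⟩ := PD.IsPredilator.ext_car_dest hρ.1.2
    rw [H.J_eq hE]
    have := hl.image (H.PR_tmap e) (fun _ => H.tmap_car hE) (fun _ _ => H.tmap_lt hE)
    rwa [tmap_inl] at this
  · rintro ⟨hz, ξ, hξ, hl⟩
    obtain ⟨σ, a, c, k, e, rfl, hE, hσ, hρ, -⟩ := dest hz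
    refine PD.IsPredilator.ext_car.2 ⟨k, e, hE, PD.Tr_restrict.2 ⟨hσ, ?_⟩⟩
    obtain ⟨y, hy, hl'⟩ := H.exists_lead hD hE hρ
    have := hD.larg_unique H.hY.lin hl' hl
    simp only [hD.leadArg_iff (ord_nat hE.nat) H.ord hρ]
    rcases hy.arg_car with ⟨x, hx, rfl⟩ | ⟨x, hx, rfl⟩
    · exact ⟨x, hx, hy⟩
    · rw [tmap_inr] at this
      exact (H.u_ne_v hξ (hE.car hx) this.symm).elim

theorem plus_car {z : M} : ((D.plus γ).ext X).car z ↔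
    ((D.shift γ).ext X).car z ∧ ∃ x, X.car x ∧ D.LArg Y (J X u v z) (v x) := by
  constructor
  · rintro ⟨ρ, c, k, e, rfl, hE, hρ⟩
    obtain ⟨hρ, i, hi, hl⟩ := PD.Tr_restrict.1 hρ
    have hz : ((D.shift γ).ext X).car (pr ρ c) := PD.IsPredilator.ext_car.2 ⟨k, e, hE, hρ⟩
    refine ⟨hz, ap e i, hE.car hi, ?_⟩
    rw [hD.leadArg_iff (ord_nat hE.nat) H.ord hρ.1.2] at hl
    obtain ⟨σ, a, rfl⟩ := PD.IsPredilator.ext_car_dest hρ.1.2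
    rw [H.J_eq hE]
    have := hl.image (H.PR_tmap e) (fun _ => H.tmap_car hE) (fun _ _ => H.tmap_lt hE)
    rwa [tmap_inr] at this
  · rintro ⟨hz, x, hx, hl⟩
    obtain ⟨σ, a, c, k, e, rfl, hE, hσ, hρ, -⟩ := dest hz
    refine PD.IsPredilator.ext_car.2 ⟨k, e, hE, PD.Tr_restrict.2 ⟨hσ, ?_⟩⟩
    obtain ⟨y, hy, hl'⟩ := H.exists_lead hD hE hρ
    have := hD.larg_unique H.hY.lin hl' hl
    simp only [hD.leadArg_iff (ord_nat hE.nat) H.ord hρ]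
    rcases hy.arg_car with ⟨ξ, hξ, rfl⟩ | ⟨i, hi, rfl⟩
    · rw [tmap_inl] at this
      exact (H.u_ne_v hξ hx this).elim
    · exact ⟨i, hi, hy⟩

theorem plus_larg {z x : M} (h : (D.plus γ).LArg X z x) : D.LArg Y (J X u v z) (v x) := by
  obtain ⟨ρ, c, k, e, i, rfl, hE, hρ, hi, rfl⟩ := h
  have hl := (hD.plus_sLead H.ord hρ).1 hi
  obtain ⟨σ, a, rfl⟩ := PD.IsPredilator.ext_car_dest hρ.1.1.2
  rw [H.J_eq hE]
  have := hl.image (H.PR_tmap e) (fun _ => H.tmap_car hE) (fun _ _ => H.tmap_lt hE)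
  rwa [tmap_inr] at this

theorem plus_larg_iff {z x : M} (hz : ((D.plus γ).ext X).car z) (hx : X.car x) :
    (D.plus γ).LArg X z x ↔ D.LArg Y (J X u v z) (v x) := by
  refine ⟨H.plus_larg hD, fun h => ?_⟩
  obtain ⟨x', hx'⟩ := (hD.plus H.ord).exists_larg hz
  rwa [← H.v_inj hx'.arg_car hx (hD.larg_unique H.hY.lin (H.plus_larg hD hx') h)]

theorem minus_lt {z w : M} (hz : ((D.minus γ).ext X).car z) (hw : ((D.minus γ).ext X).car w) :
    (D.ext Y).lt (J X u v z) (J X u v w) ↔ ((D.minus γ).ext X).lt z w := by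
  rw [H.J_lt hD.pred ((H.minus_car hD).1 hz).1 ((H.minus_car hD).1 hw).1]
  exact ((hD.pred.shift H.ord).ext_restrict_lt (hD.minus_natural H.ord) H.hX hz hw).symm

theorem plus_ext_lt {z w : M} (hz : ((D.plus γ).ext X).car z) (hw : ((D.plus γ).ext X).car w) :
    (D.ext Y).lt (J X u v z) (J X u v w) ↔ ((D.plus γ).ext X).lt z w := by
  rw [H.J_lt hD.pred ((H.plus_car hD).1 hz).1 ((H.plus_car hD).1 hw).1]
  exact ((hD.pred.shift H.ord).ext_restrict_lt (hD.plus_natural H.ord) H.hX hz hw).symm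

end Leads

end Split

end PRS

namespace PRS

/-! ### Transitive closures as bounds for quantifiers over coded predilators -/

section Closure

variable {M : Type u} [PRSModel M]

theorem exists_iterU : ∃ F : M → M → M, PR M (fun p : M × M => F p.1 p.2) ∧
    ∀ a x, F a x = union a (iU x fun v => sU (F a v)) := by
  obtain ⟨F, hF, h⟩ := PR.recursion (M := M) (A := M)
    (G := fun a f x => union a (iU x fun v => sU (ap f v))) (by fun_prop)
  refine ⟨F, hF, fun a x => ?_⟩
  have hp : PR M (F a) := PR.const_left (f := fun p : M × M => F p.1 p.2) hF a
  rw [h]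
  refine ext fun z => ?_
  rw [mem_union, mem_union, mem_iU (by fun_prop), mem_iU (by fun_prop)]
  refine or_congr Iff.rfl (exists_congr fun v => and_congr_right fun hv => ?_)
  rw [ap_gr hp hv]

/-- the transitive closure -/
def trcl (x : M) : M := iU om (exists_iterU.choose x)

@[fun_prop] theorem PR.trcl {A : Type*} [Enc M A] {f : A → M} (hf : PR M f) :
    PR M (fun a => trcl (f a)) := by
  have := (exists_iterU (M := M)).choose_spec.1
  have : PR M fun p : A × M => exists_iterU.choose (f p.1) p.2 :=
    PR.comp (h := fun p : A × M => (f p.1, p.2)) this (by fun_prop)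
  unfold PRS.trcl
  fun_prop

theorem mem_trcl {x z : M} : z ∊ trcl x ↔ ∃ n, n ∊ (om : M) ∧ z ∊ exists_iterU.choose x n :=
  mem_iU (PR.const_left (f := fun p : M × M => exists_iterU.choose p.1 p.2)
    exists_iterU.choose_spec.1 x)

theorem mem_iterU {x n z : M} : z ∊ exists_iterU.choose x n ↔
    z ∊ x ∨ ∃ m, m ∊ n ∧ ∃ v, v ∊ exists_iterU.choose x m ∧ z ∊ v := by
  have h := (exists_iterU (M := M)).choose_spec
  have hp : PR M (exists_iterU.choose x) :=
    PR.const_left (f := fun p : M × M => exists_iterU.choose p.1 p.2) h.1 x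
  rw [h.2, mem_union, mem_iU (by fun_prop)]
  simp only [mem_sU]

theorem trcl_trans {x y z : M} (hy : y ∊ trcl x) (hz : z ∊ y) : z ∊ trcl x := by
  obtain ⟨n, hn, hy⟩ := mem_trcl.1 hy
  exact mem_trcl.2 ⟨suc n, suc_mem_om hn, mem_iterU.2 (Or.inr ⟨n, mem_suc_self n, y, hy, hz⟩)⟩

theorem sub_trcl {x z : M} (h : z ∊ x) : z ∊ trcl x :=
  mem_trcl.2 ⟨emp, emp_mem_om, mem_iterU.2 (Or.inl h)⟩

theorem pr_mem_trcl {x a b : M} (h : pr a b ∊ trcl x) : a ∊ trcl x ∧ b ∊ trcl x := by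
  have h1 : sing a ∊ pr a b := by rw [pr_eq]; simp
  have h2 : pair a b ∊ pr a b := by rw [pr_eq]; simp
  exact ⟨trcl_trans (trcl_trans h h1) (by simp), trcl_trans (trcl_trans h h2) (by simp)⟩

theorem trcl_pr {a b : M} : a ∊ trcl (pr a b) ∧ b ∊ trcl (pr a b) := by
  have h1 : sing a ∊ pr a b := by rw [pr_eq]; simp
  have h2 : pair a b ∊ pr a b := by rw [pr_eq]; simp
  exact ⟨trcl_trans (sub_trcl h1) (by simp), trcl_trans (sub_trcl h2) (by simp)⟩

end Closure

namespace PD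

variable {M : Type u} [PRSModel M] {A : Type*} [Enc M A]

/-! ### Bounded forms of the notions for coded predilators -/

def OCar (x n σ : M) : Prop := (ofSet x).car n σ
def OLt (x n σ τ : M) : Prop := (ofSet x).lt n σ τ
def OMap (x m n f σ τ : M) : Prop := (ofSet x).map m n f σ τ
def OSupp (x n σ a : M) : Prop := (ofSet x).supp n σ a

/-- The unbounded quantifiers over the components of a code are eliminated in favour of projections,
which are primitive recursive. -/
theorem code_iff {x : M} {P : M → M → M → M → Prop} : (∃ C L F S, x = code C L F S ∧ P C L F S) ↔
    x = code (fst x) (fst (snd x)) (fst (snd (snd x))) (snd (snd (snd x))) ∧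
      P (fst x) (fst (snd x)) (fst (snd (snd x))) (snd (snd (snd x))) := by
  constructor
  · rintro ⟨C, L, F, S, rfl, h⟩
    simp only [code, fst_pr, snd_pr]
    exact ⟨trivial, h⟩
  · exact fun h => ⟨_, _, _, _, h⟩

@[fun_prop] theorem PR_OCar {x n σ : A → M} (hx : PR M x) (hn : PR M n) (hσ : PR M σ) :
    PR M fun a => OCar (x a) (n a) (σ a) := by
  simp only [OCar, ofSet, code_iff]
  simp only [code]
  fun_prop

@[fun_prop] theorem PR_OLt {x n σ τ : A → M} (hx : PR M x) (hn : PR M n) (hσ : PR M σ)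
    (hτ : PR M τ) : PR M fun a => OLt (x a) (n a) (σ a) (τ a) := by
  simp only [OLt, ofSet, code_iff]
  simp only [code]
  fun_prop

@[fun_prop] theorem PR_OMap {x m n f σ τ : A → M} (hx : PR M x) (hm : PR M m) (hn : PR M n)
    (hf : PR M f) (hσ : PR M σ) (hτ : PR M τ) :
    PR M fun a => OMap (x a) (m a) (n a) (f a) (σ a) (τ a) := by
  simp only [OMap, ofSet, code_iff]
  simp only [code]
  fun_prop

@[fun_prop] theorem PR_OSupp {x n σ τ : A → M} (hx : PR M x) (hn : PR M n) (hσ : PR M σ)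
    (hτ : PR M τ) : PR M fun a => OSupp (x a) (n a) (σ a) (τ a) := by
  simp only [OSupp, ofSet, code_iff]
  simp only [code]
  fun_prop

theorem code_trcl {x C L F S : M} (h : x = code C L F S) :
    C ∊ trcl x ∧ L ∊ trcl x ∧ F ∊ trcl x ∧ S ∊ trcl x := by
  subst h
  have h1 := trcl_pr (a := C) (b := pr L (pr F S))
  have h2 := pr_mem_trcl h1.2
  exact ⟨h1.1, h2.1, pr_mem_trcl h2.2⟩

theorem OCar.dom {x n σ : M} (h : OCar x n σ) : n ∊ trcl x ∧ σ ∊ trcl x := by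
  obtain ⟨C, L, F, S, hx, h⟩ := h
  exact pr_mem_trcl (trcl_trans (code_trcl hx).1 h)

theorem OLt.dom {x n σ τ : M} (h : OLt x n σ τ) : n ∊ trcl x ∧ σ ∊ trcl x ∧ τ ∊ trcl x := by
  obtain ⟨C, L, F, S, hx, h⟩ := h
  have := pr_mem_trcl (trcl_trans (code_trcl hx).2.1 h)
  exact ⟨this.1, pr_mem_trcl this.2⟩

theorem OMap.dom {x m n f σ τ : M} (h : OMap x m n f σ τ) :
    m ∊ trcl x ∧ n ∊ trcl x ∧ f ∊ trcl x ∧ σ ∊ trcl x ∧ τ ∊ trcl x := by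
  obtain ⟨C, L, F, S, hx, h⟩ := h
  have h1 := pr_mem_trcl (trcl_trans (code_trcl hx).2.2.1 h)
  have h2 := pr_mem_trcl h1.2
  have h3 := pr_mem_trcl h2.2
  exact ⟨h1.1, h2.1, h3.1, pr_mem_trcl h3.2⟩

theorem OSupp.dom {x n σ a : M} (h : OSupp x n σ a) : n ∊ trcl x ∧ σ ∊ trcl x ∧ a ∊ trcl x := by
  obtain ⟨C, L, F, S, hx, h⟩ := h
  have := pr_mem_trcl (trcl_trans (code_trcl hx).2.2.2 h)
  exact ⟨this.1, pr_mem_trcl this.2⟩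

/-- a bound for the morphisms of `Nat` -/
def homs : M := Fin (times om om)

/-- This and the next four definitions together express that the coded data form a predilator. All
quantifiers are bounded by the transitive closure of the code, by `ω` or by the set of morphisms, so
the property is primitive recursive in the code. -/
def BOrder (x : M) : Prop :=
  (BAll (trcl x) fun n => BAll (trcl x) fun σ => OCar x n σ → n ∊ om) ∧
  (BAll (trcl x) fun n => BAll (trcl x) fun σ => BAll (trcl x) fun τ =>
    OLt x n σ τ → OCar x n σ ∧ OCar x n τ) ∧
  (BAll om fun n => BAll (trcl x) fun σ => OCar x n σ → ¬ OLt x n σ σ) ∧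
  (BAll om fun n => BAll (trcl x) fun σ => BAll (trcl x) fun τ => BAll (trcl x) fun ρ =>
    OLt x n σ τ → OLt x n τ ρ → OLt x n σ ρ) ∧
  BAll om fun n => BAll (trcl x) fun σ => BAll (trcl x) fun τ =>
    OCar x n σ → OCar x n τ → OLt x n σ τ ∨ σ = τ ∨ OLt x n τ σ

def BMap (x : M) : Prop :=
  (BAll (trcl x) fun m => BAll (trcl x) fun n => BAll (trcl x) fun f => BAll (trcl x) fun σ =>
    BAll (trcl x) fun τ => OMap x m n f σ τ → Hom m n f ∧ OCar x m σ ∧ OCar x n τ) ∧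
  (BAll om fun m => BAll om fun n => BAll homs fun f => BAll (trcl x) fun σ =>
    Hom m n f → OCar x m σ → BEx (trcl x) fun τ => OMap x m n f σ τ ∧ BAll (trcl x) fun τ' =>
      OMap x m n f σ τ' → τ' = τ) ∧
  BAll (trcl x) fun m => BAll (trcl x) fun n => BAll (trcl x) fun f => BAll (trcl x) fun σ =>
    BAll (trcl x) fun σ' => BAll (trcl x) fun τ => BAll (trcl x) fun τ' =>
      OMap x m n f σ τ → OMap x m n f σ' τ' → OLt x m σ σ' → OLt x n τ τ'

def BFunct (x : M) : Prop :=
  (BAll om fun n => BAll homs fun f => BAll (trcl x) fun σ =>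
    Hom n n f → (BAll n fun i => pr i i ∊ f) → OCar x n σ → OMap x n n f σ σ) ∧
  BAll (trcl x) fun l => BAll (trcl x) fun m => BAll (trcl x) fun n => BAll (trcl x) fun f =>
    BAll (trcl x) fun g => BAll homs fun h => BAll (trcl x) fun σ => BAll (trcl x) fun τ =>
      BAll (trcl x) fun ρ => Hom l n h →
        (BAll om fun i => BAll om fun j => BAll om fun k => pr i j ∊ f → pr j k ∊ g → pr i k ∊ h) →
        OMap x l m f σ τ → OMap x m n g τ ρ → OMap x l n h σ ρ

def BMono (x : M) : Prop :=
  BAll (trcl x) fun m => BAll (trcl x) fun n => BAll (trcl x) fun f => BAll (trcl x) fun g =>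
    BAll (trcl x) fun σ => BAll (trcl x) fun τ => BAll (trcl x) fun τ' =>
      (BAll om fun i => BAll om fun j => BAll om fun j' =>
        pr i j ∊ f → pr i j' ∊ g → j = j' ∨ j ∊ j') →
      OMap x m n f σ τ → OMap x m n g σ τ' → τ = τ' ∨ OLt x n τ τ'

def BSupp (x : M) : Prop :=
  (BAll (trcl x) fun n => BAll (trcl x) fun σ => BAll (trcl x) fun a => OSupp x n σ a →
    OCar x n σ ∧ BAll a fun i => i ∊ n) ∧
  (BAll (trcl x) fun n => BAll (trcl x) fun σ => OCar x n σ → BEx (trcl x) fun a => OSupp x n σ a ∧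
    BAll (trcl x) fun a' => OSupp x n σ a' → a' = a) ∧
  (BAll (trcl x) fun m => BAll (trcl x) fun n => BAll (trcl x) fun f => BAll (trcl x) fun σ =>
    BAll (trcl x) fun τ => BAll (trcl x) fun a => BAll (trcl x) fun b => OMap x m n f σ τ →
      OSupp x m σ a → OSupp x n τ b → BAll om fun j => j ∊ b ↔ BEx a fun i => pr i j ∊ f) ∧
  BAll om fun m => BAll (trcl x) fun n => BAll homs fun f => BAll (trcl x) fun τ =>
    BAll (trcl x) fun b => Hom m n f → OSupp x n τ b → (BAll b fun j => BEx om fun i => pr i j ∊ f) →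
      BEx (trcl x) fun σ => OMap x m n f σ τ

def OMapLt (x m n N f g σ τ : M) : Prop := BEx (trcl x) fun σ' => BEx (trcl x) fun τ' =>
  OMap x m N f σ σ' ∧ OMap x n N g τ τ' ∧ OLt x N σ' τ'

@[fun_prop] theorem PR_OMapLt {x m n N f g σ τ : A → M} (hx : PR M x) (hm : PR M m) (hn : PR M n)
    (hN : PR M N) (hf : PR M f) (hg : PR M g) (hσ : PR M σ) (hτ : PR M τ) :
    PR M fun a => OMapLt (x a) (m a) (n a) (N a) (f a) (g a) (σ a) (τ a) := by
  unfold OMapLt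
  fun_prop

theorem oMapLt_iff {x m n N f g σ τ : M} :
    OMapLt x m n N f g σ τ ↔ (ofSet x).MapLt m n N f g σ τ := by
  constructor
  · rintro ⟨σ', -, τ', -, h⟩
    exact ⟨σ', τ', h⟩
  · rintro ⟨σ', τ', h⟩
    exact ⟨σ', (OMap.dom h.1).2.2.2.2, τ', (OMap.dom h.2.1).2.2.2.2, h⟩

theorem def_ofSet (x : M) : (ofSet x).Def := fun m n N σ τ => by
  simp only [← oMapLt_iff]
  fun_prop

def OTr (x σ n : M) : Prop := (ofSet x).Tr σ n

@[fun_prop] theorem PR_OTr {x σ n : A → M} (hx : PR M x) (hσ : PR M σ) (hn : PR M n) :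
    PR M fun a => OTr (x a) (σ a) (n a) := by
  show PR M fun a => OCar (x a) (n a) (σ a) ∧ OSupp (x a) (n a) (σ a) (n a)
  fun_prop

/-- bounded form of `SLead` -/
def BSLead (x σ n i : M) : Prop :=
  i ∊ n ∧ BAll om fun N => BAll homs fun f => BAll homs fun g => Hom n N f → Hom n N g →
    ap f i ∊ ap g i → OMapLt x n n N f g σ σ

@[fun_prop] theorem PR_BSLead {x σ n i : A → M} (hx : PR M x) (hσ : PR M σ) (hn : PR M n)
    (hi : PR M i) : PR M fun a => BSLead (x a) (σ a) (n a) (i a) := by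
  unfold BSLead
  fun_prop

theorem bSLead_iff {x σ n i : M} (hx : (ofSet x).IsPredilator) (hσ : (ofSet x).Tr σ n) :
    BSLead x σ n i ↔ (ofSet x).SLead σ n i := by
  refine and_congr_right fun _ => ⟨fun h N f g hf hg hlt => ?_, fun h N _ f _ g _ hf hg hlt => ?_⟩
  · have := h N hf.cod f hf.mem_Fin g hg.mem_Fin hf hg hlt
    rwa [oMapLt_iff, hx.mapLt_iff hf hg hσ.1 hσ.1] at this
  · rw [oMapLt_iff, hx.mapLt_iff hf hg hσ.1 hσ.1]
    exact h N f g hf hg hlt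

/-- A primitive recursive form of `Led`, which permits an induction along the codes of the iterates.
-/
def BLed (x : M) : Prop :=
  (BOrder x ∧ BMap x ∧ BFunct x ∧ BMono x ∧ BSupp x) ∧
  (BAll (trcl x) fun σ => BAll (trcl x) fun n => OTr x σ n → BEx n fun i => BSLead x σ n i) ∧
  BAll (trcl x) fun σ => BAll (trcl x) fun m => BAll m fun i => BAll (trcl x) fun τ =>
    BAll (trcl x) fun n => BAll n fun j => OTr x σ m → OTr x τ n → BSLead x σ m i →
      BSLead x τ n j → BAll om fun N => BAll homs fun f => BAll homs fun g => Hom m N f →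
        Hom n N g → ap f i ∊ ap g j → OMapLt x m n N f g σ τ

@[fun_prop] theorem PR_BOrder {x : A → M} (hx : PR M x) : PR M fun a => BOrder (x a) := by
  unfold BOrder
  fun_prop

@[fun_prop] theorem PR_BMap {x : A → M} (hx : PR M x) : PR M fun a => BMap (x a) := by
  unfold BMap
  fun_prop

@[fun_prop] theorem PR_BFunct {x : A → M} (hx : PR M x) : PR M fun a => BFunct (x a) := by
  unfold BFunct
  fun_prop

@[fun_prop] theorem PR_BMono {x : A → M} (hx : PR M x) : PR M fun a => BMono (x a) := by
  unfold BMono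
  fun_prop

@[fun_prop] theorem PR_BSupp {x : A → M} (hx : PR M x) : PR M fun a => BSupp (x a) := by
  unfold BSupp
  fun_prop

@[fun_prop] theorem PR_BLed {x : A → M} (hx : PR M x) : PR M fun a => BLed (x a) := by
  unfold BLed
  fun_prop

end PD

end PRS

/-! ### Correctness of the bounded forms -/

namespace PRS

namespace PD

variable {M : Type u} [PRSModel M] {A : Type*} [Enc M A]

theorem IsPredilator.bounded {x : M} (h : (ofSet x).IsPredilator) :
    BOrder x ∧ BMap x ∧ BFunct x ∧ BMono x ∧ BSupp x := by
  refine ⟨⟨?_, ?_, ?_, ?_, ?_⟩, ⟨?_, ?_, ?_⟩, ⟨?_, ?_⟩, ?_, ⟨?_, ?_, ?_, ?_⟩⟩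
  · exact fun n _ σ _ => h.car_dom n σ
  · exact fun n _ σ _ τ _ => h.lt_dom n σ τ
  · exact fun n hn σ _ => (h.linear n hn).1 σ
  · exact fun n hn σ _ τ _ ρ _ h1 h2 => (h.linear n hn).2.1 σ τ ρ (h.lt_dom _ _ _ h1).1
      (h.lt_dom _ _ _ h1).2 (h.lt_dom _ _ _ h2).2 h1 h2
  · exact fun n hn σ _ τ _ => (h.linear n hn).2.2 σ τ
  · exact fun m _ n _ f _ σ _ τ _ => h.map_dom m n f σ τ
  · intro m _ n _ f _ σ _ hf hσ
    obtain ⟨τ, hτ, hu⟩ := h.map_total m n f σ hf hσ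
    exact ⟨τ, (OMap.dom hτ).2.2.2.2, hτ, fun τ' _ h' => hu τ' h'⟩
  · exact fun m _ n _ f _ σ _ σ' _ τ _ τ' _ => h.map_lt m n f σ σ' τ τ'
  · exact fun n _ f _ σ _ => h.map_id n f σ
  · intro l _ m _ n _ f _ g _ k _ σ _ τ _ ρ _ hk hfg hf hg
    refine h.map_comp l m n f g k σ τ ρ hk (fun i j j' h1 h2 => ?_) hf hg
    have h3 := (h.map_dom _ _ _ _ _ hf).1
    have h4 := (h.map_dom _ _ _ _ _ hg).1
    have p1 := h3.pr_mem.1 h1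
    have p2 := h4.pr_mem.1 h2
    exact hfg i (trans_om _ _ h3.dom p1.1) j (trans_om _ _ h4.dom p2.1) j'
      (trans_om _ _ h4.cod (p2.2 ▸ h4.ap_mem p2.1)) h1 h2
  · intro m _ n _ f _ g _ σ _ τ _ τ' _ hfg hf hg
    refine h.monotone m n f g σ τ τ' (fun i j j' h1 h2 => ?_) hf hg
    have h3 := (h.map_dom _ _ _ _ _ hf).1
    have h4 := (h.map_dom _ _ _ _ _ hg).1
    have p1 := h3.pr_mem.1 h1
    have p2 := h4.pr_mem.1 h2
    exact hfg i (trans_om _ _ h3.dom p1.1) j (trans_om _ _ h3.cod (p1.2 ▸ h3.ap_mem p1.1)) j'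
      (trans_om _ _ h4.cod (p2.2 ▸ h4.ap_mem p2.1)) h1 h2
  · exact fun n _ σ _ a _ => h.supp_dom n σ a
  · intro n _ σ _ hσ
    obtain ⟨a, ha, hu⟩ := h.supp_total n σ hσ
    exact ⟨a, (OSupp.dom ha).2.2, ha, fun a' _ h' => hu a' h'⟩
  · exact fun m _ n _ f _ σ _ τ _ a _ b _ hf ha hb j _ => h.supp_nat m n f σ τ a b hf ha hb j
  · intro m _ n _ f _ τ _ b _ hf hb hj
    obtain ⟨σ, hσ⟩ := h.supp_range m n f τ b hf hb fun j hj' => by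
      obtain ⟨i, -, hi⟩ := hj j hj'
      exact ⟨i, hi⟩
    exact ⟨σ, (OMap.dom hσ).2.2.2.1, hσ⟩

theorem IsPredilator.of_bounded {x : M}
    (h : BOrder x ∧ BMap x ∧ BFunct x ∧ BMono x ∧ BSupp x) : (ofSet x).IsPredilator := by
  obtain ⟨⟨h1, h2, h3, h4, h5⟩, ⟨h6, h7, h8⟩, ⟨h9, h10⟩, h11, ⟨h12, h13, h14, h15⟩⟩ := h
  have md : ∀ {m n f σ τ}, OMap x m n f σ τ → Hom m n f ∧ OCar x m σ ∧ OCar x n τ := fun h => by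
    obtain ⟨a, b, c, d, e⟩ := h.dom
    exact h6 _ a _ b _ c _ d _ e h
  exact
  { car_dom := fun n σ h => h1 n (OCar.dom h).1 σ (OCar.dom h).2 h
    lt_dom := fun n σ τ h => h2 n (OLt.dom h).1 σ (OLt.dom h).2.1 τ (OLt.dom h).2.2 h
    map_dom := fun m n f σ τ h => md h
    supp_dom := fun n σ a h => h12 n (OSupp.dom h).1 σ (OSupp.dom h).2.1 a (OSupp.dom h).2.2 h
    linear := fun n hn => ⟨fun σ hσ => h3 n hn σ (OCar.dom hσ).2 hσ, fun σ τ ρ hσ hτ hρ =>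
      h4 n hn σ (OCar.dom hσ).2 τ (OCar.dom hτ).2 ρ (OCar.dom hρ).2, fun σ τ hσ hτ =>
      h5 n hn σ (OCar.dom hσ).2 τ (OCar.dom hτ).2 hσ hτ⟩
    map_total := fun m n f σ hf hσ => by
      obtain ⟨τ, -, h, hu⟩ := h7 m hf.dom n hf.cod f hf.mem_Fin σ (OCar.dom hσ).2 hf hσ
      exact ⟨τ, h, fun τ' h' => hu τ' (OMap.dom h').2.2.2.2 h'⟩
    map_lt := fun m n f σ σ' τ τ' h h' hlt => by
      obtain ⟨a, b, c, d, e⟩ := OMap.dom h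
      obtain ⟨-, -, -, d', e'⟩ := OMap.dom h'
      exact h8 _ a _ b _ c _ d _ d' _ e _ e' h h' hlt
    map_id := fun n f σ hf hid hσ => h9 n hf.dom f hf.mem_Fin σ (OCar.dom hσ).2 hf hid hσ
    map_comp := fun l m n f g k σ τ ρ hk hfg h h' => by
      obtain ⟨a, b, c, d, e⟩ := OMap.dom h
      obtain ⟨-, b', c', -, e'⟩ := OMap.dom h'
      exact h10 _ a _ b _ b' _ c _ c' _ hk.mem_Fin _ d _ e _ e' hk
        (fun i _ j _ j' _ => hfg i j j') h h'
    monotone := fun m n f g σ τ τ' hfg h h' => by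
      obtain ⟨a, b, c, d, e⟩ := OMap.dom h
      obtain ⟨-, -, c', -, e'⟩ := OMap.dom h'
      exact h11 _ a _ b _ c _ c' _ d _ e _ e' (fun i _ j _ j' _ => hfg i j j') h h'
    supp_total := fun n σ hσ => by
      obtain ⟨a, -, h, hu⟩ := h13 n (OCar.dom hσ).1 σ (OCar.dom hσ).2 hσ
      exact ⟨a, h, fun a' h' => hu a' (OSupp.dom h').2.2 h'⟩
    supp_nat := fun m n f σ τ s t h hs ht j => by
      obtain ⟨a, b, c, d, e⟩ := OMap.dom h
      have hj := h14 _ a _ b _ c _ d _ e _ (OSupp.dom hs).2.2 _ (OSupp.dom ht).2.2 h hs ht j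
      have hn := (md h).1.cod
      constructor
      · intro hjt
        exact (hj (trans_om _ _ hn ((h12 n (OSupp.dom ht).1 τ (OSupp.dom ht).2.1 t
          (OSupp.dom ht).2.2 ht).2 j hjt))).1 hjt
      · rintro ⟨i, hi, hij⟩
        have hf := (md h).1
        have p := hf.pr_mem.1 hij
        exact (hj (trans_om _ _ hn (p.2 ▸ hf.ap_mem p.1))).2 ⟨i, hi, hij⟩
    supp_range := fun m n f τ b hf hb hj => by
      obtain ⟨σ, -, h⟩ := h15 m hf.dom n (OSupp.dom hb).1 f hf.mem_Fin τ (OSupp.dom hb).2.1 b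
        (OSupp.dom hb).2.2 hf hb fun j hj' => by
          obtain ⟨i, hi⟩ := hj j hj'
          exact ⟨i, trans_om _ _ hf.dom (hf.pr_mem.1 hi).1, hi⟩
      exact ⟨σ, h⟩ }

theorem bLed_iff {x : M} : BLed x ↔ (ofSet x).Led := by
  constructor
  · rintro ⟨h, h1, h2⟩
    have hP := IsPredilator.of_bounded h
    have td : ∀ {σ n}, (ofSet x).Tr σ n → σ ∊ trcl x ∧ n ∊ trcl x := fun h =>
      ⟨(OCar.dom h.1).2, (OCar.dom h.1).1⟩
    refine ⟨hP, fun σ n hσ => ?_, fun σ m i τ n j hσ hτ hi hj N f g hf hg hlt => ?_⟩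
    · obtain ⟨i, -, hi⟩ := h1 σ (td hσ).1 n (td hσ).2 hσ
      exact ⟨i, (bSLead_iff hP hσ).1 hi⟩
    · have := h2 σ (td hσ).1 m (td hσ).2 i hi.1 τ (td hτ).1 n (td hτ).2 j hj.1 hσ hτ
        ((bSLead_iff hP hσ).2 hi) ((bSLead_iff hP hτ).2 hj) N hf.cod f hf.mem_Fin g hg.mem_Fin hf hg
        hlt
      rwa [oMapLt_iff, hP.mapLt_iff hf hg hσ.1 hτ.1] at this
  · rintro ⟨hP, h1, h2⟩
    refine ⟨hP.bounded, fun σ _ n _ hσ => ?_,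
      fun σ _ m _ i _ τ _ n _ j _ hσ hτ hi hj N _ f _ g _ hf hg hlt => ?_⟩
    · obtain ⟨i, hi⟩ := h1 σ n hσ
      exact ⟨i, hi.1, (bSLead_iff hP hσ).2 hi⟩
    · rw [oMapLt_iff, hP.mapLt_iff hf hg hσ.1 hτ.1]
      exact h2 σ m i τ n j hσ hτ ((bSLead_iff hP hσ).1 hi) ((bSLead_iff hP hτ).1 hj) N f g hf hg hlt

/-- The code determines the four relations outright. Hence an iterate given by its code is equal to
the predilator data obtained from the preceding one, and facts can be transferred by rewriting. -/
theorem IsCode.ofSet_eq {D : PD M} {y : M} (h : D.IsCode y) : ofSet y = D := by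
  obtain ⟨C, L, F, S, rfl, hC, hL, hF, hS⟩ := h
  have key : ∀ P : M → M → M → M → Prop,
      (∃ C' L' F' S', code C L F S = code C' L' F' S' ∧ P C' L' F' S') ↔ P C L F S := fun P => by
    constructor
    · rintro ⟨C', L', F', S', h, hP⟩
      simp only [code, pr_inj] at h
      obtain ⟨rfl, rfl, rfl, rfl⟩ := h
      exact hP
    · exact fun hP => ⟨_, _, _, _, rfl, hP⟩
  unfold ofSet
  simp only [key, hC, hL, hF, hS, pr_inj]
  congr 1
  · funext n σ
    refine propext ⟨?_, fun h => ⟨_, _, h, rfl, rfl⟩⟩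
    rintro ⟨_, _, h, rfl, rfl⟩
    exact h
  · funext n σ τ
    refine propext ⟨?_, fun h => ⟨_, _, _, h, rfl, rfl, rfl⟩⟩
    rintro ⟨_, _, _, h, rfl, rfl, rfl⟩
    exact h
  · funext m n f σ τ
    refine propext ⟨?_, fun h => ⟨_, _, _, _, _, h, rfl, rfl, rfl, rfl, rfl⟩⟩
    rintro ⟨_, _, _, _, _, h, rfl, rfl, rfl, rfl, rfl⟩
    exact h
  · funext n σ τ
    refine propext ⟨?_, fun h => ⟨_, _, _, h, rfl, rfl, rfl⟩⟩
    rintro ⟨_, _, _, h, rfl, rfl, rfl⟩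
    exact h

end PD

/-! ### The lexicographic order -/

variable {M : Type u} [PRSModel M] {A : Type*} [Enc M A]

/-- the set of pairs `(n, ξ)` with `n ∈ ω` and `ξ ∈ g(n)` -/
def lexSet (g : M) : M := iU om fun n => img (ap g n) fun ξ => pr n ξ

@[fun_prop] theorem PR_lexSet {g : A → M} (hg : PR M g) : PR M fun a => lexSet (g a) := by
  unfold lexSet
  fun_prop

theorem mem_lexSet {g z : M} : z ∊ lexSet g ↔ ∃ n ξ, n ∊ (om : M) ∧ ξ ∊ ap g n ∧ z = pr n ξ := by
  unfold lexSet
  rw [mem_iU (by fun_prop)]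
  constructor
  · rintro ⟨n, hn, h⟩
    obtain ⟨ξ, hξ, rfl⟩ := (mem_img (by fun_prop)).1 h
    exact ⟨n, ξ, hn, hξ, rfl⟩
  · rintro ⟨n, ξ, hn, hξ, rfl⟩
    exact ⟨n, hn, (mem_img (by fun_prop)).2 ⟨ξ, hξ, rfl⟩⟩

theorem pr_mem_lexSet {g n ξ : M} : pr n ξ ∊ lexSet g ↔ n ∊ (om : M) ∧ ξ ∊ ap g n := by
  rw [mem_lexSet]
  constructor
  · rintro ⟨n', ξ', hn, hξ, h⟩
    obtain ⟨rfl, rfl⟩ := pr_inj.1 h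
    exact ⟨hn, hξ⟩
  · exact fun h => ⟨n, ξ, h.1, h.2, rfl⟩

/-- the lexicographic order on the pairs `(n, ξ)` with `n ∈ ω` and `ξ ∈ g(n)` -/
def lex (g : M) : LO M where
  car z := z ∊ lexSet g
  lt z w := fst z ∊ fst w ∨ (fst z = fst w ∧ snd z ∊ snd w)

@[simp] theorem lex_car {g n ξ : M} : (lex g).car (pr n ξ) ↔ n ∊ (om : M) ∧ ξ ∊ ap g n :=
  pr_mem_lexSet

@[simp] theorem lex_lt {g n ξ m ζ : M} : (lex g).lt (pr n ξ) (pr m ζ) ↔ n ∊ m ∨ (n = m ∧ ξ ∊ ζ) := by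
  simp [lex]

theorem lex_dest {g z : M} (h : (lex g).car z) : ∃ n ξ, n ∊ (om : M) ∧ ξ ∊ ap g n ∧ z = pr n ξ :=
  mem_lexSet.1 h

theorem lex_good {g : M} (hg : ∀ n, n ∊ (om : M) → IsOrd (ap g n)) : (lex g).Good := by
  refine ⟨⟨lexSet g, fun x => Iff.rfl⟩, ?_, ?_, ?_, ?_⟩
  · show PR M fun p : M × M => fst p.1 ∊ fst p.2 ∨ (fst p.1 = fst p.2 ∧ snd p.1 ∊ snd p.2)
    fun_prop
  · intro x hx
    obtain ⟨n, ξ, hn, hξ, rfl⟩ := lex_dest hx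
    rw [lex_lt]
    rintro (h | ⟨-, h⟩) <;> exact notMem_self _ h
  · intro x y z hx hy hz hxy hyz
    obtain ⟨n, ξ, hn, hξ, rfl⟩ := lex_dest hx
    obtain ⟨m, ζ, hm, hζ, rfl⟩ := lex_dest hy
    obtain ⟨l, η, hl, hη, rfl⟩ := lex_dest hz
    rw [lex_lt] at *
    rcases hxy with h | ⟨rfl, h⟩ <;> rcases hyz with h' | ⟨rfl, h'⟩
    · exact Or.inl ((ord_nat hl).trans h' h)
    · exact Or.inl h
    · exact Or.inl h'
    · exact Or.inr ⟨rfl, ((hg n hn).mem hη).trans h' h⟩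
  · intro x y hx hy
    obtain ⟨n, ξ, hn, hξ, rfl⟩ := lex_dest hx
    obtain ⟨m, ζ, hm, hζ, rfl⟩ := lex_dest hy
    rw [lex_lt, lex_lt, pr_inj]
    rcases (ord_nat hn).trichotomy (ord_nat hm) with h | rfl | h
    · exact Or.inl (Or.inl h)
    · rcases ((hg n hn).mem hξ).trichotomy ((hg n hn).mem hζ) with h | rfl | h
      · exact Or.inl (Or.inr ⟨rfl, h⟩)
      · exact Or.inr (Or.inl ⟨rfl, rfl⟩)
      · exact Or.inr (Or.inr (Or.inr ⟨rfl, h⟩))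
    · exact Or.inr (Or.inr (Or.inl h))

/-! ### The extension to the lexicographic order, uniformly in the code -/

def LexEnum (g a k e : M) : Prop := (lex g).Enum a k e

@[fun_prop] theorem PR_LexEnum {g a k e : A → M} (hg : PR M g) (ha : PR M a) (hk : PR M k)
    (he : PR M e) : PR M (fun p => LexEnum (g p) (a p) (k p) (e p)) := by
  refine PR.congr (Q := fun p => k p ∊ om ∧ e p = gr (k p) (ap (e p)) ∧
    BAll (k p) (fun i => ap (e p) i ∊ lexSet (g p)) ∧
    BAll (k p) (fun i => BAll (k p) fun j => i ∊ j → (fst (ap (e p) i) ∊ fst (ap (e p) j) ∨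
      (fst (ap (e p) i) = fst (ap (e p) j) ∧ snd (ap (e p) i) ∊ snd (ap (e p) j)))) ∧
    a p = img (k p) (ap (e p))) (by fun_prop) fun p => ?_
  unfold LexEnum
  rw [LO.enum_iff]
  simp only [BAll, lex]
  grind

/-- a bound for the enumerations of finite subsets -/
def enums (g : M) : M := Fin (times om (lexSet g))

@[fun_prop] theorem PR_enums {g : A → M} (hg : PR M g) : PR M fun a => enums (g a) := by
  unfold enums
  fun_prop

theorem LexEnum.mem_enums {g a k e : M} (h : LexEnum g a k e) : e ∊ enums g :=
  LO.Enum.graph_mem_Fin h fun _ hx => LO.Enum.sub h hx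

/-- `z ∈ D(lex g)` for the predilator `D` that is coded by `x` -/
def XCar (g x z : M) : Prop := ((PD.ofSet x).ext (lex g)).car z

@[fun_prop] theorem PR_XCar {g x z : A → M} (hg : PR M g) (hx : PR M x) (hz : PR M z) :
    PR M fun a => XCar (g a) (x a) (z a) := by
  refine PR.congr (Q := fun a => z a = pr (fst (z a)) (snd (z a)) ∧ BEx om fun k =>
    BEx (enums (g a)) fun e => LexEnum (g a) (snd (z a)) k e ∧ PD.OTr (x a) (fst (z a)) k)
    (by fun_prop) fun a => ?_
  constructor
  · rintro ⟨σ, c, k, e, h, hE, hσ⟩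
    rw [h, fst_pr, snd_pr]
    exact ⟨rfl, k, hE.nat, e, LexEnum.mem_enums hE, hE, hσ⟩
  · rintro ⟨h, k, -, e, -, hE, hσ⟩
    exact ⟨_, _, k, e, h, hE, hσ⟩

/-- `z < w` in `D(lex g)` for the predilator `D` that is coded by `x` -/
def XLt (g x z w : M) : Prop := ((PD.ofSet x).ext (lex g)).lt z w

@[fun_prop] theorem PR_XLt {g x z w : A → M} (hg : PR M g) (hx : PR M x) (hz : PR M z)
    (hw : PR M w) : PR M fun a => XLt (g a) (x a) (z a) (w a) := by
  refine PR.congr (Q := fun p => z p = pr (fst (z p)) (snd (z p)) ∧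
    w p = pr (fst (w p)) (snd (w p)) ∧
    BEx om fun ka => BEx (enums (g p)) fun ea => BEx om fun kb => BEx (enums (g p)) fun eb =>
    BEx om fun kc => BEx (enums (g p)) fun ec => BEx PD.homs fun f => BEx PD.homs fun f' =>
      LexEnum (g p) (snd (z p)) ka ea ∧ LexEnum (g p) (snd (w p)) kb eb ∧
      LexEnum (g p) (union (snd (z p)) (snd (w p))) kc ec ∧ Hom ka kc f ∧ Hom kb kc f' ∧
      (BAll om fun i => BAll om fun j => BAll (lexSet (g p)) fun x =>
        pr i j ∊ f → pr i x ∊ ea → pr j x ∊ ec) ∧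
      (BAll om fun i => BAll om fun j => BAll (lexSet (g p)) fun x =>
        pr i j ∊ f' → pr i x ∊ eb → pr j x ∊ ec) ∧
      PD.OMapLt (x p) ka kb kc f f' (fst (z p)) (fst (w p)))
    (by fun_prop) fun p => ?_
  have bound : ∀ {m n f a e ec : M}, Hom m n f → LexEnum (g p) a m e →
      ((BAll om fun i => BAll om fun j => BAll (lexSet (g p)) fun x =>
        pr i j ∊ f → pr i x ∊ e → pr j x ∊ ec) ↔ ∀ i j x, pr i j ∊ f → pr i x ∊ e → pr j x ∊ ec) := by
    intro m n f a e ec hf hE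
    refine ⟨fun h i j x h1 h2 => ?_, fun h i _ j _ x _ => h i j x⟩
    have p1 := hf.pr_mem.1 h1
    have p2 := (LO.Enum.pr_mem hE).1 h2
    exact h i (trans_om _ _ hf.dom p1.1) j (trans_om _ _ hf.cod (p1.2 ▸ hf.ap_mem p1.1)) x
      (p2.2 ▸ LO.Enum.car hE p2.1) h1 h2
  constructor
  · rintro ⟨σ, a, τ, b, c, h1, h2, hc, ka, ea, kb, eb, kc, ec, f, f', ha, hb, hc', hf, hf', h3, h4, h5⟩
    rw [h1, h2, fst_pr, snd_pr, fst_pr, snd_pr]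
    have : c = union a b := ext fun y => by rw [hc, mem_union]
    rw [this] at hc'
    exact ⟨rfl, rfl, ka, ha.nat, ea, LexEnum.mem_enums ha, kb, hb.nat, eb, LexEnum.mem_enums hb, kc,
      hc'.nat, ec, LexEnum.mem_enums hc', f, hf.mem_Fin, f', hf'.mem_Fin, ha, hb, hc', hf, hf',
      (bound hf ha).2 h3, (bound hf' hb).2 h4, PD.oMapLt_iff.2 h5⟩
  · rintro ⟨h1, h2, ka, -, ea, -, kb, -, eb, -, kc, -, ec, -, f, -, f', -, ha, hb, hc, hf, hf', h3, h4,
      h5⟩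
    exact ⟨_, _, _, _, _, h1, h2, fun y => mem_union, ka, ea, kb, eb, kc, ec, f, f', ha, hb, hc, hf,
      hf', (bound hf ha).1 h3, (bound hf' hb).1 h4, PD.oMapLt_iff.1 h5⟩

/-- `y` is the leading argument of `z`, in terms of a code -/
def XLead (g x z y : M) : Prop := z = pr (fst z) (snd z) ∧ BEx om fun k => BEx (enums g) fun e =>
  BEx k fun i => LexEnum g (snd z) k e ∧ PD.OTr x (fst z) k ∧ PD.BSLead x (fst z) k i ∧ y = ap e i

@[fun_prop] theorem PR_XLead {g x z y : A → M} (hg : PR M g) (hx : PR M x) (hz : PR M z)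
    (hy : PR M y) : PR M fun a => XLead (g a) (x a) (z a) (y a) := by
  unfold XLead
  fun_prop

theorem xLead_iff {g x z y : M} (hx : (PD.ofSet x).Led) :
    XLead g x z y ↔ (PD.ofSet x).LArg (lex g) z y := by
  constructor
  · rintro ⟨hz, k, -, e, -, i, -, hE, hσ, hi, rfl⟩
    exact ⟨_, _, k, e, i, hz, hE, hσ, (PD.bSLead_iff hx.pred hσ).1 hi, rfl⟩
  · rintro ⟨σ, a, k, e, i, rfl, hE, hσ, hi, rfl⟩
    refine ⟨by rw [fst_pr, snd_pr], k, hE.nat, e, LexEnum.mem_enums hE, i, hi.1, ?_⟩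
    rw [fst_pr, snd_pr]
    exact ⟨hE, hσ, (PD.bSLead_iff hx.pred hσ).2 hi, rfl⟩

/-- A set bound for the elements of `D(lex g)`. The search for least candidates ranges over this
set. -/
theorem XCar.dom {g x z : M} (h : XCar g x z) : z ∊ times (trcl x) (Fin (lexSet g)) := by
  obtain ⟨σ, a, k, e, rfl, hE, hσ⟩ := h
  exact pr_mem_times.2 ⟨(PD.OCar.dom hσ.1).2, hE.mem_Fin fun y hy => hE.sub hy⟩

end PRS

namespace PRS

variable {M : Type u} [PRSModel M] {A : Type*} [Enc M A]

/-! ### Uniqueness of fixed points -/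

theorem ofOrd_enum_mono {α β a k e : M} (h : ∀ x, x ∊ α → x ∊ β) (hE : (LO.ofOrd α).Enum a k e) :
    (LO.ofOrd β).Enum a k e := by
  rw [LO.enum_iff] at *
  exact ⟨hE.1, hE.2.1, fun i hi => h _ (hE.2.2.1 i hi), hE.2.2.2⟩

namespace PD

variable {D : PD M}

theorem ext_ofOrd_mono_car {α β z : M} (h : ∀ x, x ∊ α → x ∊ β) (hz : (D.ext (LO.ofOrd α)).car z) :
    (D.ext (LO.ofOrd β)).car z := by
  obtain ⟨σ, a, k, e, rfl, hE, hσ⟩ := hz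
  exact ⟨σ, a, k, e, rfl, ofOrd_enum_mono h hE, hσ⟩

theorem ext_ofOrd_mono_lt {α β z w : M} (h : ∀ x, x ∊ α → x ∊ β)
    (hzw : (D.ext (LO.ofOrd α)).lt z w) : (D.ext (LO.ofOrd β)).lt z w := by
  obtain ⟨σ, a, τ, b, c, h1, h2, hc, ka, ea, kb, eb, kc, ec, f, g, ha, hb, hcE, r⟩ := hzw
  exact ⟨σ, a, τ, b, c, h1, h2, hc, ka, ea, kb, eb, kc, ec, f, g, ofOrd_enum_mono h ha,
    ofOrd_enum_mono h hb, ofOrd_enum_mono h hcE, r⟩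

theorem ext_ofOrd_car_of_sub {α β z : M} (hz : (D.ext (LO.ofOrd β)).car z)
    (h : ∀ x, x ∊ snd z → x ∊ α) : (D.ext (LO.ofOrd α)).car z := by
  obtain ⟨σ, a, k, e, rfl, hE, hσ⟩ := hz
  rw [snd_pr] at h
  refine ⟨σ, a, k, e, rfl, ?_, hσ⟩
  have hE' := LO.enum_iff.1 hE
  exact LO.enum_iff.2 ⟨hE'.1, hE'.2.1, fun i hi => h _ (hE.ap_mem hi), hE'.2.2.2⟩

theorem ext_ofOrd_lt_iff (hD : D.IsPredilator) {α β z w : M} (hα : IsOrd α) (hβ : IsOrd β)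
    (h : ∀ x, x ∊ α → x ∊ β) (hz : (D.ext (LO.ofOrd α)).car z) (hw : (D.ext (LO.ofOrd α)).car w) :
    (D.ext (LO.ofOrd β)).lt z w ↔ (D.ext (LO.ofOrd α)).lt z w := by
  have hl := hD.ext_linear (ofOrd_good hβ)
  have hz' := ext_ofOrd_mono_car h hz
  have hw' := ext_ofOrd_mono_car h hw
  refine ⟨fun hlt => ?_, ext_ofOrd_mono_lt h⟩
  rcases (hD.ext_linear (ofOrd_good hα)).2.2 z w hz hw with h1 | h1 | h1
  · exact h1
  · exact (hl.ne hz' hlt h1).elim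
  · exact (hl.asymm hz' hw' hlt (ext_ofOrd_mono_lt h h1)).elim

/-- Let `π` and `ρ` belong to the fixed points `α < β`. They agree on `α`, since a smaller value of
one at the first difference would be attained by the other at an earlier argument. Now `ρ(α)` has
support in `α` and exceeds the values at its support, so it is already of the form `π(η) = ρ(η)`
with `η < α`. This contradicts the strict monotonicity of `ρ`. -/
theorem psi_unique_aux (hD : D.IsPredilator) {α β : M} (hα : D.IsPsiFixedPoint α)
    (hβ : D.IsPsiFixedPoint β) : ¬ α ∊ β := by
  intro hlt
  obtain ⟨oα, π, hπ, hs, hr⟩ := hα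
  obtain ⟨oβ, ρ, hρ, hs', hr'⟩ := hβ
  have sub : ∀ x, x ∊ α → x ∊ β := fun x => oβ.trans hlt
  have lα := hD.ext_linear (ofOrd_good oα)
  have lβ := hD.ext_linear (ofOrd_good oβ)
  -- the elements in the range of the second embedding that have arguments below `α`
  have low : ∀ {ξ}, ξ ∊ β → (∀ x, x ∊ ξ → x ∊ α) → (D.ext (LO.ofOrd α)).car (ap ρ ξ) := by
    intro ξ hξ hξα
    have hc := hρ.car hξ
    obtain ⟨σ, a, h⟩ := IsPredilator.ext_car_dest hc
    refine ext_ofOrd_car_of_sub hc fun x hx => hξα x ?_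
    rw [h, snd_pr] at hx
    exact hs' x ξ σ a (hρ.pr_mem.2 ⟨hξ, h.symm⟩) hx
  have hsα : ∀ {ξ x}, ξ ∊ α → x ∊ snd (ap π ξ) → x ∊ ξ := by
    intro ξ x hξ hx
    obtain ⟨σ, a, h⟩ := IsPredilator.ext_car_dest (hπ.car hξ)
    rw [h, snd_pr] at hx
    exact hs x ξ σ a (hπ.pr_mem.2 ⟨hξ, h.symm⟩) hx
  have agree : ∀ ξ, ξ ∊ α → ap ρ ξ = ap π ξ := by
    refine oα.induct (P := fun ξ => ap ρ ξ = ap π ξ) (by fun_prop) fun ξ hξ ih => ?_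
    have hξα : ∀ x, x ∊ ξ → x ∊ α := fun x => oα.trans hξ
    have c1 := low (sub ξ hξ) hξα
    have c2 := hπ.car hξ
    rcases lα.2.2 _ _ c1 c2 with h | h | h
    · -- the smaller value is in the range of `π`, hence attained below `ξ`
      obtain ⟨σ, a, he⟩ := IsPredilator.ext_car_dest c1
      obtain ⟨η, hη⟩ := hr σ a (he ▸ c1) fun x z hx hz => by
        obtain ⟨hx', rfl⟩ := hπ.pr_mem.1 hz
        have hxξ := hs' x ξ σ a (hρ.pr_mem.2 ⟨sub ξ hξ, he.symm⟩) hx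
        rw [← ih x hxξ, ← he]
        have := hρ.lt (sub x hx') (sub ξ hξ) hxξ
        exact (ext_ofOrd_lt_iff hD oα oβ sub (by rw [ih x hxξ]; exact hπ.car hx') c1).1 this
      obtain ⟨hη, hη'⟩ := hπ.pr_mem.1 hη
      rw [he, hη'] at h
      have hηξ : η ∊ ξ := by
        rcases (oα.mem hη).trichotomy (oα.mem hξ) with h1 | h1 | h1
        · exact h1
        · rw [h1] at h
          exact (lα.1 _ c2 h).elim
        · exact (lα.asymm (hπ.car hη) c2 h (hπ.lt hξ hη h1)).elim
      have e1 := hρ.lt (sub η hη) (sub ξ hξ) hηξ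
      rw [ih η hηξ, he, hη'] at e1
      exact (lβ.1 _ (ext_ofOrd_mono_car sub (hπ.car hη)) e1).elim
    · exact h
    · obtain ⟨σ, a, he⟩ := IsPredilator.ext_car_dest c2
      have c2' := ext_ofOrd_mono_car sub c2
      obtain ⟨η, hη⟩ := hr' σ a (he ▸ c2') fun x z hx hz => by
        obtain ⟨hx', rfl⟩ := hρ.pr_mem.1 hz
        have hxξ := hs x ξ σ a (hπ.pr_mem.2 ⟨hξ, he.symm⟩) hx
        rw [ih x hxξ, ← he]
        exact ext_ofOrd_mono_lt sub (hπ.lt (hξα x hxξ) hξ hxξ)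
      obtain ⟨hη, hη'⟩ := hρ.pr_mem.1 hη
      rw [he, hη'] at h
      have h' := ext_ofOrd_mono_lt sub h
      have hηξ : η ∊ ξ := by
        rcases (oβ.mem hη).trichotomy (oα.mem hξ) with h1 | h1 | h1
        · exact h1
        · rw [h1] at h'
          exact (lβ.1 _ (hρ.car (sub ξ hξ)) h').elim
        · exact (lβ.asymm (hρ.car hη) (hρ.car (sub ξ hξ)) h' (hρ.lt (sub ξ hξ) hη h1)).elim
      have e1 := hπ.lt (hξα η hηξ) hξ hηξ
      rw [← ih η hηξ, he, hη'] at e1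
      have cη := low hη fun x hx => hξα x ((oα.mem hξ).trans hηξ hx)
      exact (lα.1 _ cη e1).elim
  -- The argument for agreement is applied once more at `α` itself, where only `ρ` is defined.
  have c1 := low hlt fun x hx => hx
  obtain ⟨σ, a, he⟩ := IsPredilator.ext_car_dest c1
  obtain ⟨η, hη⟩ := hr σ a (he ▸ c1) fun x z hx hz => by
    obtain ⟨hx', rfl⟩ := hπ.pr_mem.1 hz
    rw [← agree x hx', ← he]
    exact (ext_ofOrd_lt_iff hD oα oβ sub (by rw [agree x hx']; exact hπ.car hx') c1).1
      (hρ.lt (sub x hx') hlt hx')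
  obtain ⟨hη, hη'⟩ := hπ.pr_mem.1 hη
  have e1 := hρ.lt (sub η hη) hlt hη
  rw [agree η hη, he, hη'] at e1
  exact lβ.1 _ (ext_ofOrd_mono_car sub (hπ.car hη)) e1

theorem psi_unique (hD : D.IsPredilator) {α β : M} (hα : D.IsPsiFixedPoint α)
    (hβ : D.IsPsiFixedPoint β) : α = β := by
  rcases hα.1.trichotomy hβ.1 with h | h | h
  · exact (psi_unique_aux hD hα hβ h).elim
  · exact h
  · exact (psi_unique_aux hD hβ hα h).elim

end PD

theorem BAll_congr {x : M} {P Q : M → Prop} (h : ∀ z, z ∊ x → (P z ↔ Q z)) : BAll x P ↔ BAll x Q :=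
  forall_congr' fun z => imp_congr_right fun hz => h z hz

/-! ### Blocks -/

/-- `z` is an element of `D(lex g)` with leading argument in block `n`, all other arguments being in
the blocks `k, …, n`, or in block `n + 1` and bounded by `ξ` -/
def Cand (g x k n ξ z : M) : Prop :=
  XCar g x z ∧ (BEx (ap g n) fun ζ => XLead g x z (pr n ζ)) ∧
    BAll (snd z) fun y => (fst y ∊ suc n ∧ ¬ fst y ∊ k) ∨ (fst y = suc n ∧ snd y ∊ ξ)

@[fun_prop] theorem PR_Cand {g x k n ξ z : A → M} (hg : PR M g) (hx : PR M x) (hk : PR M k)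
    (hn : PR M n) (hξ : PR M ξ) (hz : PR M z) :
    PR M fun a => Cand (g a) (x a) (k a) (n a) (ξ a) (z a) := by
  unfold Cand
  fun_prop

/-- `h` is an increasing enumeration of the elements that `Cand` admits, in the manner of a
`ψ`-fixed point -/
def Blk (g x k n δ : M) (h : M → M) : Prop :=
  (BAll δ fun ξ => Cand g x k n ξ (h ξ)) ∧
  (BAll δ fun ξ => BAll ξ fun η => XLt g x (h η) (h ξ)) ∧
  BAll (times (trcl x) (Fin (lexSet g))) fun z => Cand g x k n δ z →
    (BAll δ fun α => pr (suc n) α ∊ snd z → XLt g x (h α) z) → BEx δ fun β => z = h β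

/-- The entry at `ξ` is the least candidate above all earlier entries, where arguments in block `n +
1` must be below `ξ`. The result depends on `x`, `k` and `n` in a primitive recursive way, which
replaces a choice of embeddings for infinitely many `n`. -/
theorem exists_blockFun (g : M) : ∃ F : M → M → M → M → M,
    PR M (fun p : ((M × M) × M) × M => F p.1.1.1 p.1.1.2 p.1.2 p.2) ∧ ∀ x k n ξ,
      F x k n ξ = sU (sep (times (trcl x) (Fin (lexSet g))) fun z =>
        (Cand g x k n ξ z ∧ BAll ξ fun η => XLt g x (F x k n η) z) ∧
        BAll (times (trcl x) (Fin (lexSet g))) fun w =>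
          (Cand g x k n ξ w ∧ BAll ξ fun η => XLt g x (F x k n η) w) → ¬ XLt g x w z) := by
  obtain ⟨F, hF, h⟩ := PR.recursion (M := M) (A := (M × M) × M)
    (G := fun p f ξ => sU (sep (times (trcl p.1.1) (Fin (lexSet g))) fun z =>
        (Cand g p.1.1 p.1.2 p.2 ξ z ∧ BAll ξ fun η => XLt g p.1.1 (ap f η) z) ∧
        BAll (times (trcl p.1.1) (Fin (lexSet g))) fun w =>
          (Cand g p.1.1 p.1.2 p.2 ξ w ∧ BAll ξ fun η => XLt g p.1.1 (ap f η) w) →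
            ¬ XLt g p.1.1 w z)) (by fun_prop)
  refine ⟨fun x k n => F ((x, k), n), ?_, fun x k n ξ => ?_⟩
  · exact hF
  · have hp : PR M (F ((x, k), n)) :=
      PR.const_left (f := fun p : ((M × M) × M) × M => F p.1 p.2) hF ((x, k), n)
    show F ((x, k), n) ξ = _
    conv_lhs => rw [h]
    have e : ∀ z, (BAll ξ fun η => XLt g x (ap (gr ξ (F ((x, k), n))) η) z) ↔
        BAll ξ fun η => XLt g x (F ((x, k), n) η) z := fun z =>
      BAll_congr fun η hη => by rw [ap_gr hp hη]
    simp only [e]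

/-- the function that lists the elements admitted by `Cand`, by recursion -/
def blockFun (g : M) : M → M → M → M → M := (exists_blockFun g).choose

@[fun_prop] theorem PR_blockFun (g : M) {x k n ξ : A → M} (hx : PR M x) (hk : PR M k) (hn : PR M n)
    (hξ : PR M ξ) : PR M fun a => blockFun g (x a) (k a) (n a) (ξ a) :=
  PR.comp (h := fun a => (((x a, k a), n a), ξ a)) (exists_blockFun g).choose_spec.1 (by fun_prop)

theorem blockFun_eq (g x k n ξ : M) : blockFun g x k n ξ =
    sU (sep (times (trcl x) (Fin (lexSet g))) fun z =>
      (Cand g x k n ξ z ∧ BAll ξ fun η => XLt g x (blockFun g x k n η) z) ∧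
      BAll (times (trcl x) (Fin (lexSet g))) fun w =>
        (Cand g x k n ξ w ∧ BAll ξ fun η => XLt g x (blockFun g x k n η) w) → ¬ XLt g x w z) :=
  (exists_blockFun g).choose_spec.2 x k n ξ

/-- By induction on `ξ`. If the lists agree below `ξ`, every admissible candidate at stage `ξ` is a
value of `h`, by the range condition in `Blk`, and its index is not below `ξ`. As `h` is increasing,
the least such candidate is `h ξ`. -/
theorem Blk.eq_blockFun {g x k n δ : M} {h : M → M} (hg : ∀ n, n ∊ (om : M) → IsOrd (ap g n))
    (hx : (PD.ofSet x).Led) (hδ : IsOrd δ) (hh : PR M h) (H : Blk g x k n δ h) :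
    ∀ ξ, ξ ∊ δ → blockFun g x k n ξ = h ξ := by
  refine hδ.induct (P := fun ξ => blockFun g x k n ξ = h ξ) (by fun_prop) fun ξ hξ ih => ?_
  obtain ⟨h1, h2, h3⟩ := H
  have hlin := hx.pred.ext_linear (lex_good hg)
  have e : ∀ z, (BAll ξ fun η => XLt g x (blockFun g x k n η) z) ↔ BAll ξ fun η => XLt g x (h η) z :=
    fun z => BAll_congr fun η hη => by rw [ih η hη]
  rw [blockFun_eq]
  simp only [e]
  -- the candidates are values of `h` on arguments that are not below `ξ`
  have key : ∀ w, Cand g x k n ξ w → (BAll ξ fun η => XLt g x (h η) w) →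
      ∃ β, β ∊ δ ∧ ¬ β ∊ ξ ∧ w = h β := by
    intro w hw hlt
    obtain ⟨β, hβ, rfl⟩ := h3 w hw.1.dom ⟨hw.1, hw.2.1, fun y hy => (hw.2.2 y hy).imp id
      fun h => ⟨h.1, hδ.trans hξ h.2⟩⟩ fun α _ hα => by
        refine hlt α ?_
        rcases hw.2.2 _ hα with h | h
        · rw [fst_pr] at h
          exact (notMem_self _ h.1).elim
        · rw [snd_pr] at h
          exact h.2
    exact ⟨β, hβ, fun hβξ => hlin.1 _ hw.1 (hlt β hβξ), rfl⟩
  refine sU_sep_unique (by fun_prop) (h1 ξ hξ).1.dom fun z => ?_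
  constructor
  · rintro ⟨⟨hz, hlt⟩, hmin⟩
    obtain ⟨β, hβ, hβξ, rfl⟩ := key z hz hlt
    rcases (hδ.mem hβ).trichotomy (hδ.mem hξ) with h | rfl | h
    · exact (hβξ h).elim
    · rfl
    · exact (hmin _ (h1 ξ hξ).1.dom ⟨h1 ξ hξ, h2 ξ hξ⟩ (h2 β hβ ξ h)).elim
  · rintro rfl
    refine ⟨⟨h1 ξ hξ, h2 ξ hξ⟩, fun w _ hw hlt => ?_⟩
    obtain ⟨β, hβ, hβξ, rfl⟩ := key w hw.1 hw.2
    rcases (hδ.mem hβ).trichotomy (hδ.mem hξ) with h | rfl | h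
    · exact hβξ h
    · exact hlin.1 _ hw.1.1 hlt
    · exact hlin.asymm hw.1.1 (h1 ξ hξ).1 hlt (h2 β hβ ξ h)

theorem Blk.congr {g x k n δ : M} {h h' : M → M} (H : Blk g x k n δ h) (hδ : IsOrd δ)
    (e : ∀ ξ, ξ ∊ δ → h' ξ = h ξ) : Blk g x k n δ h' := by
  obtain ⟨h1, h2, h3⟩ := H
  refine ⟨(BAll_congr fun ξ hξ => by rw [e ξ hξ]).2 h1, (BAll_congr fun ξ hξ => BAll_congr fun η hη =>
    by rw [e ξ hξ, e η (hδ.trans hξ hη)]).2 h2, fun z hz hc hlt => ?_⟩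
  obtain ⟨β, hβ, h⟩ := h3 z hz hc ((BAll_congr fun α hα => by rw [e α hα]).1 hlt)
  exact ⟨β, hβ, h.trans (e β hβ).symm⟩

end PRS

/-! ### Lists of elements with leading argument in a given block, along the iterates -/

namespace PRS

variable {M : Type u} [PRSModel M] {A : Type*} [Enc M A]

namespace LO

/-- the suborder of the elements with property `P` -/
def part (X : LO M) (P : M → Prop) : LO M where
  car x := X.car x ∧ P x
  lt := X.lt

variable {X : LO M} {P : M → Prop}

theorem part_good (hX : X.Good) (hP : PR M P) : (X.part P).Good := by
  obtain ⟨S, hS⟩ := hX.set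
  refine ⟨⟨sep S P, fun x => ?_⟩, hX.lt, fun x hx => hX.lin.1 x hx.1,
    fun x y z hx hy hz => hX.lin.2.1 x y z hx.1 hy.1 hz.1, fun x y hx hy => hX.lin.2.2 x y hx.1 hy.1⟩
  rw [mem_sep hP, ← hS]
  rfl

theorem enum_part {a k e : M} : (X.part P).Enum a k e ↔ X.Enum a k e ∧ ∀ x, x ∊ a → P x := by
  constructor
  · intro h
    have h' := enum_iff.1 h
    exact ⟨enum_iff.2 ⟨h'.1, h'.2.1, fun i hi => (h'.2.2.1 i hi).1, h'.2.2.2⟩, fun x hx => (h.sub hx).2⟩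
  · rintro ⟨h, hP⟩
    have h' := enum_iff.1 h
    exact enum_iff.2 ⟨h'.1, h'.2.1, fun i hi => ⟨h'.2.2.1 i hi, hP _ (h.ap_mem hi)⟩, h'.2.2.2⟩

theorem ext_part_car {D : PD M} {z : M} :
    (D.ext (X.part P)).car z ↔ (D.ext X).car z ∧ ∀ y, y ∊ snd z → P y := by
  constructor
  · rintro ⟨σ, a, k, e, rfl, hE, hσ⟩
    rw [snd_pr]
    exact ⟨⟨σ, a, k, e, rfl, (enum_part.1 hE).1, hσ⟩, (enum_part.1 hE).2⟩
  · rintro ⟨⟨σ, a, k, e, rfl, hE, hσ⟩, h⟩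
    rw [snd_pr] at h
    exact ⟨σ, a, k, e, rfl, enum_part.2 ⟨hE, h⟩, hσ⟩

theorem ext_part_lt {D : PD M} (hD : D.IsPredilator) (hX : X.Good) (hP : PR M P) {z w : M}
    (hz : (D.ext (X.part P)).car z) (hw : (D.ext (X.part P)).car w) :
    (D.ext (X.part P)).lt z w ↔ (D.ext X).lt z w := by
  obtain ⟨σ, a, rfl⟩ := PD.IsPredilator.ext_car_dest hz
  obtain ⟨τ, b, rfl⟩ := PD.IsPredilator.ext_car_dest hw
  have := hD.ext_image (part_good hX hP) hX (t := fun x => x) (by fun_prop) (fun x hx => hx.1)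
    (fun x y _ _ h => h) hz hw
  rwa [img_id (by fun_prop) fun _ _ => rfl, img_id (by fun_prop) fun _ _ => rfl, Iff.comm] at this

theorem larg_part {D : PD M} {z y : M} :
    D.LArg (X.part P) z y ↔ D.LArg X z y ∧ ∀ y, y ∊ snd z → P y := by
  constructor
  · rintro ⟨σ, a, k, e, i, rfl, hE, hσ, hi, rfl⟩
    rw [snd_pr]
    exact ⟨⟨σ, a, k, e, i, rfl, (enum_part.1 hE).1, hσ, hi, rfl⟩, (enum_part.1 hE).2⟩
  · rintro ⟨⟨σ, a, k, e, i, rfl, hE, hσ, hi, rfl⟩, h⟩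
    rw [snd_pr] at h
    exact ⟨σ, a, k, e, i, rfl, enum_part.2 ⟨hE, h⟩, hσ, hi, rfl⟩

end LO

theorem split_block {g n : M} (hg : ∀ n, n ∊ (om : M) → IsOrd (ap g n)) (hn : n ∊ om) :
    Split (ap g n) (LO.ofOrd (ap g (suc n))) (lex g) (fun ξ => pr n ξ) fun ξ => pr (suc n) ξ where
  ord := hg n hn
  hX := ofOrd_good (hg _ (suc_mem_om hn))
  hY := lex_good hg
  hu := by fun_prop
  hv := by fun_prop
  ucar ξ hξ := lex_car.2 ⟨hn, hξ⟩
  vcar ξ hξ := lex_car.2 ⟨suc_mem_om hn, hξ⟩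
  ult ξ η _ _ h := lex_lt.2 (Or.inr ⟨rfl, h⟩)
  vlt ξ η _ _ h := lex_lt.2 (Or.inr ⟨rfl, h⟩)
  uv ξ η _ _ := lex_lt.2 (Or.inl (mem_suc_self n))

/-- For the last iterate, the list is the fixed point embedding followed by `J`, where `γ(n)` and
`γ(n+1)` are mapped to the blocks `n` and `n + 1`. The conditions of a `ψ`-fixed point turn into
those of `Blk`, because `J` identifies the elements of `D_-` with those that have their leading
argument in block `n`. -/
theorem exists_blk_self {g x n : M} (hg : ∀ n, n ∊ (om : M) → IsOrd (ap g n))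
    (hx : (PD.ofSet x).Led) (hn : n ∊ om)
    (hfp : ((PD.ofSet x).minus (ap g n)).IsPsiFixedPoint (ap g (suc n))) :
    ∃ h, PR M h ∧ Blk g x n n (ap g (suc n)) h := by
  have H := split_block hg hn
  obtain ⟨hδ, π, hπ, hs, hr⟩ := hfp
  have hJ := H.PR_J
  have hcar : ∀ ξ, ξ ∊ ap g (suc n) → _ := fun ξ hξ => (H.minus_car hx).1 (hπ.car hξ)
  refine ⟨fun ξ => J (LO.ofOrd (ap g (suc n))) (fun ξ => pr n ξ) (fun ξ => pr (suc n) ξ) (ap π ξ),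
    by fun_prop, ?_, ?_, ?_⟩
  · intro ξ hξ
    obtain ⟨hz, ζ, hζ, hl⟩ := hcar ξ hξ
    refine ⟨H.J_car hz, ⟨ζ, hζ, (xLead_iff hx).2 hl⟩, fun y hy => ?_⟩
    rcases H.supp_cases hz hy with ⟨η, hη, rfl⟩ | ⟨η, hη, hη', rfl⟩
    · rw [fst_pr]
      exact Or.inl ⟨mem_suc_self n, notMem_self n⟩
    · rw [fst_pr, snd_pr]
      obtain ⟨σ, a, h⟩ := PD.IsPredilator.ext_car_dest hz
      rw [h, snd_pr] at hη'
      exact Or.inr ⟨rfl, hs η ξ σ a (hπ.pr_mem.2 ⟨hξ, h.symm⟩) hη'⟩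
  · intro ξ hξ η hη
    have hη' := hδ.trans hξ hη
    exact (H.minus_lt hx (hπ.car hη') (hπ.car hξ)).2 (hπ.lt hη' hξ hη)
  · intro z _ hz hlt
    obtain ⟨hzc, ⟨ζ, hζ, hl⟩, hsupp⟩ := hz
    rw [xLead_iff hx] at hl
    obtain ⟨w, hw, rfl⟩ := H.J_surj hzc fun y hy => by
      have hyc : (lex g).car y := by
        obtain ⟨σ, a, k, e, rfl, hE, -⟩ := hzc
        rw [snd_pr] at hy
        exact hE.sub hy
      obtain ⟨m, ξ, hm, hξ, rfl⟩ := lex_dest hyc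
      have := hsupp _ hy
      simp only [fst_pr, snd_pr] at this
      rcases this with ⟨h1, h2⟩ | ⟨rfl, h⟩
      · rcases mem_suc.1 h1 with h | rfl
        · exact (h2 h).elim
        · exact Or.inl ⟨ξ, hξ, rfl⟩
      · exact Or.inr ⟨ξ, h, rfl⟩
    have hw' := (H.minus_car hx).2 ⟨hw, ζ, hζ, hl⟩
    obtain ⟨σ, a, rfl⟩ := PD.IsPredilator.ext_car_dest hw
    obtain ⟨β, hβ⟩ := hr σ a hw' fun α z hα hz => by
      obtain ⟨hα', rfl⟩ := hπ.pr_mem.1 hz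
      refine (H.minus_lt hx (hπ.car hα') hw').1 (hlt α hα' ?_)
      refine (H.mem_supp_v hw hα').2 ?_
      rwa [snd_pr]
    obtain ⟨hβ, h⟩ := hπ.pr_mem.1 hβ
    exact ⟨β, hβ, by rw [h]⟩

theorem split_tail {g k : M} (hg : ∀ n, n ∊ (om : M) → IsOrd (ap g n)) (hk : k ∊ om) :
    Split (ap g k) ((lex g).part fun y => ¬ fst y ∊ suc k) (lex g) (fun ξ => pr k ξ) fun y => y where
  ord := hg k hk
  hX := LO.part_good (lex_good hg) (by fun_prop)
  hY := lex_good hg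
  hu := by fun_prop
  hv := by fun_prop
  ucar ξ hξ := lex_car.2 ⟨hk, hξ⟩
  vcar y hy := hy.1
  ult ξ η _ _ h := lex_lt.2 (Or.inr ⟨rfl, h⟩)
  vlt x y _ _ h := h
  uv ξ y _ hy := by
    obtain ⟨m, ζ, hm, hζ, rfl⟩ := lex_dest hy.1
    have := hy.2
    simp only [fst_pr] at this
    refine lex_lt.2 (Or.inl ?_)
    rcases (ord_nat hk).trichotomy (ord_nat hm) with h | rfl | h
    · exact h
    · exact (this (mem_suc_self _)).elim
    · exact (this (mem_suc.2 (Or.inl h))).elim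

/-- One separation of variables is undone: `J` adds block `k` to the admissible arguments, and the
blocks above `k` are kept in place. As `k < n`, having the leading argument in block `n` means to
lie in the `D_+` part, so no elements are lost. -/
theorem exists_blk_pred {g x y k n : M} (hg : ∀ n, n ∊ (om : M) → IsOrd (ap g n))
    (hx : (PD.ofSet x).Led) (hy : PD.ofSet y = (PD.ofSet x).plus (ap g k)) (hk : k ∊ om)
    (hn : n ∊ om) (hkn : k ∊ n) {h : M → M} (hh : PR M h)
    (H : Blk g y (suc k) n (ap g (suc n)) h) :
    ∃ h', PR M h' ∧ Blk g x k n (ap g (suc n)) h' := by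
  have S := split_tail hg hk
  have hδ := hg _ (suc_mem_om hn)
  have hW := lex_good hg
  have hy' : (PD.ofSet y).Led := hy ▸ hx.plus (hg k hk)
  have hP : PR M fun y : M => ¬ fst y ∊ suc k := by fun_prop
  obtain ⟨H1, H2, H3⟩ := H
  have hJ := S.PR_J
  have nk : ¬ n ∊ suc k := fun h => by
    rcases mem_suc.1 h with h | rfl
    · exact (ord_nat hk).asymm h hkn
    · exact notMem_self _ hkn
  have nk' : ¬ suc n ∊ suc k := fun h => nk ((ord_nat (suc_mem_om hk)).trans h (mem_suc_self n))
  have part_car : ∀ {ξ z}, Cand g y (suc k) n ξ z →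
      (((PD.ofSet x).plus (ap g k)).ext ((lex g).part fun y => ¬ fst y ∊ suc k)).car z := by
    intro ξ z hz
    rw [← hy]
    refine LO.ext_part_car.2 ⟨hz.1, fun w hw => ?_⟩
    rcases hz.2.2 w hw with h | h
    · exact h.2
    · rw [h.1]
      exact nk'
  refine ⟨fun ξ => J ((lex g).part fun y => ¬ fst y ∊ suc k) (fun ξ => pr k ξ) (fun y => y) (h ξ),
    by fun_prop, ?_, ?_, ?_⟩
  · intro ξ hξ
    have hc := H1 ξ hξ
    have hz := part_car hc
    have hz' := ((S.plus_car hx).1 hz).1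
    obtain ⟨hc1, ⟨ζ, hζ, hl⟩, hs⟩ := hc
    rw [xLead_iff hy'] at hl
    refine ⟨S.J_car hz', ⟨ζ, hζ, (xLead_iff hx).2 (S.plus_larg hx (X := _) ?_)⟩, fun w hw => ?_⟩
    · rw [← hy] at hz ⊢
      exact LO.larg_part.2 ⟨hl, (LO.ext_part_car.1 hz).2⟩
    · rcases S.supp_cases hz' hw with ⟨η, hη, rfl⟩ | ⟨w, hw1, hw2, rfl⟩
      · rw [fst_pr]
        exact Or.inl ⟨mem_suc.2 (Or.inl hkn), notMem_self k⟩
      · exact (hs w hw2).imp (fun h => ⟨h.1, fun h' => h.2 (mem_suc.2 (Or.inl h'))⟩) id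
  · intro ξ hξ η hη
    have hη' := hδ.trans hξ hη
    have c1 := part_car (H1 ξ hξ)
    have c2 := part_car (H1 η hη')
    refine (S.plus_ext_lt hx c2 c1).2 ?_
    rw [← hy] at c1 c2 ⊢
    exact (LO.ext_part_lt hy'.pred hW hP c2 c1).2 (H2 ξ hξ η hη)
  · intro z _ hz hlt
    obtain ⟨hzc, ⟨ζ, hζ, hl⟩, hsupp⟩ := hz
    rw [xLead_iff hx] at hl
    obtain ⟨w, hw, rfl⟩ := S.J_surj hzc fun y hy => by
      have hyc : (lex g).car y := by
        obtain ⟨σ, a, k, e, rfl, hE, -⟩ := hzc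
        rw [snd_pr] at hy
        exact hE.sub hy
      obtain ⟨m, ξ, hm, hξ, rfl⟩ := lex_dest hyc
      have hs := hsupp _ hy
      by_cases hmk : m = k
      · subst hmk
        exact Or.inl ⟨ξ, hξ, rfl⟩
      · refine Or.inr ⟨_, ⟨hyc, ?_⟩, rfl⟩
        simp only [fst_pr] at hs ⊢
        rcases hs with h | h
        · exact fun h' => (mem_suc.1 h').elim h.2 hmk
        · rw [h.1]
          exact nk'
    have hX : ((lex g).part fun y => ¬ fst y ∊ suc k).car (pr n ζ) :=
      ⟨lex_car.2 ⟨hn, hζ⟩, by simp only [fst_pr]; exact nk⟩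
    -- The leading argument lies in block `n`, hence in the tail above block `k`. So the preimage
    -- under `J` is an element for the next iterate.
    have hw' := (S.plus_car hx).2 ⟨hw, _, hX, hl⟩
    have hl' := (S.plus_larg_iff hx hw' hX).2 hl
    have hw2 := hw'
    rw [← hy] at hl' hw2
    have hwy := LO.ext_part_car.1 hw2
    have hsub : ∀ {y}, y ∊ snd w → ((lex g).part fun y => ¬ fst y ∊ suc k).car y := fun {y} h => by
      refine ⟨?_, hwy.2 y h⟩
      obtain ⟨σ, a, k', e, rfl, hE, -⟩ := hwy.1
      rw [snd_pr] at h
      exact hE.sub h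
    obtain ⟨β, hβ, rfl⟩ := H3 w (XCar.dom hwy.1) ⟨hwy.1,
      ⟨ζ, hζ, (xLead_iff hy').2 (LO.larg_part.1 hl').1⟩, fun y h => by
        have h1 := hsub h
        have := hsupp y ((S.mem_supp_v hw h1).2 h)
        exact this.imp (fun h => ⟨h.1, h1.2⟩) id⟩ fun α hα hm => by
          have c1 := part_car (H1 α hα)
          have := (S.plus_ext_lt hx c1 hw').1 (hlt α hα ((S.mem_supp_v hw (hsub hm)).2 hm))
          rw [← hy] at this c1
          exact (LO.ext_part_lt hy'.pred hW hP c1 hw2).1 this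
    exact ⟨β, hβ, rfl⟩

/-- The list for block `n` is carried from the `n`-th iterate down to `D`. After each step the list
is replaced by `blockFun`; only then is the statement a primitive recursive property of `k`, to
which induction applies. -/
theorem blk_blockFun {d g : M} (hg : ∀ n, n ∊ (om : M) → IsOrd (ap g n)) (hd : (PD.ofSet d).Led)
    {n s e : M} (hn : n ∊ om) (hs : IsSeq s (suc n)) (hs0 : pr emp d ∊ s) (hse : pr n e ∊ s)
    (hsuc : ∀ k x y c, k ∊ n → pr k x ∊ s → pr (suc k) y ∊ s → pr k c ∊ g →
      ((PD.ofSet x).plus c).IsCode y) (hgs : ∀ k, k ∊ (om : M) → pr k (ap g k) ∊ g)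
    (hfp : ((PD.ofSet e).minus (ap g n)).IsPsiFixedPoint (ap g (suc n))) :
    Blk g d emp n (ap g (suc n)) (blockFun g d emp n) := by
  have hδ := hg _ (suc_mem_om hn)
  have hsn := suc_mem_om hn
  have ap_s : ∀ {k y}, pr k y ∊ s → k ∊ suc n → ap s k = y := fun {k y} h hk => by
    obtain ⟨z, hz, hu⟩ := hs.2 k hk
    refine ap_eq h fun w hw => ?_
    rw [hu w hw, hu y h]
  have mem_s : ∀ {k}, k ∊ suc n → pr k (ap s k) ∊ s := fun {k} hk => by
    obtain ⟨z, hz, hu⟩ := hs.2 k hk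
    rwa [ap_s hz hk]
  have low : ∀ {k}, suc k ∊ suc n → k ∊ n := fun {k} h => by
    rcases mem_suc.1 h with h | h
    · exact (ord_nat hn).trans h (mem_suc_self k)
    · rw [← h]
      exact mem_suc_self k
  have step : ∀ {k}, k ∊ om → suc k ∊ suc n →
      PD.ofSet (ap s (suc k)) = (PD.ofSet (ap s k)).plus (ap g k) := fun {k} hk h =>
    (hsuc k _ _ _ (low h) (mem_s (mem_suc.2 (Or.inl (low h)))) (mem_s h) (hgs k hk)).ofSet_eq
  have s0 : ap s emp = d := ap_s hs0 (emp_mem_suc hn)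
  have sn : ap s n = e := ap_s hse (mem_suc_self n)
  -- The induction is carried out for the bounded form, since the unbounded one is not evidently
  -- primitive recursive.
  have led : ∀ k, k ∊ om → k ∊ suc n → (PD.ofSet (ap s k)).Led := by
    have : ∀ k, k ∊ om → k ∊ suc n → PD.BLed (ap s k) := by
      refine nat_induct (by fun_prop) (fun _ => by rw [s0]; exact PD.bLed_iff.2 hd) fun k hk ih h => ?_
      rw [PD.bLed_iff, step hk h]
      exact (PD.bLed_iff.1 (ih (mem_suc.2 (Or.inl (low h))))).plus (hg k hk)
    exact fun k hk h => PD.bLed_iff.1 (this k hk h)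
  have fin : ∀ {k} {h : M → M}, k ∊ om → k ∊ suc n → PR M h → Blk g (ap s k) k n (ap g (suc n)) h →
      Blk g (ap s k) k n (ap g (suc n)) (blockFun g (ap s k) k n) := fun hk hk' hh H =>
    H.congr hδ (H.eq_blockFun hg (led _ hk hk') hδ hh)
  have last : Blk g (ap s n) n n (ap g (suc n)) (blockFun g (ap s n) n n) := by
    obtain ⟨h, hh, H⟩ := exists_blk_self hg (led n hn (mem_suc_self n)) hn (sn ▸ hfp)
    exact fin hn (mem_suc_self n) hh H
  -- Downward induction in contrapositive form: a failure at `0` would propagate upwards to `n`.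
  by_contra h0
  have : ∀ k, k ∊ om → k ∊ suc n →
      ¬ Blk g (ap s k) k n (ap g (suc n)) (blockFun g (ap s k) k n) := by
    refine nat_induct (by unfold Blk; fun_prop) (fun _ => by rwa [s0]) fun k hk ih h H => ?_
    have hk' : k ∊ suc n := mem_suc.2 (Or.inl (low h))
    obtain ⟨h', hh', H'⟩ := exists_blk_pred hg (led k hk hk') (step hk h) hk hn (low h)
      (by fun_prop) H
    exact ih hk' (fin hk hk' hh' H')
  exact this n hn (mem_suc_self n) last

end PRS

namespace PRS

variable {M : Type u} [PRSModel M] {A : Type*} [Enc M A]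

/-! ### Infinite sums of ordinals -/

theorem exists_psum (g : M) : ∃ F : M → M, PR M F ∧
    ∀ n, F n = iU n fun m => oadd (F m) (ap g (suc m)) := by
  obtain ⟨F, hF, h⟩ := PR.recursion (M := M) (A := M)
    (G := fun g f n => iU n fun m => oadd (ap f m) (ap g (suc m))) (by fun_prop)
  have hp : PR M (F g) := PR.const_left (f := fun p : M × M => F p.1 p.2) hF g
  refine ⟨F g, hp, fun n => ?_⟩
  rw [h]
  refine ext fun z => ?_
  rw [mem_iU (by fun_prop), mem_iU (by fun_prop)]
  exact exists_congr fun m => and_congr_right fun hm => by rw [ap_gr hp hm]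

/-- the sum of the ordinals `g(m + 1)` for `m < n` -/
def psum (g : M) : M → M := (exists_psum g).choose

@[fun_prop] theorem PR_psum (g : M) {n : A → M} (hn : PR M n) : PR M fun a => psum g (n a) :=
  PR.comp (exists_psum g).choose_spec.1 hn

theorem mem_psum {g n z : M} : z ∊ psum g n ↔ ∃ m, m ∊ n ∧ z ∊ oadd (psum g m) (ap g (suc m)) := by
  have h := (exists_psum g).choose_spec.2 n
  change psum g n = iU n fun m => oadd (psum g m) (ap g (suc m)) at h
  rw [h, mem_iU (by fun_prop)]

theorem psum_suc (g n : M) : psum g (suc n) = oadd (psum g n) (ap g (suc n)) := by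
  refine ext fun z => ?_
  rw [mem_psum]
  constructor
  · rintro ⟨m, hm, hz⟩
    rcases mem_suc.1 hm with h | rfl
    · exact mem_oadd_left (mem_psum.2 ⟨m, h, hz⟩)
    · exact hz
  · exact fun hz => ⟨n, mem_suc_self n, hz⟩

@[fun_prop] theorem PR_IsOrd {f : A → M} (hf : PR M f) : PR M fun a => IsOrd (f a) := by
  refine PR.congr (Q := fun a => (BAll (f a) fun y => BAll y fun z => z ∊ f a) ∧
    BAll (f a) fun b => BAll b fun y => BAll y fun z => z ∊ b) (by fun_prop) fun a => ?_
  exact ⟨fun h => ⟨fun y hy z hz => h.1 y z hy hz, fun b hb y hy z hz => h.2 b hb y z hy hz⟩,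
    fun h => ⟨fun y z hy hz => h.1 y hy z hz, fun b hb y z hy hz => h.2 b hb y hy z hz⟩⟩

section Sum

variable {g : M} (hg : ∀ n, n ∊ (om : M) → IsOrd (ap g n))
include hg

theorem ord_psum : ∀ n, n ∊ om → IsOrd (psum g n) := by
  refine nat_induct (by fun_prop) ?_ fun n hn ih => ?_
  · rw [eq_emp (x := psum g emp) fun z hz => ?_]
    · exact ord_emp
    · obtain ⟨m, hm, -⟩ := mem_psum.1 hz
      exact notMem_emp hm
  · rw [psum_suc]
    exact ord_oadd ih (hg _ (suc_mem_om hn))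

theorem ord_psum_om : IsOrd (psum g om) := by
  have key : ∀ {z}, z ∊ psum g om → ∃ n, n ∊ (om : M) ∧ z ∊ psum g (suc n) := fun {z} hz => by
    obtain ⟨n, hn, h⟩ := mem_psum.1 hz
    exact ⟨n, hn, by rwa [psum_suc]⟩
  refine ⟨fun y z hy hz => ?_, fun b hb => ?_⟩
  · obtain ⟨n, hn, h⟩ := key hy
    have := (ord_psum hg _ (suc_mem_om hn)).trans h hz
    rw [psum_suc] at this
    exact mem_psum.2 ⟨n, hn, this⟩
  · obtain ⟨n, hn, h⟩ := key hb
    exact ((ord_psum hg _ (suc_mem_om hn)).mem h).1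

-- Each element of the infinite sum belongs to a unique summand. It is found via the least `n` for
-- which the element lies below the `(n+1)`-st partial sum.
omit hg in
theorem mem_psum_om {z : M} : z ∊ psum g om ↔
    ∃ n ξ, n ∊ (om : M) ∧ ξ ∊ ap g (suc n) ∧ z = oadd (psum g n) ξ := by
  rw [mem_psum]
  constructor
  · rintro ⟨n, hn, hz⟩
    obtain ⟨m, hm, hP, hmin⟩ := exists_minimal (x := om) (y := n)
      (P := fun n => z ∊ oadd (psum g n) (ap g (suc n))) (by fun_prop) hn hz
    rcases mem_oadd.1 hP with h | ⟨ξ, hξ, h⟩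
    · obtain ⟨l, hl, h⟩ := mem_psum.1 h
      exact (hmin l hl (trans_om _ _ hm hl) h).elim
    · exact ⟨m, ξ, hm, hξ, h⟩
  · rintro ⟨n, ξ, hn, hξ, rfl⟩
    exact ⟨n, hn, oadd_mem hξ⟩

omit hg in
theorem psum_lt {m n ξ ζ : M} (hmn : m ∊ n) (hξ : ξ ∊ ap g (suc m)) :
    oadd (psum g m) ξ ∊ oadd (psum g n) ζ :=
  mem_oadd_left (mem_psum.2 ⟨m, hmn, oadd_mem hξ⟩)

theorem psum_inj {m n ξ ζ : M} (hm : m ∊ om) (hn : n ∊ om) (hξ : ξ ∊ ap g (suc m))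
    (hζ : ζ ∊ ap g (suc n)) (h : oadd (psum g m) ξ = oadd (psum g n) ζ) : m = n ∧ ξ = ζ := by
  rcases (ord_nat hm).trichotomy (ord_nat hn) with hlt | rfl | hlt
  · have := psum_lt (ζ := ζ) hlt hξ
    rw [h] at this
    exact (notMem_self _ this).elim
  · exact ⟨rfl, oadd_inj ((hg _ (suc_mem_om hm)).mem hξ) ((hg _ (suc_mem_om hm)).mem hζ) h⟩
  · have := psum_lt (ζ := ξ) hlt hζ
    rw [h] at this
    exact (notMem_self _ this).elim

theorem psum_lt_iff {m n ξ ζ : M} (hm : m ∊ om) (hn : n ∊ om) (hξ : ξ ∊ ap g (suc m))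
    (hζ : ζ ∊ ap g (suc n)) :
    oadd (psum g m) ξ ∊ oadd (psum g n) ζ ↔ m ∊ n ∨ (m = n ∧ ξ ∊ ζ) := by
  constructor
  · intro h
    rcases (ord_nat hm).trichotomy (ord_nat hn) with hlt | rfl | hlt
    · exact Or.inl hlt
    · exact Or.inr ⟨rfl, (oadd_mem_iff ((hg _ (suc_mem_om hm)).mem hξ)
        ((hg _ (suc_mem_om hm)).mem hζ)).1 h⟩
    · exact (((ord_psum_om hg).mem (mem_psum_om.2 ⟨m, ξ, hm, hξ, rfl⟩)).asymm (psum_lt hlt hζ) h).elim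
  · rintro (h | ⟨rfl, h⟩)
    · exact psum_lt h hξ
    · exact oadd_mem h

theorem isOrdSum_psum (hgs : IsSeq g om) (hap : ∀ n, n ∊ (om : M) → pr n (ap g n) ∊ g) :
    IsOrdSum g (psum g om) := by
  refine ⟨ord_psum_om hg, ?_⟩
  let L : M := iU om fun n => img (ap g (suc n)) fun ξ => pr n ξ
  have hL : ∀ z, (lexSum g).car z ↔ z ∊ L := fun z => by
    show _ ↔ z ∊ iU om fun n => img (ap g (suc n)) fun ξ => pr n ξ
    rw [mem_iU (by fun_prop)]
    constructor
    · rintro ⟨n, ξ, c, hn, hc, hξ, rfl⟩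
      obtain ⟨y, -, hu⟩ := hgs.2 (suc n) (suc_mem_om hn)
      rw [hu c hc, ← hu _ (hap _ (suc_mem_om hn))] at hξ
      exact ⟨n, hn, (mem_img (by fun_prop)).2 ⟨ξ, hξ, rfl⟩⟩
    · rintro ⟨n, hn, h⟩
      obtain ⟨ξ, hξ, rfl⟩ := (mem_img (by fun_prop)).1 h
      exact ⟨n, ξ, _, hn, hap _ (suc_mem_om hn), hξ, rfl⟩
  have hd : ∀ {z}, z ∊ L → ∃ n ξ, n ∊ (om : M) ∧ ξ ∊ ap g (suc n) ∧ z = pr n ξ := fun {z} hz => by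
    obtain ⟨n, hn, h⟩ := (mem_iU (by fun_prop)).1 hz
    obtain ⟨ξ, hξ, rfl⟩ := (mem_img (by fun_prop)).1 h
    exact ⟨n, ξ, hn, hξ, rfl⟩
  have hf : PR M fun z => oadd (psum g (fst z)) (snd z) := by fun_prop
  have hE : (lexSum g).Emb (LO.ofOrd (psum g om)) (gr L fun z => oadd (psum g (fst z)) (snd z)) := by
    refine (LO.emb_iff hL).2 ⟨ext fun z => ?_, fun x hx => ?_, fun x x' hx hx' hlt => ?_⟩
    · rw [mem_gr hf, mem_gr (by fun_prop)]
      exact exists_congr fun v => and_congr_right fun hv => by rw [ap_gr hf hv]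
    · rw [ap_gr hf hx]
      obtain ⟨n, ξ, hn, hξ, rfl⟩ := hd hx
      rw [fst_pr, snd_pr]
      exact mem_psum_om.2 ⟨n, ξ, hn, hξ, rfl⟩
    · rw [ap_gr hf hx, ap_gr hf hx']
      obtain ⟨n, ξ, hn, hξ, rfl⟩ := hd hx
      obtain ⟨m, ζ, hm, hζ, rfl⟩ := hd hx'
      obtain ⟨n', ξ', m', ζ', h1, h2, h⟩ := hlt
      obtain ⟨rfl, rfl⟩ := pr_inj.1 h1
      obtain ⟨rfl, rfl⟩ := pr_inj.1 h2
      simp only [fst_pr, snd_pr]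
      exact (psum_lt_iff hg hn hm hξ hζ).2 h
  refine ⟨_, hE, fun y hy => ?_⟩
  obtain ⟨n, ξ, hn, hξ, rfl⟩ := mem_psum_om.1 hy
  refine ⟨pr n ξ, (pr_mem_gr hf).2 ⟨(hL _).1 ⟨n, ξ, _, hn, hap _ (suc_mem_om hn), hξ, rfl⟩, ?_⟩⟩
  rw [fst_pr, snd_pr]

/-- the isomorphism from the sum of the `g(n + 1)` onto the blocks with positive index -/
def blockOf (g z : M) : M := sU (sep (lexSet g) fun y => y ∊ lexSet g ∧
  BEx om fun n => y = pr (suc n) (snd y) ∧ z = oadd (psum g n) (snd y))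

omit hg in
@[fun_prop] theorem PR_blockOf (g : M) {z : A → M} (hz : PR M z) : PR M fun a => blockOf g (z a) := by
  unfold blockOf
  fun_prop

/-- The summand with index `n` corresponds to block `n + 1`, since block `0` is reserved for `γ`. -/
theorem blockOf_eq {n ξ : M} (hn : n ∊ om) (hξ : ξ ∊ ap g (suc n)) :
    blockOf g (oadd (psum g n) ξ) = pr (suc n) ξ := by
  have hm : pr (suc n) ξ ∊ lexSet g := pr_mem_lexSet.2 ⟨suc_mem_om hn, hξ⟩
  refine sU_sep_unique (by fun_prop) hm fun y => ?_
  constructor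
  · rintro ⟨hy, m, hm, h1, h2⟩
    rw [h1, pr_mem_lexSet] at hy
    obtain ⟨rfl, h⟩ := psum_inj hg hn hm hξ hy.2 h2
    rw [h1, ← h]
  · rintro rfl
    rw [snd_pr]
    exact ⟨hm, n, hn, rfl, rfl⟩

theorem split_sum : Split (ap g emp) (LO.ofOrd (psum g om)) (lex g) (fun ξ => pr emp ξ)
    (blockOf g) where
  ord := hg _ emp_mem_om
  hX := ofOrd_good (ord_psum_om hg)
  hY := lex_good hg
  hu := by fun_prop
  hv := by fun_prop
  ucar ξ hξ := lex_car.2 ⟨emp_mem_om, hξ⟩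
  vcar x hx := by
    obtain ⟨n, ξ, hn, hξ, rfl⟩ := mem_psum_om.1 hx
    rw [blockOf_eq hg hn hξ]
    exact lex_car.2 ⟨suc_mem_om hn, hξ⟩
  ult ξ η _ _ h := lex_lt.2 (Or.inr ⟨rfl, h⟩)
  vlt x y hx hy hxy := by
    obtain ⟨n, ξ, hn, hξ, rfl⟩ := mem_psum_om.1 hx
    obtain ⟨m, ζ, hm, hζ, rfl⟩ := mem_psum_om.1 hy
    rw [blockOf_eq hg hn hξ, blockOf_eq hg hm hζ, lex_lt]
    rcases (psum_lt_iff hg hn hm hξ hζ).1 hxy with h | ⟨h, h'⟩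
    · exact Or.inl (suc_mem_suc (ord_nat hm) h)
    · exact Or.inr ⟨by rw [h], h'⟩
  uv ξ x _ hx := by
    obtain ⟨n, ζ, hn, hζ, rfl⟩ := mem_psum_om.1 hx
    rw [blockOf_eq hg hn hζ]
    exact lex_lt.2 (Or.inl (emp_mem_suc hn))

theorem blocks_cases {y : M} (hy : (lex g).car y) :
    (∃ ξ, ξ ∊ ap g emp ∧ y = pr emp ξ) ∨ ∃ x, x ∊ psum g om ∧ y = blockOf g x := by
  obtain ⟨n, ξ, hn, hξ, rfl⟩ := lex_dest hy
  rcases mem_om.1 hn with rfl | ⟨m, hm, rfl⟩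
  · exact Or.inl ⟨ξ, hξ, rfl⟩
  · exact Or.inr ⟨_, mem_psum_om.2 ⟨m, ξ, hm, hξ, rfl⟩, (blockOf_eq hg hm hξ).symm⟩

/-- The lists for all blocks are concatenated. Within a block the properties come from `Blk`, while
dominance of leading arguments settles comparisons between different blocks. `J` identifies `D^γ(S)`
for the sum `S` with all of `D(lex g)`, because block `0` and the image of `S` exhaust `lex g`. -/
theorem isPsiFixedPoint_psum {d : M} (hd : (PD.ofSet d).Led)
    (hB : ∀ n, n ∊ (om : M) → Blk g d emp n (ap g (suc n)) (blockFun g d emp n)) :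
    ((PD.ofSet d).shift (ap g emp)).IsPsiFixedPoint (psum g om) := by
  have H := split_sum hg
  have hS := ord_psum_om hg
  have hlin := hd.pred.ext_linear (lex_good hg)
  obtain ⟨f, hf, hfJ⟩ := H.exists_inverse (PD.ofSet d)
  -- the value at `x`, as an element of the extension to the blocks
  let G : M → M := fun x => blockFun g d emp (sU (fst (blockOf g x))) (snd (blockOf g x))
  -- The index `x` lies in block `n + 1` while the listed element has its leading argument in block
  -- `n`, hence the predecessor `sU`.
  have hG : ∀ {n ξ}, n ∊ om → ξ ∊ ap g (suc n) →
      G (oadd (psum g n) ξ) = blockFun g d emp n ξ := fun {n ξ} hn hξ => by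
    show blockFun g d emp (sU (fst (blockOf g _))) (snd (blockOf g _)) = _
    rw [blockOf_eq hg hn hξ, fst_pr, snd_pr, sU_suc (trans_nat hn)]
  have hfin : ∀ {z}, XCar g d z → ∀ y, y ∊ snd z → (lex g).car y := by
    rintro _ ⟨σ, a, k, e, rfl, hE, -⟩ y hy
    rw [snd_pr] at hy
    exact hE.sub hy
  have inv : ∀ {z}, XCar g d z → ((((PD.ofSet d).shift (ap g emp)).ext (LO.ofOrd (psum g om))).car
      (f z) ∧ J (LO.ofOrd (psum g om)) (fun ξ => pr emp ξ) (blockOf g) (f z) = z) := fun {z} hz =>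
    hfJ z hz fun y hy => blocks_cases hg (hfin hz y hy)
  have Gcand : ∀ {n ξ}, n ∊ om → ξ ∊ ap g (suc n) → Cand g d emp n ξ (G (oadd (psum g n) ξ)) :=
    fun hn hξ => by
      rw [hG hn hξ]
      exact (hB _ hn).1 _ hξ
  have Gcar : ∀ {x}, x ∊ psum g om → XCar g d (G x) := fun {x} hx => by
    obtain ⟨n, ξ, hn, hξ, rfl⟩ := mem_psum_om.1 hx
    exact (Gcand hn hξ).1
  have lead_lt : ∀ {m n ξ ζ z w}, m ∊ n → XLead g d z (pr m ξ) → XLead g d w (pr n ζ) →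
      XLt g d z w := fun hmn hz hw =>
    hd.larg_lt (lex_good hg) ((xLead_iff hd).1 hz) ((xLead_iff hd).1 hw) (lex_lt.2 (Or.inl hmn))
  have Glt : ∀ {x y}, x ∊ psum g om → y ∊ psum g om → x ∊ y → XLt g d (G x) (G y) := by
    intro x y hx hy hxy
    obtain ⟨m, ξ, hm, hξ, rfl⟩ := mem_psum_om.1 hx
    obtain ⟨n, ζ, hn, hζ, rfl⟩ := mem_psum_om.1 hy
    rcases (psum_lt_iff hg hm hn hξ hζ).1 hxy with h | ⟨rfl, h⟩
    · obtain ⟨-, ⟨_, _, h1⟩, -⟩ := Gcand hm hξ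
      obtain ⟨-, ⟨_, _, h2⟩, -⟩ := Gcand hn hζ
      exact lead_lt h h1 h2
    · rw [hG hm hξ, hG hm hζ]
      exact (hB m hm).2.1 ζ hζ ξ h
  have hGf : PR M fun x => f (G x) := by fun_prop
  have ap_π : ∀ {x}, x ∊ psum g om → ap (gr (psum g om) fun x => f (G x)) x = f (G x) :=
    fun hx => ap_gr hGf hx
  refine ⟨hS, gr (psum g om) fun x => f (G x), (LO.emb_iff fun x => Iff.rfl).2
    ⟨ext fun z => ?_, fun x hx => ?_, fun x y hx hy hxy => ?_⟩, fun α β σ a h hα => ?_,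
    fun σ a hτ hlt => ?_⟩
  · rw [mem_gr hGf, mem_gr (by fun_prop)]
    exact exists_congr fun v => and_congr_right fun hv => by rw [ap_π hv]
  · rw [ap_π hx]
    exact (inv (Gcar hx)).1
  · rw [ap_π hx, ap_π hy, ← H.J_lt hd.pred (inv (Gcar hx)).1 (inv (Gcar hy)).1, (inv (Gcar hx)).2,
      (inv (Gcar hy)).2]
    exact Glt hx hy hxy
  · obtain ⟨hβ, he⟩ := (pr_mem_gr hGf).1 h
    have hz := inv (Gcar hβ)
    have hα' : α ∊ snd (f (G β)) := by rw [← he, snd_pr]; exact hα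
    have hαS : α ∊ psum g om := by
      obtain ⟨ρ, c, k, e, h, hE, -⟩ := hz.1
      rw [h, snd_pr] at hα'
      exact hE.sub hα'
    have hm := (H.mem_supp_v hz.1 hαS).2 hα'
    rw [hz.2] at hm
    obtain ⟨n, ξ, hn, hξ, rfl⟩ := mem_psum_om.1 hβ
    obtain ⟨m, ζ, hm', hζ, rfl⟩ := mem_psum_om.1 hαS
    rw [blockOf_eq hg hm' hζ] at hm
    have := (Gcand hn hξ).2.2 _ hm
    simp only [fst_pr, snd_pr] at this
    -- Arguments in the blocks up to `n` belong to earlier summands. In block `n + 1` the bound is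
    -- the index `ξ` itself, so the argument is again smaller than `β`.
    rcases this with ⟨h, -⟩ | ⟨h, h'⟩
    · rcases mem_suc.1 h with h | h
      · exact psum_lt ((ord_nat hn).trans h (mem_suc_self m)) hζ
      · exact psum_lt (h ▸ mem_suc_self m) hζ
    · obtain rfl := suc_inj h
      exact oadd_mem h'
  · set τ := pr σ a with hτe
    have hw : XCar g d (J (LO.ofOrd (psum g om)) (fun ξ => pr emp ξ) (blockOf g) τ) := H.J_car hτ
    set w := J (LO.ofOrd (psum g om)) (fun ξ => pr emp ξ) (blockOf g) τ with hwe
    have below : ∀ {x}, x ∊ psum g om → blockOf g x ∊ snd w → XLt g d (G x) w := fun {x} hx hm => by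
      have hxa := (H.mem_supp_v hτ hx).1 hm
      rw [hτe, snd_pr] at hxa
      have := hlt x _ hxa ((pr_mem_gr hGf).2 ⟨hx, rfl⟩)
      rw [← H.J_lt hd.pred (inv (Gcar hx)).1 hτ, (inv (Gcar hx)).2] at this
      exact this
    obtain ⟨y, hy⟩ := hd.exists_larg hw
    obtain ⟨n, ζ, hn, hζ, rfl⟩ := lex_dest hy.arg_car
    have hl := (xLead_iff hd).2 hy
    have hc : Cand g d emp n (ap g (suc n)) w := by
      refine ⟨hw, ⟨ζ, hζ, hl⟩, fun y hy => ?_⟩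
      rcases blocks_cases hg (hfin hw y hy) with ⟨ξ, hξ, rfl⟩ | ⟨x, hx, rfl⟩
      · rw [fst_pr]
        exact Or.inl ⟨emp_mem_suc hn, notMem_emp⟩
      · have hGw := below hx hy
        obtain ⟨m, ξ, hm, hξ, rfl⟩ := mem_psum_om.1 hx
        rw [blockOf_eq hg hm hξ, fst_pr, snd_pr]
        rcases (ord_nat hm).trichotomy (ord_nat hn) with h | rfl | h
        · exact Or.inl ⟨suc_mem_suc (ord_nat hn) h, notMem_emp⟩
        · exact Or.inr ⟨rfl, hξ⟩
        -- The argument is in block `m + 1` with `m > n`. The value at it has its leading argument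
        -- in block `m` and thus exceeds `w`, contrary to the assumption that `w` is above the
        -- values at its arguments.
        · obtain ⟨hGc, ⟨_, _, h1⟩, -⟩ := Gcand hm hξ
          exact (hlin.asymm hw hGc (lead_lt h hl h1) hGw).elim
    obtain ⟨β, hβ, h⟩ := (hB n hn).2.2 w hw.dom hc fun α hα hm => by
      rw [← hG hn hα]
      refine below (mem_psum_om.2 ⟨n, α, hn, hα, rfl⟩) ?_
      rwa [blockOf_eq hg hn hα]
    have hβS := mem_psum_om.2 ⟨n, β, hn, hβ, rfl⟩
    refine ⟨_, (pr_mem_gr hGf).2 ⟨hβS, ?_⟩⟩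
    refine H.J_inj hd.pred hτ (inv (Gcar hβS)).1 ?_
    rw [(inv (Gcar hβS)).2, hG hn hβ]
    exact h

end Sum

end PRS

end

/-- Read "for every model `M` of `PRSω`" as "provably in `PRSω`". Here `d` codes the dilator `D`, and
`g` is the sequence of the ordinals `γ(n)`. -/
theorem mainTheorem7 {M : Type u} [PRSModel M] (d γ g : M)
    (hD : (PRS.PD.ofSet d).IsDilator)
    (hconn : (PRS.PD.ofSet d).IsConnected)
    (hone : ¬ (PRS.PD.ofSet d).IsOne)
    (hγ : PRS.IsOrd γ)
    (hg : PRS.IsSeq g PRS.om)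
    (hg_zero : PRSModel.mem (PRS.pr PRS.emp γ) g)
    (hg_succ : ∀ n : M, PRSModel.mem n PRS.om → ∃ e c x : M,
      PRSModel.mem (PRS.pr n c) g ∧ PRSModel.mem (PRS.pr (PRS.suc n) x) g ∧
      PRS.PD.IterPlus d g n e ∧ ((PRS.PD.ofSet e).minus c).IsPsiFixedPoint x) :
    ∃ S : M, PRS.IsOrdSum g S ∧
      ∀ Ω : M, ((PRS.PD.ofSet d).shift γ).IsPsiFixedPoint Ω ↔ Ω = S := by
  have hap : ∀ n, PRSModel.mem n PRS.om → PRSModel.mem (PRS.pr n (PRS.ap g n)) g ∧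
      ∀ c, PRSModel.mem (PRS.pr n c) g → c = PRS.ap g n := fun n hn => by
    obtain ⟨y, hy, hu⟩ := hg.2 n hn
    have : PRS.ap g n = y := PRS.ap_eq hy hu
    rw [this]
    exact ⟨hy, hu⟩
  have hfp : ∀ n, PRSModel.mem n PRS.om → ∃ e, PRS.PD.IterPlus d g n e ∧
      ((PRS.PD.ofSet e).minus (PRS.ap g n)).IsPsiFixedPoint (PRS.ap g (PRS.suc n)) := fun n hn => by
    obtain ⟨e, c, x, hc, hx, he, hp⟩ := hg_succ n hn
    obtain rfl := (hap n hn).2 c hc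
    obtain rfl := (hap _ (PRS.suc_mem_om hn)).2 x hx
    exact ⟨e, he, hp⟩
  have hord : ∀ n, PRSModel.mem n PRS.om → PRS.IsOrd (PRS.ap g n) := fun n hn => by
    rcases PRS.mem_om.1 hn with rfl | ⟨m, hm, rfl⟩
    · rwa [← (hap _ hn).2 γ hg_zero]
    · obtain ⟨e, -, hp⟩ := hfp m hm
      exact hp.1
  have hLed := PRS.PD.led_of_connected hD.1 (PRS.PD.def_ofSet d) hconn hone
  -- The separate embeddings for the individual `n` are replaced by values of one primitive
  -- recursive function, so that they can be put together in a single set.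
  have hB : ∀ n, PRSModel.mem n PRS.om →
      PRS.Blk g d PRS.emp n (PRS.ap g (PRS.suc n)) (PRS.blockFun g d PRS.emp n) := fun n hn => by
    obtain ⟨e, ⟨s, hs, hs0, hse, hsuc⟩, hp⟩ := hfp n hn
    exact PRS.blk_blockFun hord hLed hn hs hs0 hse hsuc (fun k hk => (hap k hk).1) hp
  have hS := PRS.isPsiFixedPoint_psum hord hLed hB
  rw [← (hap _ PRS.emp_mem_om).2 γ hg_zero] at hS
  refine ⟨PRS.psum g PRS.om, PRS.isOrdSum_psum hord hg fun n hn => (hap n hn).1, fun Ω =>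
    ⟨fun h => PRS.PD.psi_unique (hD.1.shift hγ) h hS, ?_⟩⟩
  rintro rfl
  exact hS
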